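/- Let $Q$ be an $r$-dimensional smooth manifold without boundary (Hausdorff and second countable) and let $H\colon [0,1]\times T^*Q\to\mathbb{R}$ be a smooth, possibly time-dependent, Hamiltonian. Let $\theta=p_a\,du^a$ be the Liouville one-form on $T^*Q$, and equip $T^*Q\times T^*Q$ with the symplectic form $d\alpha$, where $\alpha=\mathrm{pr}_1^*\theta-\mathrm{pr}_2^*\theta$. Let $\mathcal{EL}$ be the set of curves $\chi=(u,p)\colon[0,1]\to T^*Q$ that solve Hamilton's equations $\dot u^a=\partial H/\partial p_a$, $\dot p_a=-\partial H/\partial u^a$ on $[0,1]$, and let $$\Pi(\mathcal{EL})=\{(\chi(1),\chi(0)) : \chi\in\mathcal{EL}\}\subset T^*Q\times T^*Q .$$ Suppose that the system is Dirichlet: for every $(u_0,u_1)\in Q\times Q$ there is exactly one $\chi=(u,p)\in\mathcal{EL}$ with $u(0)=u_0$ and $u(1)=u_1$. Define Hamilton's principal function $W\colon Q\times Q\to\mathbb{R}$ by $$W(u_0,u_1)=\int_0^1\big(p_a(t)\,\dot u^a(t)-H(t,u(t),p(t))\big)\,dt ,$$ where $\chi=(u,p)$ is that unique solution. Then $\Pi(\mathcal{EL})$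 is a Lagrangian submanifold of $(T^*Q\times T^*Q,d\alpha)$, that is, a smooth embedded submanifold of dimension $2r$ on which $d\alpha$ vanishes. Moreover $W$ is continuously differentiable and is a generating function of $\Pi(\mathcal{EL})$, that is, $\Pi(\mathcal{EL})$ is the graph of $dW$: $$\Pi(\mathcal{EL})=\Big\{\big((u_1,p_1),(u_0,p_0)\big) : p_1=\frac{\partial W}{\partial u_1}(u_0,u_1),\quad p_0=-\frac{\partial W}{\partial u_0}(u_0,u_1)\Big\}.$$ -/

import Mathlib

open Set Bundle
open scoped Manifold ContDiff

noncomputable section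

/-! ## Differential forms and Lagrangian submanifolds -/

section Forms

variable {F : Type*} [NormedAddCommGroup F] [NormedSpace ℝ F] {G : Type*} [TopologicalSpace G]
  (J : ModelWithCorners ℝ F G) {M : Type*} [TopologicalSpace M] [ChartedSpace G M]

/-- The local expression of the one-form `α` in the preferred chart `φ` at `x`, that is the
pull-back `(φ⁻¹)^* α`, a one-form on (the target of `φ` in) the model vector space. -/
def oneFormInChart (α : ∀ y : M, TangentSpace J y →L[ℝ] ℝ) (x : M) (ξ : F) : F →L[ℝ] ℝ :=
  (α ((extChartAt J x).symm ξ)).comp (mfderiv 𝓘(ℝ, F) J (extChartAt J x).symm ξ)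

/-- The exterior derivative of a one-form on a manifold without boundary:
`dα (v, w) = D_v α (w) - D_w α (v)`, computed in the preferred chart at `x`, through which
`TangentSpace J x` is identified with the model vector space. -/
def extDerivOneForm (α : ∀ y : M, TangentSpace J y →L[ℝ] ℝ) (x : M)
    (v w : TangentSpace J x) : ℝ :=
  fderiv ℝ (oneFormInChart J α x) (extChartAt J x x) v w -
    fderiv ℝ (oneFormInChart J α x) (extChartAt J x x) w v

/-- A chart `Φ` with domain around `x` in which `L` becomes the linear subspace `S`
(translated to pass through `Φ x`). -/
structure IsSliceChart (L : Set M) (x : M) (Φ : PartialDiffeomorph J 𝓘(ℝ, F) M F ∞)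
    (S : Submodule ℝ F) : Prop where
  mem_source : x ∈ Φ.source
  mem_iff : ∀ y ∈ Φ.source, y ∈ L ↔ Φ y - Φ x ∈ S

/-- `L` is a Lagrangian submanifold of `M` with respect to the two-form `Ω`: it is an embedded
smooth submanifold (every point of `L` has a slice chart) whose dimension is half the dimension
of `M`, and `Ω` vanishes on pairs of vectors tangent to `L`. In a slice chart `Φ` at `x` onto the
subspace `S`, the tangent space of `L` at `x` is the preimage of `S` under the differential
of `Φ` at `x`. -/
def IsLagrangianSubmanifold (Ω : ∀ x : M, TangentSpace J x → TangentSpace J x → ℝ)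
    (L : Set M) : Prop :=
  ∀ x ∈ L, ∃ (Φ : PartialDiffeomorph J 𝓘(ℝ, F) M F ∞) (S : Submodule ℝ F),
    IsSliceChart J L x Φ S ∧
    2 * Module.finrank ℝ S = Module.finrank ℝ F ∧
    ∀ v w : TangentSpace J x,
      mfderiv J 𝓘(ℝ, F) Φ x v ∈ S → mfderiv J 𝓘(ℝ, F) Φ x w ∈ S → Ω x v w = 0

end Forms

/-! ## The cotangent bundle of a manifold modelled on `ℝ^r` -/

section Cotangent

variable (r : ℕ) (Q : Type*) [TopologicalSpace Q] [ChartedSpace (EuclideanSpace ℝ (Fin r)) Q]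
  [IsManifold (𝓡 r) ∞ Q]

/-- The typical fibre `(ℝ^r)^*` of the cotangent bundle. -/
abbrev CotFiber : Type := EuclideanSpace ℝ (Fin r) →L[ℝ] ℝ

/-- The cotangent bundle `T^*Q`: its points are pairs `z = ⟨u, p⟩` with `u = z.proj` a point
of `Q` and `p = z.snd` a linear form on the tangent space of `Q` at `u`. -/
abbrev CotBundle : Type _ :=
  TotalSpace (CotFiber r) (fun u : Q ↦ TangentSpace (𝓡 r) u →L[ℝ] Trivial Q ℝ u)

/-- The model with corners of the manifold `T^*Q`; the model vector space is `ℝ^r × (ℝ^r)^*`. -/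
abbrev cotModel : ModelWithCorners ℝ (EuclideanSpace ℝ (Fin r) × CotFiber r)
    (ModelProd (EuclideanSpace ℝ (Fin r)) (CotFiber r)) :=
  (𝓡 r).prod 𝓘(ℝ, CotFiber r)

variable {r Q}

/-- The Liouville one-form `θ = p_a du^a` on `T^*Q`: `θ_z (v) = p (dπ v)` for `z = (u, p)`. -/
def liouvilleForm (z : CotBundle r Q) : TangentSpace (cotModel r) z →L[ℝ] ℝ :=
  ContinuousLinearMap.comp (show TangentSpace (𝓡 r) z.proj →L[ℝ] ℝ from z.snd)
    (mfderiv (cotModel r) (𝓡 r) (fun y : CotBundle r Q ↦ y.proj) z)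

/-- The canonical symplectic form `ω = dθ = dp_a ∧ du^a` on `T^*Q`. -/
def symplecticForm (z : CotBundle r Q) (v w : TangentSpace (cotModel r) z) : ℝ :=
  extDerivOneForm (cotModel r) liouvilleForm z v w

/-- The one-form `α = pr₁^* θ - pr₂^* θ = p_a(1) du^a(1) - p_a(0) du^a(0)` on `T^*Q × T^*Q`.
The first factor carries the data at time `1`, the second factor the data at time `0`. -/
def boundaryOneForm (z : CotBundle r Q × CotBundle r Q) :
    TangentSpace ((cotModel r).prod (cotModel r)) z →L[ℝ] ℝ :=
  ContinuousLinearMap.comp (liouvilleForm z.1)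
      (mfderiv ((cotModel r).prod (cotModel r)) (cotModel r) Prod.fst z) -
    ContinuousLinearMap.comp (liouvilleForm z.2)
      (mfderiv ((cotModel r).prod (cotModel r)) (cotModel r) Prod.snd z)

/-- The symplectic form `dα = pr₁^* ω - pr₂^* ω` on `T^*Q × T^*Q`. -/
def boundarySymplecticForm (z : CotBundle r Q × CotBundle r Q)
    (v w : TangentSpace ((cotModel r).prod (cotModel r)) z) : ℝ :=
  extDerivOneForm ((cotModel r).prod (cotModel r)) boundaryOneForm z v w

/-! ## Hamilton's equations -/

/-- `χ : [0,1] → T^*Q` solves Hamilton's equations of the time-dependent Hamiltonian `H`: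
`χ` is differentiable on `[0,1]` (one-sidedly at the end points) and its velocity `v` satisfies
`i_v ω = - dH(t, ·)`, which in canonical coordinates reads `u' = ∂H/∂p`, `p' = - ∂H/∂u`.
For a smooth `H` such curves are automatically smooth on `[0,1]`. Only the values of `χ`
on `[0,1]` matter. -/
def IsHamiltonSolution (H : ℝ → CotBundle r Q → ℝ) (χ : ℝ → CotBundle r Q) : Prop :=
  ∀ t ∈ Icc (0 : ℝ) 1, ∃ v : TangentSpace (cotModel r) (χ t),
    HasMFDerivWithinAt 𝓘(ℝ, ℝ) (cotModel r) χ (Icc 0 1) t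
      ((1 : ℝ →L[ℝ] ℝ).smulRight v) ∧
    ∀ w : TangentSpace (cotModel r) (χ t),
      symplecticForm (χ t) v w = - mfderiv (cotModel r) 𝓘(ℝ, ℝ) (H t) (χ t) w

/-- The set `Π(𝓔𝓛)` of boundary values `(χ(1), χ(0))` of the solutions of
Hamilton's equations on `[0,1]`. -/
def boundaryValues (H : ℝ → CotBundle r Q → ℝ) : Set (CotBundle r Q × CotBundle r Q) :=
  {z | ∃ χ : ℝ → CotBundle r Q, IsHamiltonSolution H χ ∧ z = (χ 1, χ 0)}

/-- The Dirichlet assumption: for all `u₀, u₁` there is a solution of Hamilton's equations on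
`[0,1]` with `u(0) = u₀` and `u(1) = u₁`, and any two such solutions agree on `[0,1]`. -/
def IsDirichlet (H : ℝ → CotBundle r Q → ℝ) : Prop :=
  ∀ u₀ u₁ : Q,
    (∃ χ, IsHamiltonSolution H χ ∧ (χ 0).proj = u₀ ∧ (χ 1).proj = u₁) ∧
    ∀ χ χ', IsHamiltonSolution H χ → (χ 0).proj = u₀ → (χ 1).proj = u₁ →
      IsHamiltonSolution H χ' → (χ' 0).proj = u₀ → (χ' 1).proj = u₁ →
      EqOn χ χ' (Icc 0 1)

/-- The velocity `u'(t)` of the projection `u = π ∘ χ` of a curve `χ` in `T^*Q`,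
for `t ∈ [0,1]`. -/
def baseVelocity (χ : ℝ → CotBundle r Q) (t : ℝ) : TangentSpace (𝓡 r) (χ t).proj :=
  mfderivWithin 𝓘(ℝ, ℝ) (𝓡 r) (fun s ↦ (χ s).proj) (Icc 0 1) t (1 : ℝ)

/-- The action `S(χ) = ∫₀¹ (p · u' - H(t, u, p)) dt`. -/
def action (H : ℝ → CotBundle r Q → ℝ) (χ : ℝ → CotBundle r Q) : ℝ :=
  ∫ t in (0 : ℝ)..1, ((χ t).snd (baseVelocity χ t) - H t (χ t))

/-- Hamilton's principal function `W(u₀, u₁)` of a Dirichlet system: the action of the solution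
of Hamilton's equations with end points `u₀` and `u₁`. -/
def principalFunction {H : ℝ → CotBundle r Q → ℝ} (hD : IsDirichlet H) (u : Q × Q) : ℝ :=
  action H (hD u.1 u.2).1.choose

/-- The graph of `dW` for a function `W(u₀, u₁)` on `Q × Q`, as a subset of `T^*Q × T^*Q`:
the pairs `(z₁, z₀) = ((u₁, p₁), (u₀, p₀))` with `dW = p₁ du₁ - p₀ du₀` at `(u₀, u₁)`, that is
`p₁ = ∂W/∂u₁` and `p₀ = - ∂W/∂u₀`. -/
def graphOfDifferential (W : Q × Q → ℝ) : Set (CotBundle r Q × CotBundle r Q) :=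
  {z | ∀ (a : TangentSpace (𝓡 r) z.2.proj) (b : TangentSpace (𝓡 r) z.1.proj),
    mfderiv ((𝓡 r).prod (𝓡 r)) 𝓘(ℝ, ℝ) W (z.2.proj, z.1.proj) (a, b) =
      z.1.snd b - z.2.snd a}

end Cotangent

end

/-! By uniqueness for Hamilton's equations, Π(𝓔𝓛) is, near the boundary values of a given solution,
the graph of the time evolution φ on an open set of initial values. There φ and the action A depend
smoothly on the initial value, and the first variation formula reads dA = φ^*θ - θ
(`IsCanonicalOneForm.exists_isActionFlow`). Hence pr₁^*θ - pr₂^*θ pulls back to the exact form dA on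
the graph, and the graph is Lagrangian (`IsActionFlow.exists_isSliceChart`).

For W, consider the end point map f : (u₀, p₀) ↦ (u₀, u₁). The Dirichlet condition makes f
injective, W ∘ f = A, and dA = P ∘ df with P = p₁ du₁ - p₀ du₀. If df were invertible, dW = P ∘ f⁻¹
would follow from the chain rule. But injectivity of f leaves room for critical points, as for x ↦
x³, and there the chain rule says nothing about W.

The core is therefore `hasFDerivAt_of_comp_eq_of_injOn`: for an injective C¹ map f between spaces of
equal dimension, W ∘ f = S and dS = P ∘ df imply dW = P ∘ f⁻¹, also at critical values. It is proved
with weak derivatives. The Jacobian of a compactly supported C¹ map has integral zero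
(`integral_det_fderiv_eq_zero`). Comparing f with f + h e for h = S · (ψ ∘ f) gives ∫ (ψ(f) P e + S
dψ(f) e) det Df = 0. A change of variables turns this into an integral over the image, weighted by
the sign of det Df. For S = 1 and P = 0 it says that this sign has weak derivative zero, so it is
locally almost everywhere constant. The constant is not zero, because an injective C¹ map has a
regular point in every open set (`exists_det_fderiv_ne_zero`). So f is open
(`exists_ball_subset_image`), the sign cancels, and the continuous function W has the continuous
weak derivative P ∘ f⁻¹, which mollification upgrades to a classical one.

Smooth dependence on initial values comes from the inverse function theorem in the Banach space of
continuous curves, applied to the integral equation on short intervals inside one chart. The pieces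
are concatenated, and the identities dA = φ^*θ - θ add up.

Finally Π(𝓔𝓛) lies in the graph of dW by the formula for dW. Conversely, a point of the graph has
the same end points as some solution, and dW determines the momenta. -/

/-! ### The determinant as a top coefficient -/

section DetWeights

variable {E : Type*} [NormedAddCommGroup E] [NormedSpace ℝ E] [FiniteDimensional ℝ E]

open Polynomial in
/-- The determinant is the leading coefficient of `t ↦ det (1 + t A)`, recovered by Lagrange
interpolation. -/
theorem exists_det_eq_sum_det_one_add (hn : 1 ≤ Module.finrank ℝ E) {τ : ℝ} (hτ : τ ≠ 0) :
    ∃ w : ℕ → ℝ, ∑ i ∈ Finset.range (Module.finrank ℝ E + 1), w i = 0 ∧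
      ∀ A : E →L[ℝ] E, A.det = ∑ i ∈ Finset.range (Module.finrank ℝ E + 1),
        w i * (ContinuousLinearMap.id ℝ E + (τ * i) • A).det := by
  classical
  set n := Module.finrank ℝ E with hn'
  set s := Finset.range (n + 1) with hs
  have hinj : Set.InjOn (fun i : ℕ ↦ τ * (i : ℝ)) s := by
    intro i _ j _ hij
    exact_mod_cast mul_left_cancel₀ hτ hij
  have hcard : s.card = n + 1 := by simp [hs]
  -- The weights of the divided difference of order n at the nodes τ i: they extract the coefficient
  -- of t^n from any polynomial of degree at most n.
  let w : ℕ → ℝ := fun i ↦ (∏ j ∈ s.erase i, (τ * (i : ℝ) - τ * (j : ℝ)))⁻¹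
  have key : ∀ P : ℝ[X], P.natDegree ≤ n → P.coeff n = ∑ i ∈ s, w i * P.eval (τ * i) := by
    intro P hP
    have h := Lagrange.coeff_eq_sum (P := P) hinj (by
      rw [hcard]
      exact lt_of_le_of_lt Polynomial.degree_le_natDegree (by exact_mod_cast Nat.lt_succ_of_le hP))
    rw [hcard, Nat.add_sub_cancel] at h
    rw [h]
    refine Finset.sum_congr rfl fun i _ ↦ ?_
    simp only [w, div_eq_inv_mul]
  refine ⟨w, ?_, fun A ↦ ?_⟩
  -- Since n ≥ 1, the constant polynomial 1 has coefficient 0 in degree n.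
  · have := key 1 (by simp)
    rw [Polynomial.coeff_one, if_neg (by lia)] at this
    simpa using this.symm
  · let b := Module.finBasis ℝ E
    let M := LinearMap.toMatrix b b (A : E →ₗ[ℝ] E)
    have hdeg := Polynomial.natDegree_det_X_add_C_le M 1
    have hco := Polynomial.coeff_det_X_add_C_card M 1
    rw [Fintype.card_fin] at hdeg hco
    have hA : A.det = M.det := (LinearMap.det_toMatrix b _).symm
    rw [hA, ← hco, key _ hdeg]
    refine Finset.sum_congr rfl fun i _ ↦ ?_
    congr 1
    have h1 : (ContinuousLinearMap.id ℝ E + (τ * i) • A).det =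
        (1 + (τ * i : ℝ) • M).det := by
      have : (ContinuousLinearMap.id ℝ E + (τ * i) • A).det = _ :=
        (LinearMap.det_toMatrix b (ContinuousLinearMap.id ℝ E + (τ * i) • A : E →L[ℝ] E)).symm
      rw [this]
      congr 1
      simp [M]
    have h2 : (Polynomial.eval (τ * (i : ℝ)) ((X : ℝ[X]) • M.map C + (1 : Matrix _ _ ℝ).map C).det) =
        (1 + (τ * i : ℝ) • M).det := by
      rw [← Polynomial.coe_evalRingHom, RingHom.map_det]
      congr 1
      ext a c
      rcases eq_or_ne a c with rfl | hac
      · simp; ring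
      · simp [hac]; ring
    rw [h1, h2]

end DetWeights

/-! ### Integrals of Jacobian determinants -/

section Degree

open MeasureTheory

variable {E : Type*} [NormedAddCommGroup E] [NormedSpace ℝ E] [FiniteDimensional ℝ E]
  [MeasurableSpace E] [BorelSpace E] (μ : Measure E) [μ.IsAddHaarMeasure]

/-- A small compactly supported perturbation of the identity preserves the volume of the support of
the perturbation. -/
theorem setIntegral_det_id_add_smul_fderiv {g : E → E} (hg : ContDiff ℝ 1 g)
    {C : NNReal} (hC : LipschitzWith C g) {t : NNReal}
    (htC : t * C < 1)
    (hpos : ∀ x, 0 < (ContinuousLinearMap.id ℝ E + (t : ℝ) • fderiv ℝ g x).det) :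
    ∫ x in tsupport g, (ContinuousLinearMap.id ℝ E + (t : ℝ) • fderiv ℝ g x).det ∂μ =
      μ.real (tsupport g) := by
  set K := tsupport g
  let h : E → E := fun x ↦ x + (t : ℝ) • g x
  have hh : ∀ x, HasFDerivAt h (ContinuousLinearMap.id ℝ E + (t : ℝ) • fderiv ℝ g x) x := fun x ↦
    (hasFDerivAt_id x).add (((hg.differentiable one_ne_zero) x).hasFDerivAt.const_smul (t : ℝ))
  -- h differs from the identity by a map with Lipschitz constant t C < 1, hence is a bijection of
  -- E.
  have happ : ApproximatesLinearOn h ((ContinuousLinearEquiv.refl ℝ E : E ≃L[ℝ] E) : E →L[ℝ] E)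
      univ (t * C) := by
    intro x _ y _
    have : h x - h y - ((ContinuousLinearEquiv.refl ℝ E : E ≃L[ℝ] E) : E →L[ℝ] E) (x - y) =
        (t : ℝ) • (g x - g y) := by
      simp [h, smul_sub]; abel
    rw [this, norm_smul, Real.norm_of_nonneg t.coe_nonneg]
    have := hC.dist_le_mul x y
    rw [dist_eq_norm, dist_eq_norm] at this
    calc (t : ℝ) * ‖g x - g y‖ ≤ t * (C * ‖x - y‖) := by gcongr
      _ = _ := by simp [mul_assoc]
  have hcond : Subsingleton E ∨ t * C <
      ‖((ContinuousLinearEquiv.refl ℝ E).symm : E →L[ℝ] E)‖₊⁻¹ := by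
    rcases subsingleton_or_nontrivial E with hs | hs
    · exact Or.inl hs
    · right
      have : ‖((ContinuousLinearEquiv.refl ℝ E).symm : E →L[ℝ] E)‖₊ = 1 := by
        ext; exact ContinuousLinearMap.norm_id
      rw [this, inv_one]
      exact htC
  have hinj : Function.Injective h := injOn_univ.1 (happ.injOn hcond)
  have hsurj : Function.Surjective h := happ.surjective hcond
  have hout : ∀ x, x ∉ K → h x = x := fun x hx ↦ by
    simp [h, image_eq_zero_of_notMem_tsupport hx]
  -- The bijection h fixes every point outside K, so it also permutes K; the change of variables
  -- formula then gives the volume of K.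
  have himg : h '' K = K := by
    apply Subset.antisymm
    · rintro _ ⟨x, hx, rfl⟩
      by_contra hx'
      exact hx' (by rwa [hinj (hout _ hx')])
    · intro y hy
      obtain ⟨x, rfl⟩ := hsurj y
      by_cases hx : x ∈ K
      · exact ⟨x, hx, rfl⟩
      · exact absurd (hout x hx ▸ hy) hx
  have hKm : MeasurableSet K := (isClosed_tsupport g).measurableSet
  have := integral_image_eq_integral_abs_det_fderiv_smul μ hKm
    (fun x _ ↦ (hh x).hasFDerivWithinAt) hinj.injOn (fun _ ↦ (1 : ℝ))
  rw [himg] at this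
  simp only [smul_eq_mul, mul_one, integral_const, MeasurableSet.univ, measureReal_restrict_apply,
    univ_inter] at this
  rw [this]
  exact integral_congr_ae (Filter.Eventually.of_forall fun x ↦ (abs_of_pos (hpos x)).symm)

/-- The Jacobian determinant of a compactly supported map has vanishing integral. -/
theorem integral_det_fderiv_eq_zero (hn : 1 ≤ Module.finrank ℝ E) {g : E → E}
    (hg : ContDiff ℝ 1 g) (hc : HasCompactSupport g) :
    ∫ x, (fderiv ℝ g x).det ∂μ = 0 := by
  have hDc : Continuous (fderiv ℝ g) := hg.continuous_fderiv one_ne_zero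
  obtain ⟨C₀, hC₀⟩ := hDc.bounded_above_of_compact_support (hc.fderiv ℝ)
  have hC₀' : 0 ≤ C₀ := (norm_nonneg _).trans (hC₀ 0)
  let C : NNReal := ⟨C₀, hC₀'⟩
  have hlip : LipschitzWith C g :=
    lipschitzWith_of_nnnorm_fderiv_le (hg.differentiable one_ne_zero) fun x ↦ hC₀ x
  obtain ⟨δ, hδ, hδ'⟩ : ∃ δ > 0, ∀ B : E →L[ℝ] E, ‖B - ContinuousLinearMap.id ℝ E‖ < δ →
      0 < B.det := by
    have h1 : ∀ᶠ B : E →L[ℝ] E in nhds (ContinuousLinearMap.id ℝ E), 0 < B.det := by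
      refine (ContinuousLinearMap.continuous_det (𝕜 := ℝ) (E := E)).continuousAt.eventually
        (lt_mem_nhds ?_)
      simp [ContinuousLinearMap.det]
    obtain ⟨δ, hδ, h⟩ := Metric.eventually_nhds_iff.1 h1
    exact ⟨δ, hδ, fun B hB ↦ h (by rwa [dist_eq_norm])⟩
  set n := Module.finrank ℝ E with hn'
  have hnpos : (0 : ℝ) < n := by exact_mod_cast hn
  -- Chosen so that τ i C₀ < min δ 1 for all i ≤ n: the bound 1 makes id + τ i g bijective, the
  -- bound δ keeps its Jacobian positive.
  let τ : ℝ := min δ 1 / (2 * n * (C₀ + 1))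
  have hm : 0 < min δ 1 := lt_min hδ one_pos
  have hτ : 0 < τ := by positivity
  have hsmall : ∀ i ∈ Finset.range (n + 1), τ * i * C₀ < min δ 1 := by
    intro i hi
    have hi' : (i : ℝ) ≤ n := by exact_mod_cast Nat.lt_succ_iff.1 (Finset.mem_range.1 hi)
    calc τ * i * C₀ ≤ τ * n * (C₀ + 1) := by gcongr; linarith
      _ = min δ 1 / 2 := by simp only [τ]; field_simp
      _ < min δ 1 := by linarith
  -- For each i ≤ n the integral of det (1 + τ i Dg) over the support is the volume of the support,
  -- so the combination with weights of sum zero vanishes.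
  obtain ⟨w, hw, hdet⟩ := exists_det_eq_sum_det_one_add (E := E) hn hτ.ne'
  have hzero : ∀ x, x ∉ tsupport g → (fderiv ℝ g x).det = 0 := by
    intro x hx
    rw [image_eq_zero_of_notMem_tsupport (fun h ↦ hx (tsupport_fderiv_subset ℝ h))]
    have : (0 : E →L[ℝ] E).det = LinearMap.det (0 : E →ₗ[ℝ] E) := rfl
    rw [this, LinearMap.det_zero, zero_pow (by lia)]
  rw [← setIntegral_eq_integral_of_forall_compl_eq_zero hzero]
  have hcont : ∀ i : ℕ, Continuous
      fun x ↦ (ContinuousLinearMap.id ℝ E + (τ * i) • fderiv ℝ g x).det := fun i ↦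
    ContinuousLinearMap.continuous_det.comp (continuous_const.add (hDc.fun_const_smul _))
  rw [integral_congr_ae (Filter.Eventually.of_forall fun x ↦ hdet (fderiv ℝ g x))]
  rw [integral_finsetSum _ fun i _ ↦
    (((hcont i).const_mul (w i)).continuousOn.integrableOn_compact hc)]
  have : ∀ i ∈ Finset.range (n + 1),
      ∫ x in tsupport g, w i * (ContinuousLinearMap.id ℝ E + (τ * i) • fderiv ℝ g x).det ∂μ =
        w i * μ.real (tsupport g) := by
    intro i hi
    have hti : 0 ≤ τ * i := by positivity
    rw [integral_const_mul]
    congr 1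
    refine setIntegral_det_id_add_smul_fderiv μ hg hlip (t := ⟨τ * i, hti⟩) ?_ ?_
    · exact NNReal.coe_lt_coe.1 ((hsmall i hi).trans_le (min_le_right _ _))
    · intro x
      apply hδ'
      change ‖_ + (τ * i) • _ - _‖ < δ
      rw [add_sub_cancel_left, norm_smul, Real.norm_of_nonneg hti]
      calc τ * i * ‖fderiv ℝ g x‖ ≤ τ * i * C₀ := by gcongr; exact hC₀ x
        _ < δ := (hsmall i hi).trans_le (min_le_left _ _)
  rw [Finset.sum_congr rfl this, ← Finset.sum_mul, hw, zero_mul]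

/-- Adding `h e`, where `dh` factors through `df`, to `f` does not change the integral of the
Jacobian determinant. -/
theorem setIntegral_apply_mul_det_fderiv_eq_zero {f : E → E} {x₀ : E} {ρ R : ℝ} (hρ : 0 < ρ)
    (hρR : ρ < R) (hf : ContDiffOn ℝ 1 f (Metric.ball x₀ R)) {h : E → ℝ} (hh : ContDiff ℝ 1 h)
    {K : Set E} (hK : IsCompact K) (hKρ : K ⊆ Metric.ball x₀ ρ) (hhK : tsupport h ⊆ K)
    (ν : E → E →L[ℝ] ℝ) (hν : ∀ x ∈ K, fderiv ℝ h x = (ν x).comp (fderiv ℝ f x)) (e : E) :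
    ∫ x in K, ν x e * (fderiv ℝ f x).det ∂μ = 0 := by
  rcases Nat.eq_zero_or_pos (Module.finrank ℝ E) with hn | hn
  · have : Subsingleton E := Module.finrank_zero_iff.1 hn
    simp [Subsingleton.elim e 0]
  -- The cut-off makes f compactly supported and leaves it unchanged on the ball of radius ρ, which
  -- contains K. Then f₁ and f₁ + h e both have Jacobians of integral zero.
  let χ : ContDiffBump x₀ := ⟨ρ, (ρ + R) / 2, hρ, by linarith⟩
  have hball : ∀ x ∈ Metric.ball x₀ R, ContDiffAt ℝ 1 f x := fun x hx ↦
    hf.contDiffAt (Metric.isOpen_ball.mem_nhds hx)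
  let f₁ : E → E := fun x ↦ χ x • f x
  have hsupp : tsupport f₁ ⊆ Metric.closedBall x₀ ((ρ + R) / 2) :=
    (tsupport_smul_subset_left χ f).trans χ.tsupport_eq.subset
  have hf₁ : ContDiff ℝ 1 f₁ := by
    rw [contDiff_iff_contDiffAt]
    intro x
    by_cases hx : x ∈ Metric.ball x₀ R
    · exact χ.contDiffAt.smul (hball x hx)
    · have : f₁ =ᶠ[nhds x] fun _ ↦ 0 := by
        refine notMem_tsupport_iff_eventuallyEq.1 fun hx' ↦ hx ?_
        have := Metric.mem_closedBall.1 (hsupp hx')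
        exact Metric.mem_ball.2 (by linarith)
      exact contDiffAt_const.congr_of_eventuallyEq this
  have hf₁c : HasCompactSupport f₁ :=
    (isCompact_closedBall x₀ _).of_isClosed_subset (isClosed_tsupport _) hsupp
  let g : E → E := fun x ↦ f₁ x + h x • e
  have hg : ContDiff ℝ 1 g := hf₁.add (hh.smul contDiff_const)
  have hhc : HasCompactSupport h := hK.of_isClosed_subset (isClosed_tsupport _) hhK
  have hgc : HasCompactSupport g := hf₁c.add (hhc.smul_right)
  have hDg : ∀ x, fderiv ℝ g x = fderiv ℝ f₁ x + (fderiv ℝ h x).smulRight e := fun x ↦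
    (((hf₁.differentiable one_ne_zero) x).hasFDerivAt.add
      (((hh.differentiable one_ne_zero) x).hasFDerivAt.smul_const e)).fderiv
  have hDf : ∀ x ∈ K, fderiv ℝ f₁ x = fderiv ℝ f x := by
    intro x hx
    apply Filter.EventuallyEq.fderiv_eq
    filter_upwards [Metric.isOpen_ball.mem_nhds (hKρ hx)] with y hy
    simp [f₁, χ.one_of_mem_closedBall (Metric.ball_subset_closedBall hy)]
  have hcg : Continuous fun x ↦ (fderiv ℝ g x).det :=
    ContinuousLinearMap.continuous_det.comp (hg.continuous_fderiv one_ne_zero)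
  have hcf : Continuous fun x ↦ (fderiv ℝ f₁ x).det :=
    ContinuousLinearMap.continuous_det.comp (hf₁.continuous_fderiv one_ne_zero)
  have hdet0 : (0 : E →L[ℝ] E).det = 0 := by
    have : (0 : E →L[ℝ] E).det = LinearMap.det (0 : E →ₗ[ℝ] E) := rfl
    rw [this, LinearMap.det_zero, zero_pow (by lia)]
  have hig : Integrable (fun x ↦ (fderiv ℝ g x).det) μ :=
    hcg.integrable_of_hasCompactSupport ((hgc.fderiv ℝ).comp_left hdet0)
  have hif : Integrable (fun x ↦ (fderiv ℝ f₁ x).det) μ :=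
    hcf.integrable_of_hasCompactSupport ((hf₁c.fderiv ℝ).comp_left hdet0)
  have hsub : ∫ x, ((fderiv ℝ g x).det - (fderiv ℝ f₁ x).det) ∂μ = 0 := by
    rw [integral_sub hig hif, integral_det_fderiv_eq_zero μ hn hg hgc,
      integral_det_fderiv_eq_zero μ hn hf₁ hf₁c, sub_zero]
  rw [← setIntegral_eq_integral_of_forall_compl_eq_zero (s := K)] at hsub
  · rw [← hsub]
    refine setIntegral_congr_fun hK.measurableSet fun x hx ↦ ?_
    -- On K, Dg is Df followed by the rank-one perturbation 1 + ν ⊗ e of the identity, so det Dg -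
    -- det Df = ν(e) det Df.
    have h1 : fderiv ℝ g x =
        (ContinuousLinearMap.id ℝ E + (ν x).smulRight e).comp (fderiv ℝ f x) := by
      rw [hDg, hDf x hx, hν x hx]
      ext v
      simp
    have h2 : (ContinuousLinearMap.id ℝ E + (ν x).smulRight e).det = 1 + ν x e :=
      LinearMap.transvection.det (ν x : E →ₗ[ℝ] ℝ) e
    have h3 : (fderiv ℝ g x).det = (1 + ν x e) * (fderiv ℝ f x).det := by
      rw [h1, ← h2]
      exact LinearMap.det_comp _ _
    rw [h3, hDf x hx]
    ring
  · intro x hx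
    have : fderiv ℝ h x = 0 :=
      image_eq_zero_of_notMem_tsupport fun hx' ↦ hx (hhK (tsupport_fderiv_subset ℝ hx'))
    simp [hDg, this]

/-- The weak form of `dW = p`, where `W ∘ f = S` and `dS = P ∘ df`, multiplied by the sign of the
Jacobian determinant of `f`. -/
theorem setIntegral_test_mul_det_fderiv_eq_zero {f : E → E} {x₀ : E} {ρ R : ℝ} (hρ : 0 < ρ)
    (hρR : ρ < R) (hf : ContDiffOn ℝ 1 f (Metric.ball x₀ R)) {S : E → ℝ}
    (hS : ContDiffOn ℝ 1 S (Metric.ball x₀ R)) {P : E → E →L[ℝ] ℝ}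
    (hP : ∀ x ∈ Metric.ball x₀ R, fderiv ℝ S x = (P x).comp (fderiv ℝ f x))
    {ψ : E → ℝ} (hψ : ContDiff ℝ 1 ψ) 
    (hψs : ∀ x ∈ Metric.sphere x₀ ρ, f x ∉ tsupport ψ) (e : E) :
    ∫ x in Metric.closedBall x₀ ρ,
      (ψ (f x) * P x e + S x * fderiv ℝ ψ (f x) e) * (fderiv ℝ f x).det ∂μ = 0 := by
  set B := Metric.closedBall x₀ ρ
  have hBR : B ⊆ Metric.ball x₀ R := Metric.closedBall_subset_ball hρR
  let K : Set E := B ∩ f ⁻¹' (tsupport ψ)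
  have hfB : ContinuousOn f B := hf.continuousOn.mono hBR
  have hK : IsCompact K := (isCompact_closedBall x₀ ρ).of_isClosed_subset
    (hfB.preimage_isClosed_of_isClosed Metric.isClosed_closedBall (isClosed_tsupport ψ))
    inter_subset_left
  have hKρ : K ⊆ Metric.ball x₀ ρ := by
    rintro x ⟨hxB, hx⟩
    rcases (Metric.mem_closedBall.1 hxB).lt_or_eq with h | h
    · exact h
    · exact absurd hx (hψs x h)
  have hψ0 : ∀ x ∈ B, x ∉ K → ψ (f x) = 0 ∧ fderiv ℝ ψ (f x) = 0 := by
    intro x hx hxK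
    have hx' : f x ∉ tsupport ψ := fun h ↦ hxK ⟨hx, h⟩
    exact ⟨image_eq_zero_of_notMem_tsupport hx',
      image_eq_zero_of_notMem_tsupport fun h ↦ hx' (tsupport_fderiv_subset ℝ h)⟩
  -- ψ ∘ f vanishes near the sphere, so S · (ψ ∘ f) on the ball extends by zero to a C¹ function on
  -- E. On K its differential is (ψ(f) P + S dψ(f)) ∘ df.
  let h : E → ℝ := (Metric.ball x₀ ρ).indicator fun x ↦ S x * ψ (f x)
  have hloc : ∀ x ∈ Metric.ball x₀ ρ, h =ᶠ[nhds x] fun x ↦ S x * ψ (f x) := fun x hx ↦ by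
    filter_upwards [Metric.isOpen_ball.mem_nhds hx] with y hy
    exact indicator_of_mem hy _
  have hoff : ∀ x ∉ K, h x = 0 := by
    intro x hx
    by_cases hxb : x ∈ Metric.ball x₀ ρ
    · simp [h, hxb, (hψ0 x (Metric.ball_subset_closedBall hxb) hx).1]
    · exact indicator_of_notMem hxb _
  have hh : ContDiff ℝ 1 h := by
    rw [contDiff_iff_contDiffAt]
    intro x
    by_cases hx : x ∈ Metric.ball x₀ ρ
    · have hxR := Metric.isOpen_ball.mem_nhds (hBR (Metric.ball_subset_closedBall hx))
      exact ((hS.contDiffAt hxR).mul (hψ.contDiffAt.comp x (hf.contDiffAt hxR))).congr_of_eventuallyEq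
        (hloc x hx)
    · refine contDiffAt_const (c := (0 : ℝ)) |>.congr_of_eventuallyEq ?_
      filter_upwards [hK.isClosed.isOpen_compl.mem_nhds fun hxK ↦ hx (hKρ hxK)] with y hy
      exact hoff y hy
  have hhK : tsupport h ⊆ K := closure_minimal
    (fun x hx ↦ by_contra fun hxK ↦ hx (hoff x hxK)) hK.isClosed
  have hmain := setIntegral_apply_mul_det_fderiv_eq_zero μ hρ hρR hf hh hK hKρ hhK
    (fun x ↦ ψ (f x) • P x + S x • fderiv ℝ ψ (f x)) (by
      intro x hx
      have hxR := Metric.isOpen_ball.mem_nhds (hBR hx.1)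
      rw [(hloc x (hKρ hx)).fderiv_eq]
      have h1 : HasFDerivAt S ((P x).comp (fderiv ℝ f x)) x := by
        rw [← hP x (hBR hx.1)]
        exact ((hS.contDiffAt hxR).differentiableAt one_ne_zero).hasFDerivAt
      have h2 : HasFDerivAt (fun x ↦ ψ (f x)) ((fderiv ℝ ψ (f x)).comp (fderiv ℝ f x)) x :=
        ((hψ.differentiable one_ne_zero) (f x)).hasFDerivAt.comp x
          ((hf.contDiffAt hxR).differentiableAt one_ne_zero).hasFDerivAt
      refine (h1.fun_mul h2).fderiv.trans ?_
      ext v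
      simp
      ring) e
  rw [← hmain]
  refine setIntegral_eq_of_subset_of_forall_sdiff_eq_zero Metric.isClosed_closedBall.measurableSet
    inter_subset_left fun x hx ↦ ?_
  obtain ⟨h1, h2⟩ := hψ0 x hx.1 hx.2
  simp [h1, h2]

end Degree

/-! ### Regular points of injective C¹ maps -/

section ConstantRank

variable {E : Type*} [NormedAddCommGroup E] [NormedSpace ℝ E] [FiniteDimensional ℝ E]

/-- The differential of an injective `C¹` map between spaces of the same dimension is somewhere
invertible. -/
theorem exists_det_fderiv_ne_zero {f : E → E} {U : Set E} (hU : IsOpen U) (hne : U.Nonempty)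
    (hf : ContDiffOn ℝ 1 f U) (hinj : InjOn f U) : ∃ x ∈ U, (fderiv ℝ f x).det ≠ 0 := by
  by_contra! hdet
  let rk : E → ℕ := fun x ↦ Module.finrank ℝ (fderiv ℝ f x : E →ₗ[ℝ] E).range
  -- Near a point of maximal rank the rank is constant. If it is not full, f is constant on curves
  -- transverse to the rank directions, against injectivity.
  obtain ⟨x₁, hx₁, hmax⟩ : ∃ x₁ ∈ U, ∀ x ∈ U, rk x ≤ rk x₁ := by
    have hfin : (rk '' U).Finite :=
      (Set.finite_le_nat (Module.finrank ℝ E)).subset (by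
        rintro _ ⟨x, _, rfl⟩
        exact Submodule.finrank_le _)
    obtain ⟨_, ⟨x₁, hx₁, rfl⟩, h⟩ := hfin.exists_maximal (hne.image rk)
    exact ⟨x₁, hx₁, fun x hx ↦ (le_total (rk x) (rk x₁)).elim id fun h' ↦
      h (mem_image_of_mem rk hx) h'⟩
  let A := fderiv ℝ f x₁
  let V : Submodule ℝ E := (A : E →ₗ[ℝ] E).range
  let N : Submodule ℝ E := (A : E →ₗ[ℝ] E).ker
  obtain ⟨a₀, ha₀⟩ := V.subtype.exists_leftInverse_of_injective V.ker_subtype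
  obtain ⟨b₀, hb₀⟩ := N.subtype.exists_leftInverse_of_injective N.ker_subtype
  let prV : E →L[ℝ] V := LinearMap.toContinuousLinearMap a₀
  let prN : E →L[ℝ] N := LinearMap.toContinuousLinearMap b₀
  have ha : ∀ v : V, prV v = v := fun v ↦ LinearMap.congr_fun ha₀ v
  have hb : ∀ v : N, prN v = v := fun v ↦ LinearMap.congr_fun hb₀ v
  have hdiff : ∀ x ∈ U, ContDiffAt ℝ 1 f x := fun x hx ↦ hf.contDiffAt (hU.mem_nhds hx)
  -- The component of f in the range of Df(x₁), together with the component of x in its kernel, is a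
  -- coordinate system near x₁.
  let F : E → V × N := fun x ↦ (prV (f x), prN x)
  have hFd : ∀ x ∈ U, HasFDerivAt F ((prV.comp (fderiv ℝ f x)).prod prN) x := fun x hx ↦
    (prV.hasFDerivAt.comp x ((hdiff x hx).differentiableAt one_ne_zero).hasFDerivAt).prodMk
      prN.hasFDerivAt
  have hFc : ContDiffAt ℝ 1 F x₁ :=
    (prV.contDiff.contDiffAt.comp x₁ (hdiff x₁ hx₁)).prodMk prN.contDiff.contDiffAt
  have hinjF : Function.Injective (((prV.comp A).prod prN : E →L[ℝ] V × N) : E →ₗ[ℝ] V × N) := by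
    rw [← LinearMap.ker_eq_bot, LinearMap.ker_eq_bot']
    intro v hv
    have h1 : prV (A v) = 0 := congrArg Prod.fst hv
    have h2 : prN v = 0 := congrArg Prod.snd hv
    have h3 : A v = 0 := by
      have := ha ⟨A v, ⟨v, rfl⟩⟩
      rw [h1] at this
      exact (congrArg Subtype.val this).symm
    have := hb ⟨v, h3⟩
    rw [h2] at this
    exact (congrArg Subtype.val this).symm
  have hrank : Module.finrank ℝ E = Module.finrank ℝ (V × N) := by
    rw [Module.finrank_prod]
    exact (LinearMap.finrank_range_add_finrank_ker (A : E →ₗ[ℝ] E)).symm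
  let Φ : E ≃L[ℝ] V × N :=
    (LinearEquiv.ofInjectiveOfFinrankEq _ hinjF hrank).toContinuousLinearEquiv
  have hΦ : HasFDerivAt F (Φ : E →L[ℝ] V × N) x₁ := hFd x₁ hx₁
  let e := hFc.toOpenPartialHomeomorph F hΦ one_ne_zero
  have hx₁e : x₁ ∈ e.source := hFc.mem_toOpenPartialHomeomorph_source hΦ one_ne_zero
  have heF : ∀ x, e x = F x := fun _ ↦ rfl
  have hG : ContDiffAt ℝ 1 e.symm (F x₁) := hFc.to_localInverse hΦ one_ne_zero
  have hGx : e.symm (F x₁) = x₁ := e.left_inv hx₁e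
  have hNe : ∃ k₀ : N, k₀ ≠ 0 := by
    have : Nontrivial N := by
      rw [Submodule.nontrivial_iff_ne_bot]
      exact (LinearMap.bot_lt_ker_of_det_eq_zero (hdet x₁ hx₁)).ne'
    exact exists_ne 0
  obtain ⟨k₀, hk₀⟩ := hNe
  have hev : ∀ᶠ y in nhds (F x₁), y ∈ e.target ∧ e.symm y ∈ U ∧ DifferentiableAt ℝ e.symm y := by
    filter_upwards [e.open_target.mem_nhds (e.map_source hx₁e),
      hG.continuousAt.preimage_mem_nhds (by rw [hGx]; exact hU.mem_nhds hx₁),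
      hG.eventually (by simp)] with y h1 h2 h3
    exact ⟨h1, h2, h3.differentiableAt one_ne_zero⟩
  obtain ⟨δ, hδ, hball⟩ := Metric.eventually_nhds_iff_ball.1 hev
  -- A line on which only the kernel coordinate moves.
  let ℓ : ℝ → V × N := fun t ↦ F x₁ + t • (0, k₀)
  have hℓc : Continuous ℓ := by fun_prop
  have hℓd : ∀ t, HasDerivAt ℓ (0, k₀) t := fun t ↦ by
    have := ((hasDerivAt_id t).smul_const ((0, k₀) : V × N)).const_add (F x₁)
    rwa [one_smul] at this
  have hℓ0 : ℓ 0 = F x₁ := by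
    change F x₁ + (0 : ℝ) • _ = _
    rw [zero_smul, add_zero]
  obtain ⟨η, hη, hηb⟩ : ∃ η > 0, ∀ t ∈ Metric.ball (0 : ℝ) η, ℓ t ∈ Metric.ball (F x₁) δ :=
    Metric.eventually_nhds_iff_ball.1
      (hℓc.continuousAt.preimage_mem_nhds (by rw [hℓ0]; exact Metric.ball_mem_nhds _ hδ))
  have hderiv : ∀ t ∈ Metric.ball (0 : ℝ) η,
      HasDerivWithinAt (fun t ↦ f (e.symm (ℓ t))) 0 (Metric.ball 0 η) t := by
    intro t ht
    obtain ⟨hy, hyU, hyd⟩ := hball _ (hηb t ht)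
    set x := e.symm (ℓ t)
    set G' := fderiv ℝ e.symm (ℓ t)
    have hcomp : ((prV.comp (fderiv ℝ f x)).prod prN).comp G' = ContinuousLinearMap.id ℝ (V × N) := by
      refine HasFDerivAt.unique (f := fun y ↦ F (e.symm y)) (x := ℓ t)
        (HasFDerivAt.comp (g := F) (f := e.symm) (ℓ t) (hFd x hyU) hyd.hasFDerivAt) ?_
      refine (hasFDerivAt_id (ℓ t)).congr_of_eventuallyEq ?_
      filter_upwards [e.open_target.mem_nhds hy] with y hy
      exact e.right_inv hy
    have hcomp' : ∀ y, prV (fderiv ℝ f x (G' y)) = y.1 := fun y ↦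
      congrArg Prod.fst (DFunLike.congr_fun hcomp y)
    let W : Submodule ℝ E := (fderiv ℝ f x : E →ₗ[ℝ] E).range
    let aW : W →ₗ[ℝ] V := (prV : E →ₗ[ℝ] V).comp W.subtype
    have hsurj : Function.Surjective aW := fun v ↦
      ⟨⟨fderiv ℝ f x (G' (v, 0)), ⟨_, rfl⟩⟩, hcomp' (v, 0)⟩
    -- `prV` maps the range of Df(x) onto V; maximality of the rank at x₁ makes it injective there.
    -- So a direction with prV (Df v) = 0 satisfies Df v = 0.
    have hfr : Module.finrank ℝ W = Module.finrank ℝ V :=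
      le_antisymm (hmax x hyU) (LinearMap.finrank_le_finrank_of_surjective hsurj)
    have hinjW : Function.Injective aW :=
      (LinearMap.injective_iff_surjective_of_finrank_eq_finrank hfr).2 hsurj
    have hzero : fderiv ℝ f x (G' (0, k₀)) = 0 := by
      have : (⟨fderiv ℝ f x (G' (0, k₀)), ⟨_, rfl⟩⟩ : W) = 0 :=
        hinjW ((hcomp' (0, k₀)).trans (map_zero aW).symm)
      exact congrArg Subtype.val this
    have h1 : HasDerivAt (fun t ↦ e.symm (ℓ t)) (G' (0, k₀)) t :=
      hyd.hasFDerivAt.comp_hasDerivAt t (hℓd t)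
    have h2 := ((hdiff x hyU).differentiableAt one_ne_zero).hasFDerivAt.comp_hasDerivAt t h1
    rw [hzero] at h2
    exact h2.hasDerivWithinAt
  have h0 : (0 : ℝ) ∈ Metric.ball (0 : ℝ) η := Metric.mem_ball_self hη
  have h1 : η / 2 ∈ Metric.ball (0 : ℝ) η := by
    rw [mem_ball_zero_iff, Real.norm_of_nonneg (by linarith)]
    linarith
  have hconst := (convex_ball (0 : ℝ) η).norm_image_sub_le_of_norm_hasDerivWithin_le hderiv
    (C := 0) (by simp) h0 h1
  rw [zero_mul, norm_le_zero_iff, sub_eq_zero] at hconst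
  have heq := hinj (hball _ (hηb _ h1)).2.1 (hball _ (hηb _ h0)).2.1 hconst
  have heq' := e.symm.injOn (hball _ (hηb _ h1)).1 (hball _ (hηb _ h0)).1 heq
  have : (η / 2) • k₀ = 0 := by simpa [ℓ] using heq'
  exact hk₀ ((smul_eq_zero.1 this).resolve_left (by positivity))

end ConstantRank

/-! ### From weak to classical derivatives -/

section Mollify

open MeasureTheory Filter Topology

/-- A bump function of radius tending to `0`. -/
noncomputable def shrinkingBump {E : Type*} [NormedAddCommGroup E] (i : ℕ) : ContDiffBump (0 : E) :=
  ⟨1 / (2 * ((i : ℝ) + 1)), 1 / ((i : ℝ) + 1), by positivity, by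
    apply one_div_lt_one_div_of_lt <;> linarith [(Nat.cast_nonneg i : (0 : ℝ) ≤ i)]⟩

theorem tendsto_shrinkingBump_rOut {E : Type*} [NormedAddCommGroup E] :
    Tendsto (fun i ↦ (shrinkingBump (E := E) i).rOut) atTop (𝓝 0) :=
  tendsto_one_div_add_atTop_nhds_zero_nat

variable {E : Type*} [NormedAddCommGroup E] [NormedSpace ℝ E] [FiniteDimensional ℝ E]
  [MeasurableSpace E] [BorelSpace E] (μ : Measure E) [μ.IsAddHaarMeasure]

open scoped Convolution

/-- A mollification of a function with weak derivative `p` on a ball has derivative the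
mollification of `p`. -/
theorem hasFDerivAt_normed_convolution {g : E → ℝ} {p : E → E →L[ℝ] ℝ}
    (hg : LocallyIntegrable g μ) (hp : LocallyIntegrable p μ) {y₀ : E} {r : ℝ}
    (hweak : ∀ ψ : E → ℝ, ContDiff ℝ 1 ψ → tsupport ψ ⊆ Metric.ball y₀ r → ∀ e : E,
      ∫ y, (ψ y * p y e + g y * fderiv ℝ ψ y e) ∂μ = 0)
    (φ : ContDiffBump (0 : E)) (hφ : φ.rOut < r / 2) {x : E} (hx : x ∈ Metric.ball y₀ (r / 2)) :
    HasFDerivAt (φ.normed μ ⋆[ContinuousLinearMap.lsmul ℝ ℝ, μ] g : E → ℝ)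
      ((φ.normed μ ⋆[ContinuousLinearMap.lsmul ℝ ℝ, μ] p : E → E →L[ℝ] ℝ) x) x := by
  have hφ1 : ContDiff ℝ 1 (φ.normed μ) := φ.contDiff_normed
  have hφc : HasCompactSupport (φ.normed μ) := φ.hasCompactSupport_normed
  have h := hφc.hasFDerivAt_convolution_left (ContinuousLinearMap.lsmul ℝ ℝ) hφ1 hg x (μ := μ)
  suffices H : ((φ.normed μ ⋆[ContinuousLinearMap.lsmul ℝ ℝ, μ] p : E → E →L[ℝ] ℝ) x) =
      ((fderiv ℝ (φ.normed μ) ⋆[(ContinuousLinearMap.lsmul ℝ ℝ).precompL E, μ] g :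
        E → E →L[ℝ] ℝ) x) by
    rw [H]
    exact h
  ext e
  -- Tested against the reflected kernel, the weak identity becomes the equality of the two
  -- convolutions at x. The kernel radius is below r / 2, so the support stays in the ball.
  let ψ : E → ℝ := fun y ↦ φ.normed μ (x - y)
  have hψ : ContDiff ℝ 1 ψ := hφ1.comp (contDiff_const.sub contDiff_id)
  have hψs : tsupport ψ ⊆ Metric.ball y₀ r := by
    have h1 : tsupport ψ ⊆ Metric.closedBall x φ.rOut := by
      refine closure_minimal (fun y hy ↦ ?_) Metric.isClosed_closedBall
      have : x - y ∈ Function.support (φ.normed μ) := hy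
      rw [φ.support_normed_eq, mem_ball_zero_iff, ← dist_eq_norm, dist_comm] at this
      exact this.le
    refine h1.trans fun y hy ↦ ?_
    have := Metric.mem_closedBall.1 hy
    have := Metric.mem_ball.1 hx
    have := dist_triangle y x y₀
    exact Metric.mem_ball.2 (by linarith)
  have hw := hweak ψ hψ hψs e
  have hψd : ∀ y e, fderiv ℝ ψ y e = - fderiv ℝ (φ.normed μ) (x - y) e := fun y e ↦ by
    have h1 : HasFDerivAt (fun y : E ↦ x - y) (-ContinuousLinearMap.id ℝ E) y :=
      (hasFDerivAt_id y).const_sub x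
    have h2 : HasFDerivAt ψ _ y :=
      ((hφ1.differentiable one_ne_zero) (x - y)).hasFDerivAt.comp y h1
    rw [h2.fderiv]
    simp
  have hψc : HasCompactSupport ψ := (isCompact_closedBall y₀ r).of_isClosed_subset
    (isClosed_tsupport _) (hψs.trans Metric.ball_subset_closedBall)
  have hpi : Integrable (fun y ↦ ψ y • p y) μ :=
    hp.integrable_smul_left_of_hasCompactSupport hψ.continuous hψc
  have hgi : Integrable (fun y ↦ g y • fderiv ℝ ψ y) μ :=
    hg.integrable_smul_right_of_hasCompactSupport (hψ.continuous_fderiv one_ne_zero) (hψc.fderiv ℝ)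
  have hpe : Integrable (fun y ↦ ψ y * p y e) μ := by
    simpa using hpi.apply_continuousLinearMap e
  have hge : Integrable (fun y ↦ g y * fderiv ℝ ψ y e) μ := by
    simpa using hgi.apply_continuousLinearMap e
  rw [integral_add hpe hge] at hw
  have hex1 : ((φ.normed μ ⋆[ContinuousLinearMap.lsmul ℝ ℝ, μ] p : E → E →L[ℝ] ℝ) x) e =
      ∫ y, ψ y * p y e ∂μ := by
    rw [convolution_eq_swap]
    rw [ContinuousLinearMap.integral_apply (by simpa using hpi)]
    simp [ψ]
  have hex2 : ((fderiv ℝ (φ.normed μ) ⋆[(ContinuousLinearMap.lsmul ℝ ℝ).precompL E, μ] g :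
      E → E →L[ℝ] ℝ) x) e = - ∫ y, g y * fderiv ℝ ψ y e ∂μ := by
    rw [convolution_eq_swap, ContinuousLinearMap.integral_apply, ← integral_neg]
    · refine integral_congr_ae (Eventually.of_forall fun y ↦ ?_)
      simp [hψd, ContinuousLinearMap.precompL_apply, mul_comm]
    · refine hgi.neg.congr (Eventually.of_forall fun y ↦ ?_)
      ext v
      simp [ContinuousLinearMap.precompL_apply, mul_comm, hψd]
  rw [hex1, hex2]
  linarith

/-- A locally integrable function with vanishing weak derivative on a ball is almost everywhere
constant on the concentric ball of half the radius. -/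
theorem ae_eq_const_of_weak_deriv_eq_zero {g : E → ℝ} (hg : LocallyIntegrable g μ) {y₀ : E} {r : ℝ}
    (hweak : ∀ ψ : E → ℝ, ContDiff ℝ 1 ψ → tsupport ψ ⊆ Metric.ball y₀ r → ∀ e : E,
      ∫ y, g y * fderiv ℝ ψ y e ∂μ = 0) :
    ∃ c : ℝ, ∀ᵐ y ∂μ, y ∈ Metric.ball y₀ (r / 2) → g y = c := by
  rcases le_or_gt r 0 with hr | hr
  · exact ⟨0, Eventually.of_forall fun y hy ↦ by
      rw [Metric.ball_eq_empty.2 (by linarith)] at hy; exact hy.elim⟩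
  let w : ℕ → E → ℝ := fun i ↦
    ((shrinkingBump (E := E) i).normed μ ⋆[ContinuousLinearMap.lsmul ℝ ℝ, μ] g : E → ℝ)
  -- Almost everywhere convergence needs a bounded ratio of outer to inner radii; for these bumps it
  -- is 2.
  have hae : ∀ᵐ y ∂μ, Tendsto (fun i ↦ w i y) atTop (𝓝 (g y)) :=
    ContDiffBump.ae_convolution_tendsto_right_of_locallyIntegrable tendsto_shrinkingBump_rOut
      (K := 2) (Eventually.of_forall fun i ↦ by
        simp only [shrinkingBump]; field_simp; exact le_rfl) hg
  have hconst : ∀ᶠ i in atTop, ∀ y ∈ Metric.ball y₀ (r / 2), w i y = w i y₀ := by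
    filter_upwards [(tendsto_shrinkingBump_rOut (E := E)).eventually (gt_mem_nhds (half_pos hr))]
      with i hi y hy
    have hd : ∀ x ∈ Metric.ball y₀ (r / 2),
        HasFDerivWithinAt (w i) (0 : E →L[ℝ] ℝ) (Metric.ball y₀ (r / 2)) x := by
      intro x hx
      have := hasFDerivAt_normed_convolution μ hg (p := fun _ ↦ 0)
        (integrable_zero E (E →L[ℝ] ℝ) μ).locallyIntegrable
        (fun ψ h1 h2 e ↦ by simpa using hweak ψ h1 h2 e) _ hi hx
      have hz : (((shrinkingBump (E := E) i).normed μ ⋆[ContinuousLinearMap.lsmul ℝ ℝ, μ]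
          (fun _ ↦ 0 : E → E →L[ℝ] ℝ) : E → E →L[ℝ] ℝ) x) = 0 := by
        rw [show (fun _ ↦ 0 : E → E →L[ℝ] ℝ) = 0 from rfl, convolution_zero]
        rfl
      rw [hz] at this
      exact this.hasFDerivWithinAt
    have := (convex_ball y₀ (r / 2)).norm_image_sub_le_of_norm_hasFDerivWithin_le hd (C := 0)
      (by simp) (Metric.mem_ball_self (half_pos hr)) hy
    rwa [zero_mul, norm_le_zero_iff, sub_eq_zero] at this
  have hlim : ∀ y ∈ Metric.ball y₀ (r / 2), Tendsto (fun i ↦ w i y) atTop (𝓝 (g y)) →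
      Tendsto (fun i ↦ w i y₀) atTop (𝓝 (g y)) := fun y hy h ↦
    h.congr' (hconst.mono fun i hi ↦ hi y hy)
  refine ⟨limUnder atTop fun i ↦ w i y₀, ?_⟩
  filter_upwards [hae] with y hy hyb
  exact (hlim y hyb hy).limUnder_eq.symm

/-- A continuous function with weak derivative `p` on a ball has derivative `p x₁` at points `x₁`
where `p` is continuous. -/
theorem hasFDerivAt_of_weak_deriv {g : E → ℝ} {p : E → E →L[ℝ] ℝ}
    (hg : LocallyIntegrable g μ) (hp : LocallyIntegrable p μ) {y₀ : E} {r : ℝ} (hr : 0 < r)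
    (hweak : ∀ ψ : E → ℝ, ContDiff ℝ 1 ψ → tsupport ψ ⊆ Metric.ball y₀ r → ∀ e : E,
      ∫ y, (ψ y * p y e + g y * fderiv ℝ ψ y e) ∂μ = 0)
    (hgc : ∀ᶠ y in 𝓝 y₀, ContinuousAt g y) (hpc : ContinuousAt p y₀) :
    HasFDerivAt g (p y₀) y₀ := by
  rw [hasFDerivAt_iff_isLittleO, Asymptotics.isLittleO_iff]
  intro ε hε
  obtain ⟨δ₁, hδ₁, h₁⟩ := Metric.continuousAt_iff.1 hpc ε hε
  -- δ ≤ r / 2 allows differentiating the mollifications. 2 δ ≤ δ₁ is needed because their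
  -- derivative at a point of the δ-ball averages p over a second ball of radius below δ.
  set δ := min δ₁ r / 2 with hδ
  have hδ0 : 0 < δ := half_pos (lt_min hδ₁ hr)
  have hδr : δ ≤ r / 2 := by rw [hδ]; gcongr; exact min_le_right _ _
  have hδδ : δ + δ ≤ δ₁ := by rw [hδ]; linarith [min_le_left δ₁ r]
  let w : ℕ → E → ℝ := fun i ↦
    ((shrinkingBump (E := E) i).normed μ ⋆[ContinuousLinearMap.lsmul ℝ ℝ, μ] g : E → ℝ)
  have hlim : ∀ y, ContinuousAt g y → Tendsto (fun i ↦ w i y) atTop (𝓝 (g y)) := fun y hy ↦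
    ContDiffBump.convolution_tendsto_right tendsto_shrinkingBump_rOut
      (Eventually.of_forall fun _ ↦ hg.aestronglyMeasurable)
      (hy.tendsto.comp tendsto_snd) tendsto_const_nhds
  filter_upwards [hgc, Metric.ball_mem_nhds y₀ hδ0] with y hy hyδ
  -- For all large i the derivative of the mollification is within ε of p y₀ on the whole δ-ball, so
  -- the mean value estimate does not depend on i and survives the limit.
  have hbound : ∀ᶠ i in atTop, ‖w i y - w i y₀ - p y₀ (y - y₀)‖ ≤ ε * ‖y - y₀‖ := by
    filter_upwards [(tendsto_shrinkingBump_rOut (E := E)).eventually (gt_mem_nhds hδ0)] with i hi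
    refine (convex_ball y₀ δ).norm_image_sub_le_of_norm_hasFDerivWithin_le' (f' := fun x ↦
      ((shrinkingBump (E := E) i).normed μ ⋆[ContinuousLinearMap.lsmul ℝ ℝ, μ] p :
        E → E →L[ℝ] ℝ) x) (fun x hx ↦ ?_) (fun x hx ↦ ?_) (Metric.mem_ball_self hδ0) hyδ
    · exact (hasFDerivAt_normed_convolution μ hg hp hweak _ (hi.trans_le hδr)
        (Metric.ball_subset_ball hδr hx)).hasFDerivWithinAt
    · rw [← dist_eq_norm]
      refine dist_convolution_le hε.le
        (shrinkingBump (E := E) i).support_normed_eq.subset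
        (shrinkingBump (E := E) i).nonneg_normed
        (shrinkingBump (E := E) i).integral_normed hp.aestronglyMeasurable fun z hz ↦ ?_
      refine (h₁ ?_).le
      have := Metric.mem_ball.1 hz
      have := Metric.mem_ball.1 hx
      have := dist_triangle z x y₀
      linarith
  have h2 : Tendsto (fun i ↦ ‖w i y - w i y₀ - p y₀ (y - y₀)‖) atTop
      (𝓝 ‖g y - g y₀ - p y₀ (y - y₀)‖) :=
    (((hlim y hy).sub (hlim y₀ hgc.self_of_nhds)).sub_const _).norm
  exact le_of_tendsto h2 hbound

end Mollify

/-! ### The sign of the Jacobian and openness of injective C¹ maps -/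

section OpenMapping

open MeasureTheory Filter Topology

/-- A continuous map from a compact set to a Hausdorff space is closed. -/
theorem continuousOn_invFunOn_image {X Y : Type*} [TopologicalSpace X] [TopologicalSpace Y] [T2Space Y]
    [Nonempty X] {f : X → Y} {B : Set X} (hB : IsCompact B)
    (hf : ContinuousOn f B) (hinj : InjOn f B) : ContinuousOn (Function.invFunOn f B) (f '' B) := by
  rw [continuousOn_iff_isClosed]
  intro C hC
  refine ⟨f '' (B ∩ C), ((hB.inter_right hC).image_of_continuousOn
    (hf.mono inter_subset_left)).isClosed, ?_⟩
  ext y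
  constructor
  · rintro ⟨hy, x, hx, rfl⟩
    rw [mem_preimage, hinj.leftInvOn_invFunOn hx] at hy
    exact ⟨⟨x, ⟨hx, hy⟩, rfl⟩, ⟨x, hx, rfl⟩⟩
  · rintro ⟨⟨x, ⟨hx, hxC⟩, rfl⟩, -⟩
    exact ⟨by rwa [mem_preimage, hinj.leftInvOn_invFunOn hx], ⟨x, hx, rfl⟩⟩

variable {E : Type*} [NormedAddCommGroup E] [NormedSpace ℝ E] 

/-- The sign of the Jacobian determinant of `f`, transported to the image of `B`. -/
noncomputable def imageSign (f : E → E) (B : Set E) (y : E) : ℝ :=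
  (f '' {x ∈ B | 0 < (fderiv ℝ f x).det}).indicator 1 y -
    (f '' {x ∈ B | (fderiv ℝ f x).det < 0}).indicator 1 y

theorem imageSign_of_pos {f : E → E} {B : Set E} (hf : InjOn f B) {x : E} (hx : x ∈ B)
    (h : 0 < (fderiv ℝ f x).det) : imageSign f B (f x) = 1 := by
  have h1 : f x ∈ f '' {x ∈ B | 0 < (fderiv ℝ f x).det} := mem_image_of_mem f ⟨hx, h⟩
  have h2 : f x ∉ f '' {x ∈ B | (fderiv ℝ f x).det < 0} := by
    rintro ⟨y, ⟨hy, hy'⟩, hyx⟩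
    rw [hf hy hx hyx] at hy'
    exact lt_asymm h hy'
  simp [imageSign, indicator_of_mem h1, indicator_of_notMem h2]

theorem imageSign_of_neg {f : E → E} {B : Set E} (hf : InjOn f B) {x : E} (hx : x ∈ B)
    (h : (fderiv ℝ f x).det < 0) : imageSign f B (f x) = -1 := by
  have h1 : f x ∈ f '' {x ∈ B | (fderiv ℝ f x).det < 0} := mem_image_of_mem f ⟨hx, h⟩
  have h2 : f x ∉ f '' {x ∈ B | 0 < (fderiv ℝ f x).det} := by
    rintro ⟨y, ⟨hy, hy'⟩, hyx⟩
    rw [hf hy hx hyx] at hy'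
    exact lt_asymm h hy'
  simp [imageSign, indicator_of_mem h1, indicator_of_notMem h2]

theorem imageSign_of_notMem {f : E → E} {B : Set E} {y : E} (hy : y ∉ f '' B) :
    imageSign f B y = 0 := by
  have h1 : y ∉ f '' {x ∈ B | (fderiv ℝ f x).det < 0} := fun h ↦
    hy (image_mono (fun _ hx ↦ hx.1) h)
  have h2 : y ∉ f '' {x ∈ B | 0 < (fderiv ℝ f x).det} := fun h ↦
    hy (image_mono (fun _ hx ↦ hx.1) h)
  simp [imageSign, indicator_of_notMem h1, indicator_of_notMem h2]

variable [FiniteDimensional ℝ E]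
  [MeasurableSpace E] [BorelSpace E] (μ : Measure E) [μ.IsAddHaarMeasure]

variable {f : E → E} {U B : Set E}

theorem measurableSet_image_det (hU : IsOpen U) (hf : ContDiffOn ℝ 1 f U) (hB : IsCompact B)
    (hBU : B ⊆ U) (hinj : InjOn f B) {J : Set ℝ} (hJ : IsOpen J) :
    MeasurableSet {x ∈ B | (fderiv ℝ f x).det ∈ J} ∧
      MeasurableSet (f '' {x ∈ B | (fderiv ℝ f x).det ∈ J}) := by
  have hd : ContinuousOn (fun x ↦ (fderiv ℝ f x).det) U :=
    ContinuousLinearMap.continuous_det.comp_continuousOn (hf.continuousOn_fderiv_of_isOpen hU le_rfl)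
  have h1 : {x ∈ B | (fderiv ℝ f x).det ∈ J} =
      B ∩ (U ∩ (fun x ↦ (fderiv ℝ f x).det) ⁻¹' J) := by
    ext x
    exact ⟨fun h ↦ ⟨h.1, hBU h.1, h.2⟩, fun h ↦ ⟨h.1, h.2.2⟩⟩
  have h2 : MeasurableSet {x ∈ B | (fderiv ℝ f x).det ∈ J} := by
    rw [h1]
    exact hB.measurableSet.inter (hd.isOpen_inter_preimage hU hJ).measurableSet
  refine ⟨h2, h2.image_of_continuousOn_injOn (hf.continuousOn.mono fun x hx ↦ hBU hx.1)
    (hinj.mono fun x hx ↦ hx.1)⟩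

/-- Change of variables, applied separately where det Df > 0 and where det Df < 0, with |det Df| = ±
det Df. Critical points contribute nothing on the right, and by injectivity their images carry the
sign 0 on the left, so Sard's theorem is not needed. -/
theorem integrable_imageSign_mul (hU : IsOpen U) (hf : ContDiffOn ℝ 1 f U) (hB : IsCompact B)
    (hBU : B ⊆ U) (hinj : InjOn f B) {G : E → ℝ} (hG : ContinuousOn G (f '' B)) :
    Integrable (fun y ↦ imageSign f B y * G y) μ ∧
    ∫ y, imageSign f B y * G y ∂μ = ∫ x in B, G (f x) * (fderiv ℝ f x).det ∂μ := by
  have hfB : ContinuousOn f B := hf.continuousOn.mono hBU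
  have hGi : IntegrableOn G (f '' B) μ :=
    hG.integrableOn_compact (hB.image_of_continuousOn hfB)
  have hd : ContinuousOn (fun x ↦ (fderiv ℝ f x).det) B :=
    ContinuousLinearMap.continuous_det.comp_continuousOn
      ((hf.continuousOn_fderiv_of_isOpen hU le_rfl).mono hBU)
  have hderiv : ∀ s ⊆ B, ∀ x ∈ s, HasFDerivWithinAt f (fderiv ℝ f x) s x := fun s hs x hx ↦
    ((hf.contDiffAt (hU.mem_nhds (hBU (hs hx)))).differentiableAt
      one_ne_zero).hasFDerivAt.hasFDerivWithinAt
  obtain ⟨hPm, hPm'⟩ := measurableSet_image_det hU hf hB hBU hinj (isOpen_Ioi (a := (0 : ℝ)))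
  obtain ⟨hNm, hNm'⟩ := measurableSet_image_det hU hf hB hBU hinj (isOpen_Iio (a := (0 : ℝ)))
  set P := {x ∈ B | (fderiv ℝ f x).det ∈ Ioi (0 : ℝ)} with hP
  set N := {x ∈ B | (fderiv ℝ f x).det ∈ Iio (0 : ℝ)} with hN
  have hPB : P ⊆ B := fun x hx ↦ hx.1
  have hNB : N ⊆ B := fun x hx ↦ hx.1
  have hs : (fun y ↦ imageSign f B y * G y) =
      fun y ↦ (f '' P).indicator G y - (f '' N).indicator G y := by
    ext y
    have hPe : (f '' P).indicator G y = (f '' P).indicator 1 y * G y := by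
      by_cases h : y ∈ f '' P <;> simp [h]
    have hNe : (f '' N).indicator G y = (f '' N).indicator 1 y * G y := by
      by_cases h : y ∈ f '' N <;> simp [h]
    rw [hPe, hNe, ← sub_mul]
    rfl
  have hi1 : Integrable ((f '' P).indicator G) μ :=
    (hGi.mono_set (image_mono hPB)).integrable_indicator hPm'
  have hi2 : Integrable ((f '' N).indicator G) μ :=
    (hGi.mono_set (image_mono hNB)).integrable_indicator hNm'
  refine ⟨hs ▸ hi1.sub hi2, ?_⟩
  have hk : IntegrableOn (fun x ↦ |(fderiv ℝ f x).det| * G (f x)) B μ :=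
    (hd.abs.mul (hG.comp hfB (mapsTo_image f B))).integrableOn_compact hB
  have e1 := integral_image_eq_integral_abs_det_fderiv_smul μ hPm (hderiv P hPB)
    (hinj.mono hPB) G
  have e2 := integral_image_eq_integral_abs_det_fderiv_smul μ hNm (hderiv N hNB)
    (hinj.mono hNB) G
  simp only [smul_eq_mul] at e1 e2
  rw [hs, integral_sub hi1 hi2, integral_indicator hPm', integral_indicator hNm', e1, e2,
    ← inter_eq_right.2 hPB, ← inter_eq_right.2 hNB, ← setIntegral_indicator hPm,
    ← setIntegral_indicator hNm, ← integral_sub (hk.indicator hPm) (hk.indicator hNm)]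
  refine setIntegral_congr_fun hB.measurableSet fun x hx ↦ ?_
  rcases lt_trichotomy (fderiv ℝ f x).det 0 with h | h | h
  · have h1 : x ∉ P := fun h' ↦ lt_asymm h h'.2
    have h2 : x ∈ N := ⟨hx, h⟩
    simp [h1, h2, abs_of_neg h, mul_comm]
  · have h1 : x ∉ P := fun h' ↦ h'.2.ne' h
    have h2 : x ∉ N := fun h' ↦ h'.2.ne h
    simp [h1, h2, h]
  · have h1 : x ∉ N := fun h' ↦ lt_asymm h h'.2
    have h2 : x ∈ P := ⟨hx, h⟩
    simp [h1, h2, abs_of_pos h, mul_comm]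

/-- An injective `C¹` map between spaces of the same dimension is open, with Jacobian determinant of
almost everywhere constant sign. -/
theorem exists_ball_subset_image {x₀ : E} {ρ R : ℝ} (hρ : 0 < ρ) (hρR : ρ < R)
    (hf : ContDiffOn ℝ 1 f (Metric.ball x₀ R)) (hinj : InjOn f (Metric.ball x₀ R)) :
    ∃ r > 0, Metric.ball (f x₀) r ⊆ f '' Metric.closedBall x₀ ρ ∧
      (∀ x ∈ Metric.sphere x₀ ρ, f x ∉ Metric.ball (f x₀) r) ∧
      ∃ c : ℝ, c ≠ 0 ∧ ∀ᵐ y ∂μ, y ∈ Metric.ball (f x₀) r →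
        imageSign f (Metric.closedBall x₀ ρ) y = c := by
  set B := Metric.closedBall x₀ ρ with hBdef
  have hBU : B ⊆ Metric.ball x₀ R := Metric.closedBall_subset_ball hρR
  have hB : IsCompact B := isCompact_closedBall x₀ ρ
  have hiB : InjOn f B := hinj.mono hBU
  have hx₀R : x₀ ∈ Metric.ball x₀ R := Metric.mem_ball_self (hρ.trans hρR)
  have hSB : Metric.sphere x₀ ρ ⊆ B := Metric.sphere_subset_closedBall
  have hSc : IsClosed (f '' Metric.sphere x₀ ρ) :=
    ((isCompact_sphere x₀ ρ).image_of_continuousOn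
      (hf.continuousOn.mono (hSB.trans hBU))).isClosed
  -- By injectivity f x₀ is not in the compact image of the sphere. Test functions supported in a
  -- ball that misses this image are admissible in the integral identity.
  obtain ⟨r, hr, hrS⟩ := Metric.isOpen_iff.1 hSc.isOpen_compl (f x₀) (by
    rintro ⟨x, hx, hxe⟩
    rw [hinj (hBU (hSB hx)) hx₀R hxe] at hx
    simp at hx
    exact hρ.ne hx)
  have hS' : ∀ x ∈ Metric.sphere x₀ ρ, f x ∉ Metric.ball (f x₀) r := fun x hx h ↦
    hrS h (mem_image_of_mem f hx)
  have hloc : LocallyIntegrable (imageSign f B) μ := by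
    have := (integrable_imageSign_mul μ Metric.isOpen_ball hf hB hBU hiB
      (G := fun _ ↦ 1) continuousOn_const).1
    simp only [mul_one] at this
    exact this.locallyIntegrable
  -- The integral identity with S = 1 and P = 0 says that the sign has zero weak derivative.
  obtain ⟨c, hc⟩ := ae_eq_const_of_weak_deriv_eq_zero μ hloc (y₀ := f x₀) (r := r) (by
    intro ψ hψ hψs e
    rw [(integrable_imageSign_mul μ Metric.isOpen_ball hf hB hBU hiB
      ((hψ.continuous_fderiv one_ne_zero).clm_apply continuous_const).continuousOn).2]
    have := setIntegral_test_mul_det_fderiv_eq_zero μ hρ hρR hf (S := fun _ ↦ 1)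
      contDiffOn_const (P := fun _ ↦ 0) (by simp) hψ (fun x hx h ↦ hS' x hx (hψs h)) e
    simpa using this)
  have hvalue : ∀ O : Set E, IsOpen O → O.Nonempty → O ⊆ Metric.ball (f x₀) (r / 2) →
      ∃ y ∈ O, imageSign f B y = c := by
    intro O hO hOn hOb
    have : ∃ᵐ y ∂μ, y ∈ O := by
      rw [frequently_ae_mem_iff]
      exact (hO.measure_pos μ hOn).ne'
    obtain ⟨y, hy, hyO⟩ := (hc.and_frequently this).exists
    exact ⟨y, hyO, hy (hOb hyO)⟩
  -- Near a regular point f is a local homeomorphism with Jacobian of one sign, so a whole open set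
  -- of values has sign 1 or -1, and c is taken somewhere in it.
  have hc0 : c ≠ 0 := by
    let O : Set E := Metric.ball x₀ ρ ∩ f ⁻¹' Metric.ball (f x₀) (r / 2)
    have hbR : Metric.ball x₀ ρ ⊆ Metric.ball x₀ R := Metric.ball_subset_ball hρR.le
    have hO : IsOpen O := (hf.continuousOn.mono hbR).isOpen_inter_preimage Metric.isOpen_ball
      Metric.isOpen_ball
    have hOn : O.Nonempty := ⟨x₀, Metric.mem_ball_self hρ, Metric.mem_ball_self (half_pos hr)⟩
    have hOR : O ⊆ Metric.ball x₀ R := inter_subset_left.trans hbR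
    obtain ⟨x, hx, hdet⟩ := exists_det_fderiv_ne_zero hO hOn (hf.mono hOR) (hinj.mono hOR)
    have hfx : ContDiffAt ℝ 1 f x := hf.contDiffAt (Metric.isOpen_ball.mem_nhds (hOR hx))
    let Φ : E ≃L[ℝ] E := (fderiv ℝ f x).toContinuousLinearEquivOfDetNeZero hdet
    have hΦ : HasStrictFDerivAt f (Φ : E →L[ℝ] E) x := hfx.hasStrictFDerivAt one_ne_zero
    have hmap := hΦ.map_nhds_eq_of_equiv
    have hdc : ContinuousAt (fun x ↦ (fderiv ℝ f x).det) x :=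
      ContinuousLinearMap.continuous_det.continuousAt.comp
        (hfx.continuousAt_fderiv one_ne_zero)
    have hex : ∀ O' : Set E, O' ∈ 𝓝 x → O' ⊆ O → ∃ z ∈ O', imageSign f B (f z) = c := by
      intro O' hO' hOO
      have h1 : f '' O' ∈ 𝓝 (f x) := by rw [← hmap]; exact image_mem_map hO'
      obtain ⟨y, hy, hyc⟩ := hvalue (interior (f '' O')) isOpen_interior
        ⟨f x, mem_interior_iff_mem_nhds.2 h1⟩ (interior_subset.trans (by
          rintro _ ⟨z, hz, rfl⟩
          exact (hOO hz).2))
      obtain ⟨z, hz, rfl⟩ := interior_subset hy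
      exact ⟨z, hz, hyc⟩
    rcases hdet.lt_or_gt with h | h
    · obtain ⟨z, ⟨hzO, hz⟩, hzc⟩ := hex (O ∩ {z | (fderiv ℝ f z).det < 0})
        (inter_mem (hO.mem_nhds hx) (hdc.eventually (gt_mem_nhds h))) inter_subset_left
      rw [imageSign_of_neg hiB (Metric.ball_subset_closedBall hzO.1) hz] at hzc
      rw [← hzc]
      norm_num
    · obtain ⟨z, ⟨hzO, hz⟩, hzc⟩ := hex (O ∩ {z | 0 < (fderiv ℝ f z).det})
        (inter_mem (hO.mem_nhds hx) (hdc.eventually (lt_mem_nhds h))) inter_subset_left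
      rw [imageSign_of_pos hiB (Metric.ball_subset_closedBall hzO.1) hz] at hzc
      rw [← hzc]
      norm_num
  have hfBc : IsClosed (f '' B) := (hB.image_of_continuousOn (hf.continuousOn.mono hBU)).isClosed
  refine ⟨r / 2, half_pos hr, ?_, fun x hx h ↦ hS' x hx (Metric.ball_subset_ball (by linarith) h),
    c, hc0, hc⟩
  -- A missed value has a neighbourhood outside the compact image. The sign is 0 there, but c is
  -- taken as well.
  by_contra hsub
  obtain ⟨y, hy, hyB⟩ := not_subset.1 hsub
  obtain ⟨z, ⟨hz, hzB⟩, hzc⟩ := hvalue (Metric.ball (f x₀) (r / 2) ∩ (f '' B)ᶜ)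
    (Metric.isOpen_ball.inter hfBc.isOpen_compl) ⟨y, hy, hyB⟩ inter_subset_left
  exact hc0 (hzc ▸ imageSign_of_notMem hzB)

end OpenMapping

/-! ### Differentiability through an injective change of variables -/

section WeakDifferential

open MeasureTheory Filter Topology

variable {E : Type*} [NormedAddCommGroup E] [NormedSpace ℝ E] [FiniteDimensional ℝ E]
  {f : E → E} {U : Set E}

/-- If `W ∘ f = S` and `dS = P ∘ df` for an injective `C¹` map `f` between spaces of the same
dimension, then `W` is differentiable with `dW = P ∘ f⁻¹`, even at critical values of `f`. -/
theorem hasFDerivAt_of_comp_eq_of_injOn (hU : IsOpen U)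
    (hf : ContDiffOn ℝ 1 f U) (hinj : InjOn f U) {S : E → ℝ} (hS : ContDiffOn ℝ 1 S U)
    {P : E → E →L[ℝ] ℝ} (hPc : ContinuousOn P U)
    (hP : ∀ x ∈ U, fderiv ℝ S x = (P x).comp (fderiv ℝ f x))
    {W : E → ℝ} (hW : ∀ x ∈ U, W (f x) = S x) {x₀ : E} (hx₀ : x₀ ∈ U) :
    HasFDerivAt W (P x₀) (f x₀) := by
  let : MeasurableSpace E := borel E
  have : BorelSpace E := ⟨rfl⟩
  let μ : Measure E := Measure.addHaar
  obtain ⟨R, hR, hRU⟩ := Metric.isOpen_iff.1 hU x₀ hx₀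
  set ρ := R / 2
  have hρ : 0 < ρ := half_pos hR
  have hρR : ρ < R := half_lt_self hR
  obtain ⟨r, hr, hsub, hS', c, hc, hae⟩ := exists_ball_subset_image μ hρ hρR (hf.mono hRU)
    (hinj.mono hRU)
  set B := Metric.closedBall x₀ ρ with hBdef
  have hBU : B ⊆ U := (Metric.closedBall_subset_ball hρR).trans hRU
  have hB : IsCompact B := isCompact_closedBall x₀ ρ
  have hiB : InjOn f B := hinj.mono hBU
  have hx₀B : x₀ ∈ B := Metric.mem_closedBall_self hρ.le
  let F := Function.invFunOn f B
  have hFc : ContinuousOn F (f '' B) :=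
    continuousOn_invFunOn_image hB (hf.continuousOn.mono hBU) hiB
  have hFm : MapsTo F (f '' B) B := by
    rintro _ ⟨x, hx, rfl⟩
    simp only [F, hiB.leftInvOn_invFunOn hx]
    exact hx
  have hFf : ∀ x ∈ B, F (f x) = x := fun x hx ↦ hiB.leftInvOn_invFunOn hx
  have hWc : ContinuousOn W (f '' B) := by
    refine ((hS.continuousOn.mono hBU).comp hFc hFm).congr ?_
    rintro _ ⟨x, hx, rfl⟩
    simp [hFf x hx, hW x (hBU hx)]
  let p₁ : E → E →L[ℝ] ℝ := fun y ↦ P (F y)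
  have hpc : ContinuousOn p₁ (f '' B) := (hPc.mono hBU).comp hFc hFm
  set b := Metric.closedBall (f x₀) (r / 2)
  have hbB : b ⊆ f '' B := (Metric.closedBall_subset_ball (half_lt_self hr)).trans hsub
  have hbm : MeasurableSet b := Metric.isClosed_closedBall.measurableSet
  -- W and P ∘ f⁻¹ are under control only on the image of B. Truncation to a closed ball inside it
  -- gives locally integrable functions on E and changes nothing near f x₀.
  let g : E → ℝ := b.indicator W
  let p : E → E →L[ℝ] ℝ := b.indicator p₁
  have hg : LocallyIntegrable g μ := (((hWc.mono hbB).integrableOn_compact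
    (isCompact_closedBall _ _)).integrable_indicator hbm).locallyIntegrable
  have hp : LocallyIntegrable p μ := (((hpc.mono hbB).integrableOn_compact
    (isCompact_closedBall _ _)).integrable_indicator hbm).locallyIntegrable
  have hnear : ∀ y ∈ Metric.ball (f x₀) (r / 2), b ∈ 𝓝 y := fun y hy ↦
    mem_of_superset (Metric.isOpen_ball.mem_nhds hy) Metric.ball_subset_closedBall
  have hgW : ∀ y ∈ Metric.ball (f x₀) (r / 2), g =ᶠ[𝓝 y] W := fun y hy ↦ by
    filter_upwards [hnear y hy] with z hz using indicator_of_mem hz _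
  have hpp : ∀ y ∈ Metric.ball (f x₀) (r / 2), p =ᶠ[𝓝 y] p₁ := fun y hy ↦ by
    filter_upwards [hnear y hy] with z hz using indicator_of_mem hz _
  have hself : f x₀ ∈ Metric.ball (f x₀) (r / 2) := Metric.mem_ball_self (half_pos hr)
  have hmain : HasFDerivAt g (p (f x₀)) (f x₀) := by
    refine hasFDerivAt_of_weak_deriv μ hg hp (half_pos hr) ?_ ?_ ?_
    · intro ψ hψ hψs e
      let G : E → ℝ := fun y ↦ ψ y * p₁ y e + W y * fderiv ℝ ψ y e
      have hG : ContinuousOn G (f '' B) :=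
        (hψ.continuous.continuousOn.mul (hpc.clm_apply continuousOn_const)).add
          (hWc.mul (((hψ.continuous_fderiv one_ne_zero).clm_apply continuous_const).continuousOn))
      have h1 := (integrable_imageSign_mul μ hU hf hB hBU hiB hG).2
      have hψ0 : ∀ y ∉ Metric.ball (f x₀) (r / 2), ψ y = 0 ∧ fderiv ℝ ψ y = 0 := fun y hy ↦
        ⟨image_eq_zero_of_notMem_tsupport fun h ↦ hy (hψs h),
          image_eq_zero_of_notMem_tsupport fun h ↦ hy (hψs (tsupport_fderiv_subset ℝ h))⟩
      have h2 : ∫ x in B, G (f x) * (fderiv ℝ f x).det ∂μ = 0 := by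
        rw [← setIntegral_test_mul_det_fderiv_eq_zero μ hρ hρR (hf.mono hRU) (hS.mono hRU)
          (fun x hx ↦ hP x (hRU hx)) hψ
          (fun x hx h ↦ hS' x hx (Metric.ball_subset_ball (by linarith) (hψs h))) e]
        refine setIntegral_congr_fun hB.measurableSet fun x hx ↦ ?_
        simp only [G, p₁, hFf x hx, hW x (hBU hx)]
      -- On the support of ψ the sign is almost everywhere c, and c ≠ 0 can be divided out.
      have h3 : ∫ y, imageSign f B y * G y ∂μ =
          ∫ y, c * (ψ y * p y e + g y * fderiv ℝ ψ y e) ∂μ := by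
        refine integral_congr_ae ?_
        filter_upwards [hae] with y hy
        by_cases hyb : y ∈ Metric.ball (f x₀) (r / 2)
        · rw [hy (Metric.ball_subset_ball (by linarith) hyb), (hgW y hyb).self_of_nhds,
            (hpp y hyb).self_of_nhds]
        · simp [G, (hψ0 y hyb).1, (hψ0 y hyb).2]
      rw [h1, h2, integral_const_mul] at h3
      exact (mul_eq_zero.1 h3.symm).resolve_left hc
    · filter_upwards [Metric.isOpen_ball.mem_nhds hself] with y hy
      exact (hWc.continuousAt (mem_of_superset (hnear y hy) hbB)).congr (hgW y hy).symm
    · exact (hpc.continuousAt (mem_of_superset (hnear _ hself) hbB)).congr (hpp _ hself).symm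
  have hpx : p (f x₀) = P x₀ := by
    rw [(hpp _ hself).self_of_nhds]
    simp only [p₁, hFf x₀ hx₀B]
  rw [← hpx]
  exact hmain.congr_of_eventuallyEq (hgW _ hself).symm

/-- Invariance of domain for `C¹` maps. -/
theorem image_mem_nhds_of_injOn (hU : IsOpen U) (hf : ContDiffOn ℝ 1 f U) (hinj : InjOn f U)
    {x₀ : E} {N : Set E} (hN : N ∈ 𝓝 x₀) (hx₀ : x₀ ∈ U) : f '' N ∈ 𝓝 (f x₀) := by
  let : MeasurableSpace E := borel E
  have : BorelSpace E := ⟨rfl⟩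
  let μ : Measure E := Measure.addHaar
  obtain ⟨R, hR, hRU⟩ := Metric.mem_nhds_iff.1 (inter_mem hN (hU.mem_nhds hx₀))
  obtain ⟨r, hr, hsub, -⟩ := exists_ball_subset_image μ (half_pos hR) (half_lt_self hR)
    (hf.mono (hRU.trans inter_subset_right)) (hinj.mono (hRU.trans inter_subset_right))
  refine mem_of_superset (Metric.ball_mem_nhds _ hr) (hsub.trans (image_mono ?_))
  exact (Metric.closedBall_subset_ball (half_lt_self hR)).trans (hRU.trans inter_subset_left)

/-- If `W ∘ f = S` and `dS = P ∘ df` for an injective `C¹` map `f` between spaces of the same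
dimension, then `f` is open and `W` is `C¹` with `dW = P ∘ f⁻¹`. -/
theorem contDiffOn_of_comp_eq_of_injOn {X Y : Type*} [NormedAddCommGroup X] [NormedSpace ℝ X]
    [FiniteDimensional ℝ X] [NormedAddCommGroup Y] [NormedSpace ℝ Y] [FiniteDimensional ℝ Y]
    (hXY : Module.finrank ℝ X = Module.finrank ℝ Y) {f : X → Y} {U : Set X} (hU : IsOpen U)
    (hf : ContDiffOn ℝ 1 f U) (hinj : InjOn f U) {S : X → ℝ} (hS : ContDiffOn ℝ 1 S U)
    {P : X → Y →L[ℝ] ℝ} (hPc : ContinuousOn P U)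
    (hP : ∀ x ∈ U, fderiv ℝ S x = (P x).comp (fderiv ℝ f x))
    {W : Y → ℝ} (hW : ∀ x ∈ U, W (f x) = S x) :
    IsOpen (f '' U) ∧ (∀ x ∈ U, HasFDerivAt W (P x) (f x)) ∧ ContDiffOn ℝ 1 W (f '' U) := by
  -- Precomposition with a linear isomorphism reduces to maps from Y to itself.
  let L : Y ≃L[ℝ] X := ContinuousLinearEquiv.ofFinrankEq hXY.symm
  let V : Set Y := L ⁻¹' U
  have hV : IsOpen V := hU.preimage L.continuous
  have hLV : MapsTo L V U := fun y hy ↦ hy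
  let g : Y → Y := f ∘ L
  have hg : ContDiffOn ℝ 1 g V := hf.comp L.contDiff.contDiffOn hLV
  have hgi : InjOn g V := hinj.comp L.injective.injOn hLV
  have hST : ContDiffOn ℝ 1 (S ∘ L) V := hS.comp L.contDiff.contDiffOn hLV
  have hPT : ContinuousOn (P ∘ L) V := hPc.comp L.continuous.continuousOn hLV
  have hd : ∀ y ∈ V, fderiv ℝ (S ∘ L) y = ((P ∘ L) y).comp (fderiv ℝ g y) := by
    intro y hy
    rw [L.comp_right_fderiv, L.comp_right_fderiv, hP _ hy]
    rfl
  have hderiv : ∀ x ∈ U, HasFDerivAt W (P x) (f x) := by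
    intro x hx
    have hx' : L.symm x ∈ V := by simpa [V] using hx
    have := hasFDerivAt_of_comp_eq_of_injOn hV hg hgi hST hPT hd (W := W)
      (fun y hy ↦ hW _ hy) hx'
    simpa [g] using this
  have hmem : ∀ x ∈ U, ∀ N ∈ 𝓝 x, f '' N ∈ 𝓝 (f x) := by
    intro x hx N hN
    have hx' : L.symm x ∈ V := by simpa [V] using hx
    have hN' : L ⁻¹' N ∈ 𝓝 (L.symm x) :=
      L.continuous.continuousAt.preimage_mem_nhds (by simpa using hN)
    have := image_mem_nhds_of_injOn hV hg hgi hN' hx'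
    simp only [g, Function.comp_apply, L.apply_symm_apply] at this
    refine mem_of_superset this ?_
    rintro _ ⟨y, hy, rfl⟩
    exact ⟨L y, hy, rfl⟩
  have hopen : IsOpen (f '' U) := by
    rw [isOpen_iff_mem_nhds]
    rintro _ ⟨x, hx, rfl⟩
    exact hmem x hx U (hU.mem_nhds hx)
  refine ⟨hopen, hderiv, ?_⟩
  have hfd : ∀ x ∈ U, fderiv ℝ W (f x) = P x := fun x hx ↦ (hderiv x hx).fderiv
  rw [show (1 : WithTop ℕ∞) = 0 + 1 from (zero_add 1).symm,
    contDiffOn_succ_iff_fderiv_of_isOpen hopen]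
  refine ⟨?_, by simp, contDiffOn_zero.2 ?_⟩
  · rintro _ ⟨x, hx, rfl⟩
    exact (hderiv x hx).differentiableAt.differentiableWithinAt
  · rintro _ ⟨x, hx, rfl⟩
    refine ContinuousAt.continuousWithinAt ?_
    intro O hO
    rw [hfd x hx] at hO
    -- dW ∘ f = P on U, and f maps neighbourhoods to neighbourhoods, so continuity of P passes to
    -- dW.
    have h1 : P ⁻¹' O ∩ U ∈ 𝓝 x :=
      inter_mem ((hPc.continuousAt (hU.mem_nhds hx)).preimage_mem_nhds hO) (hU.mem_nhds hx)
    rw [mem_map]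
    refine mem_of_superset (hmem x hx _ h1) ?_
    rintro _ ⟨z, ⟨hz, hzU⟩, rfl⟩
    rw [mem_preimage, hfd z hzU]
    exact hz

end WeakDifferential

/-! ### Calculus on spaces of continuous curves -/

section PointwiseApply

variable {K : Type*} [TopologicalSpace K] [CompactSpace K] {F : Type*} [NormedAddCommGroup F]
  [NormedSpace ℝ F] {G : Type*} [NormedAddCommGroup G] [NormedSpace ℝ G]
  {Z : Type*} [NormedAddCommGroup Z] [NormedSpace ℝ Z]

/-- The pointwise application `(A, h) ↦ (t ↦ B (A t) (h t))` of a bilinear map. -/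
noncomputable def pointwiseApply (B : Z →L[ℝ] F →L[ℝ] G) : C(K, Z) →L[ℝ] C(K, F) →L[ℝ] C(K, G) :=
  LinearMap.mkContinuous₂
    { toFun := fun A : C(K, Z) ↦
        { toFun := fun h : C(K, F) ↦ (⟨fun t ↦ B (A t) (h t),
            (B.continuous.comp A.continuous).clm_apply h.continuous⟩ : C(K, G))
          map_add' := fun h h' ↦ ContinuousMap.ext fun t ↦ map_add (B (A t)) _ _
          map_smul' := fun c h ↦ ContinuousMap.ext fun t ↦ map_smul (B (A t)) _ _ }
      map_add' := fun A A' ↦ by ext h t; simp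
      map_smul' := fun c A ↦ by ext h t; simp } ‖B‖ fun A h ↦ by
      rw [ContinuousMap.norm_le _ (by positivity)]
      intro t
      exact (B.le_opNorm₂ (A t) (h t)).trans (by
        gcongr
        exacts [A.norm_coe_le_norm t, h.norm_coe_le_norm t])

theorem pointwiseApply_apply (B : Z →L[ℝ] F →L[ℝ] G) (A : C(K, Z)) (h : C(K, F)) (t : K) :
    pointwiseApply B A h t = B (A t) (h t) := rfl

theorem norm_pointwiseApply_le (B : Z →L[ℝ] F →L[ℝ] G) (A : C(K, Z)) {C : ℝ} (hC : 0 ≤ C)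
    (h : ∀ t, ‖B (A t)‖ ≤ C) : ‖pointwiseApply B A‖ ≤ C := by
  refine ContinuousLinearMap.opNorm_le_bound _ hC fun γ ↦ ?_
  rw [ContinuousMap.norm_le _ (by positivity)]
  intro t
  exact ((B (A t)).le_opNorm (γ t)).trans
    (mul_le_mul (h t) (γ.norm_coe_le_norm t) (norm_nonneg _) hC)

theorem contDiffOn_pointwiseApply_comp (B : Z →L[ℝ] F →L[ℝ] G) {X : Type*} [NormedAddCommGroup X]
    [NormedSpace ℝ X] {n : WithTop ℕ∞} {f : X → C(K, Z)} {s : Set X} (hf : ContDiffOn ℝ n f s) :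
    ContDiffOn ℝ n (fun x ↦ pointwiseApply B (f x)) s :=
  (ContinuousLinearMap.contDiff (E := C(K, Z)) (F := C(K, F) →L[ℝ] C(K, G))
    (pointwiseApply B)).comp_contDiffOn hf

end PointwiseApply

section Superposition

variable {F : Type*} [NormedAddCommGroup F] {G : Type*} [NormedAddCommGroup G] {a b : ℝ} {O : Set F}

/-- The set of continuous curves with values in `O`. -/
def curvesIn (a b : ℝ) (O : Set F) : Set C(Icc a b, F) := {γ | ∀ t, γ t ∈ O}

theorem isOpen_curvesIn (hO : IsOpen O) : IsOpen (curvesIn a b O) := by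
  have := ContinuousMap.isOpen_setOfPred_mapsTo (X := Icc a b) (Y := F) isCompact_univ hO
  convert this using 1
  ext γ
  exact ⟨fun h t _ ↦ h t, fun h t ↦ h (mem_univ t)⟩

open Classical in
/-- The superposition operator `γ ↦ (t ↦ g (t, γ t))` on continuous curves. -/
noncomputable def superposition (g : ℝ × F → G) (γ : C(Icc a b, F)) : C(Icc a b, G) :=
  -- The value 0 does not occur for g continuous on `Icc a b ×ˢ O` and curves in O.
  if h : Continuous fun t : Icc a b ↦ g (t, γ t) then ⟨_, h⟩ else 0

theorem superposition_apply {g : ℝ × F → G} (hg : ContinuousOn g (Icc a b ×ˢ O))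
    {γ : C(Icc a b, F)} (hγ : γ ∈ curvesIn a b O) (t : Icc a b) :
    superposition g γ t = g (t, γ t) := by
  have h : Continuous fun t : Icc a b ↦ g (t, γ t) :=
    hg.comp_continuous (by fun_prop) fun t ↦ ⟨t.2, hγ t⟩
  simp [superposition, h]

/-- By currying, this reduces to joint continuity of (γ, t) ↦ g (t, γ t). -/
theorem continuousOn_superposition {g : ℝ × F → G} (hg : ContinuousOn g (Icc a b ×ˢ O)) :
    ContinuousOn (superposition g) (curvesIn a b O) := by
  rw [continuousOn_iff_continuous_domRestrict]
  refine ContinuousMap.continuous_of_continuous_uncurry _ ?_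
  have : Function.uncurry (fun (γ : curvesIn a b O) (t : Icc a b) ↦
      (curvesIn a b O).domRestrict (superposition g) γ t) =
      fun q : curvesIn a b O × Icc a b ↦ g (q.2, (q.1 : C(Icc a b, F)) q.2) := by
    ext ⟨γ, t⟩
    exact superposition_apply hg γ.2 t
  rw [this]
  refine hg.comp_continuous ?_ fun q ↦ ⟨q.2.2, q.1.2 q.2⟩
  fun_prop

end Superposition

section Nemytskii

open Filter Topology

universe u

variable {F : Type u} [NormedAddCommGroup F] [NormedSpace ℝ F] {a b : ℝ}
  {G : Type u} [NormedAddCommGroup G] [NormedSpace ℝ G] {O : Set F}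

/-- The derivative of `g (t, x)` in `x`. -/
noncomputable def partialSnd (g : ℝ × F → G) (q : ℝ × F) : F →L[ℝ] G :=
  fderiv ℝ (fun y ↦ g (q.1, y)) q.2

/-- O is open, so the derivative in x is two-sided even at the end points of the time interval. Its
expression through `fderivWithin` is what shows its smoothness in (t, x). -/
theorem hasFDerivAt_partialSnd (hO : IsOpen O) {g : ℝ × F → G}
    (hg : ContDiffOn ℝ ∞ g (Icc a b ×ˢ O)) {t : ℝ} (ht : t ∈ Icc a b) {x : F} (hx : x ∈ O) :
    HasFDerivAt (fun y ↦ g (t, y)) (partialSnd g (t, x)) x ∧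
      partialSnd g (t, x) = (fderivWithin ℝ g (Icc a b ×ˢ O) (t, x)).comp
        (ContinuousLinearMap.inr ℝ ℝ F) := by
  have h1 : HasFDerivWithinAt g (fderivWithin ℝ g (Icc a b ×ˢ O) (t, x)) (Icc a b ×ˢ O) (t, x) :=
    ((hg.differentiableOn (by simp)) (t, x) ⟨ht, hx⟩).hasFDerivWithinAt
  have h2 : HasFDerivWithinAt (fun y : F ↦ (t, y)) (ContinuousLinearMap.inr ℝ ℝ F) O x :=
    (hasFDerivAt_prodMk_right t x).hasFDerivWithinAt
  have h3 := (h1.comp x h2 fun y hy ↦ ⟨ht, hy⟩).hasFDerivAt (hO.mem_nhds hx)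
  have h4 : partialSnd g (t, x) = _ := h3.fderiv
  exact ⟨h4 ▸ h3, h4⟩

theorem contDiffOn_partialSnd (hab : a < b) (hO : IsOpen O) {g : ℝ × F → G}
    (hg : ContDiffOn ℝ ∞ g (Icc a b ×ˢ O)) : ContDiffOn ℝ ∞ (partialSnd g) (Icc a b ×ˢ O) := by
  have hu : UniqueDiffOn ℝ (Icc a b ×ˢ O) := (uniqueDiffOn_Icc hab).prod hO.uniqueDiffOn
  have h1 : ContDiffOn ℝ ∞ (fderivWithin ℝ g (Icc a b ×ˢ O)) (Icc a b ×ˢ O) :=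
    hg.fderivWithin hu (by simp)
  refine ((h1.clm_comp (contDiffOn_const (c := ContinuousLinearMap.inr ℝ ℝ F))).congr ?_)
  rintro ⟨t, x⟩ ⟨ht, hx⟩
  exact (hasFDerivAt_partialSnd hO hg ht hx).2

/-- The superposition with g' is continuous in the supremum norm, which bounds the oscillation of
the derivative uniformly in t. The mean value inequality at each t then gives a uniform remainder.
-/
theorem hasFDerivAt_superposition {Z : Type*} [NormedAddCommGroup Z] [NormedSpace ℝ Z]
    (hO : IsOpen O) {g : ℝ × F → G} (hcg : ContinuousOn g (Icc a b ×ˢ O)) (B : Z →L[ℝ] F →L[ℝ] G)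
    {g' : ℝ × F → Z} (hcp : ContinuousOn g' (Icc a b ×ˢ O))
    (hg : ∀ t ∈ Icc a b, ∀ x ∈ O, HasFDerivAt (fun y ↦ g (t, y)) (B (g' (t, x))) x)
    {γ : C(Icc a b, F)} (hγ : γ ∈ curvesIn a b O) :
    HasFDerivAt (superposition g) (pointwiseApply B (superposition g' γ)) γ := by
  have hopen := (isOpen_curvesIn (a := a) (b := b) hO).mem_nhds hγ
  rw [hasFDerivAt_iff_isLittleO, Asymptotics.isLittleO_iff]
  intro ε hε
  let ε' := ε / (‖B‖ + 1)
  have hε' : 0 < ε' := by positivity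
  obtain ⟨δ, hδ, hδ'⟩ := Metric.mem_nhds_iff.1 (inter_mem hopen
    ((continuousOn_superposition hcp).continuousAt hopen (Metric.closedBall_mem_nhds _ hε')))
  filter_upwards [Metric.ball_mem_nhds γ hδ] with η hη
  rw [ContinuousMap.norm_le _ (by positivity)]
  intro t
  have hηO := (hδ' hη).1
  simp only [ContinuousMap.sub_apply, superposition_apply hcg hηO, superposition_apply hcg hγ,
    pointwiseApply_apply, superposition_apply hcp hγ]
  have key : ∀ x ∈ Metric.ball (γ t) δ, x ∈ O ∧ ‖B (g' (t, x)) - B (g' (t, γ t))‖ ≤ ε := by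
    intro x hx
    -- The whole curve is shifted by a constant so as to pass through x at time t; this turns
    -- supremum norm continuity into a pointwise bound.
    let ζ : C(Icc a b, F) := γ + ContinuousMap.const _ (x - γ t)
    have hζ : ζ ∈ Metric.ball γ δ := by
      rw [mem_ball_iff_norm, add_sub_cancel_left]
      refine lt_of_le_of_lt ?_ (mem_ball_iff_norm.1 hx)
      rw [ContinuousMap.norm_le _ (norm_nonneg _)]
      intro s
      exact le_rfl
    have hζt : ζ t = x := by simp [ζ]
    obtain ⟨h1, h2⟩ := hδ' hζ
    refine ⟨hζt ▸ h1 t, ?_⟩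
    have h3 := (ContinuousMap.dist_apply_le_dist t).trans (Metric.mem_closedBall.1 h2)
    rw [superposition_apply hcp h1, superposition_apply hcp hγ, hζt, dist_eq_norm] at h3
    rw [← map_sub]
    calc ‖B (g' (t, x) - g' (t, γ t))‖ ≤ (‖B‖ + 1) * ε' :=
          (B.le_opNorm _).trans (by gcongr; linarith)
      _ = ε := by simp only [ε']; field_simp
  have hηt : η t ∈ Metric.ball (γ t) δ :=
    (ContinuousMap.dist_apply_le_dist t).trans_lt (Metric.mem_ball.1 hη)
  have := (convex_ball (γ t) δ).norm_image_sub_le_of_norm_hasFDerivWithin_le'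
    (f := fun y ↦ g (t, y)) (f' := fun x ↦ B (g' (t, x))) (φ := B (g' (t, γ t)))
    (fun x hx ↦ (hg t t.2 x (key x hx).1).hasFDerivWithinAt)
    (fun x hx ↦ (key x hx).2) (Metric.mem_ball_self hδ) hηt
  exact this.trans (mul_le_mul_of_nonneg_left ((η - γ).norm_coe_le_norm t) hε.le)

/-- The derivative of a superposition operator is the superposition with the partial derivative,
followed by a continuous linear map, so the order of smoothness rises by induction. The step
replaces G by F →L[ℝ] G, whence the common universe of F and G. -/
theorem contDiffOn_superposition (hab : a < b) (hO : IsOpen O) {g : ℝ × F → G}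
    (hg : ContDiffOn ℝ ∞ g (Icc a b ×ˢ O)) :
    ContDiffOn ℝ ∞ (superposition g) (curvesIn a b O) := by
  rw [contDiffOn_infty]
  intro n
  induction n generalizing G with
  | zero => exact contDiffOn_zero.2 (continuousOn_superposition hg.continuousOn)
  | succ n ih =>
    have hopen := isOpen_curvesIn (a := a) (b := b) hO
    have hd := fun γ (hγ : γ ∈ curvesIn a b O) ↦ hasFDerivAt_superposition hO hg.continuousOn
      (ContinuousLinearMap.id ℝ (F →L[ℝ] G)) (contDiffOn_partialSnd hab hO hg).continuousOn
      (fun t ht x hx ↦ (hasFDerivAt_partialSnd hO hg ht hx).1) hγ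
    rw [Nat.cast_add, Nat.cast_one, contDiffOn_succ_iff_fderiv_of_isOpen hopen]
    refine ⟨fun γ hγ ↦ (hd γ hγ).differentiableAt.differentiableWithinAt, by simp, ?_⟩
    have h1 := contDiffOn_pointwiseApply_comp (ContinuousLinearMap.id ℝ (F →L[ℝ] G))
      (ih (contDiffOn_partialSnd hab hO hg))
    exact h1.congr fun γ hγ ↦ (hd γ hγ).fderiv

/-- The primitive vanishing at `a` of a continuous curve. -/
noncomputable def primitive (hab : a ≤ b) : C(Icc a b, G) →L[ℝ] C(Icc a b, G) :=
  LinearMap.mkContinuous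
    { toFun := fun γ ↦ ⟨fun t ↦ ∫ s in a..t, IccExtend hab γ s,
        (intervalIntegral.continuous_primitive
          (fun _ _ ↦ (γ.continuous.Icc_extend' (h := hab)).intervalIntegrable _ _) a).comp
          continuous_subtype_val⟩
      map_add' := fun γ γ' ↦ by
        ext t
        exact intervalIntegral.integral_add
          ((γ.continuous.Icc_extend' (h := hab)).intervalIntegrable _ _)
          ((γ'.continuous.Icc_extend' (h := hab)).intervalIntegrable _ _)
      map_smul' := fun c γ ↦ by
        ext t
        exact intervalIntegral.integral_smul c _ } (b - a) fun γ ↦ by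
      have h0 : 0 ≤ b - a := sub_nonneg.2 hab
      rw [ContinuousMap.norm_le _ (by positivity)]
      intro t
      have := intervalIntegral.norm_integral_le_of_norm_le_const (a := a) (b := t)
        (f := IccExtend hab γ) (C := ‖γ‖) fun s _ ↦ γ.norm_coe_le_norm _
      refine this.trans ?_
      rw [abs_of_nonneg (sub_nonneg.2 t.2.1), mul_comm]
      gcongr
      exact t.2.2

theorem primitive_apply (hab : a ≤ b) (γ : C(Icc a b, G)) (t : Icc a b) :
    primitive hab γ t = ∫ s in a..t, IccExtend hab γ s := rfl

theorem norm_primitive_le (hab : a ≤ b) : ‖primitive (G := G) hab‖ ≤ b - a :=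
  LinearMap.mkContinuous_norm_le _ (sub_nonneg.2 hab) _

theorem hasDerivAt_primitive [CompleteSpace G] (hab : a ≤ b) (γ : C(Icc a b, G)) (t : ℝ) :
    HasDerivAt (fun t ↦ ∫ s in a..t, IccExtend hab γ s) (IccExtend hab γ t) t :=
  (γ.continuous.Icc_extend' (h := hab)).integral_hasStrictDerivAt a t |>.hasDerivAt

end Nemytskii

/-! ### Smooth dependence of solutions on the initial value -/

section CurveFamily

open Filter Topology

universe u

variable {F : Type u} [NormedAddCommGroup F] [NormedSpace ℝ F] {a b : ℝ} {O : Set F}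

/-- The constant curve through a point. -/
noncomputable def constCurve (a b : ℝ) : F →L[ℝ] C(Icc a b, F) :=
  LinearMap.mkContinuous
    { toFun := fun z ↦ ContinuousMap.const _ z
      map_add' := fun _ _ ↦ rfl
      map_smul' := fun _ _ ↦ rfl } 1 fun z ↦ by
      rw [one_mul, ContinuousMap.norm_le _ (norm_nonneg z)]
      exact fun _ ↦ le_rfl

@[simp] theorem constCurve_apply (z : F) (t : Icc a b) : constCurve a b z t = z := rfl

theorem contDiff_constCurve {n : WithTop ℕ∞} : ContDiff ℝ n (constCurve (F := F) a b) :=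
  ContinuousLinearMap.contDiff (E := F) (F := C(Icc a b, F)) _

theorem hasFDerivAt_constCurve (z : F) :
    HasFDerivAt (constCurve a b : F → C(Icc a b, F)) (constCurve a b) z :=
  ContinuousLinearMap.hasFDerivAt (E := F) (F := C(Icc a b, F)) _

theorem contDiff_primitive (hab : a ≤ b) {n : WithTop ℕ∞} : ContDiff ℝ n (primitive (G := F) hab) :=
  ContinuousLinearMap.contDiff (E := C(Icc a b, F)) (F := C(Icc a b, F)) _

theorem hasFDerivAt_primitive (hab : a ≤ b) (γ : C(Icc a b, F)) :
    HasFDerivAt (primitive hab : C(Icc a b, F) → C(Icc a b, F)) (primitive hab) γ :=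
  ContinuousLinearMap.hasFDerivAt (E := C(Icc a b, F)) (F := C(Icc a b, F)) _

/-- The integral equation `γ t = z + ∫ₐᵗ X (s, γ s) ds`. -/
def IsIntegralSolution (hab : a ≤ b) (X : ℝ × F → F) (z : F) (γ : C(Icc a b, F)) : Prop :=
  γ = constCurve a b z + primitive hab (superposition X γ)

theorem IsIntegralSolution.apply_left {hab : a ≤ b} {X : ℝ × F → F} {γ : C(Icc a b, F)} {z : F}
    (hγ : IsIntegralSolution hab X z γ) : γ ⟨a, left_mem_Icc.2 hab⟩ = z := by
  rw [hγ, ContinuousMap.add_apply, primitive_apply]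
  simp

variable [CompleteSpace F]

theorem IsIntegralSolution.of_hasDerivWithinAt (hab : a ≤ b) {X : ℝ × F → F}
    (hX : ContinuousOn X (Icc a b ×ˢ O)) {χ : C(Icc a b, F)} (hχO : χ ∈ curvesIn a b O)
    {ξ : ℝ → F} (hξ : ∀ t : Icc a b, χ t = ξ t)
    (hχ : ∀ t ∈ Icc a b, HasDerivWithinAt ξ (X (t, ξ t)) (Icc a b) t) :
    IsIntegralSolution hab X (ξ a) χ := by
  ext t
  have hc : ∀ t ∈ Icc a b, IccExtend hab (superposition X χ) t = X (t, ξ t) := fun t ht ↦ by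
    rw [IccExtend_of_mem hab _ ht, superposition_apply hX hχO, hξ]
  have hsub : Icc a (t : ℝ) ⊆ Icc a b := Icc_subset_Icc_right t.2.2
  have h := intervalIntegral.integral_eq_sub_of_hasDerivAt_of_le (f := ξ)
    (f' := IccExtend hab (superposition X χ)) t.2.1
    (fun s hs ↦ (hχ s (hsub hs)).continuousWithinAt.mono hsub) (fun s hs ↦ by
      have hs' : s ∈ Icc a b := ⟨hs.1.le, hs.2.le.trans t.2.2⟩
      rw [hc s hs']
      exact (hχ s hs').hasDerivAt (Icc_mem_nhds hs.1 (hs.2.trans_le t.2.2)))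
    (((superposition X χ).continuous.Icc_extend' (h := hab)).intervalIntegrable _ _)
  rw [ContinuousMap.add_apply, primitive_apply, h, constCurve_apply, hξ]
  abel

theorem IsIntegralSolution.hasDerivWithinAt {hab : a ≤ b} {X : ℝ × F → F}
    (hX : ContinuousOn X (Icc a b ×ˢ O)) {γ : C(Icc a b, F)} (hγO : γ ∈ curvesIn a b O) {z : F}
    (hγ : IsIntegralSolution hab X z γ) {t : ℝ} (ht : t ∈ Icc a b) :
    HasDerivWithinAt (IccExtend hab γ) (X (t, IccExtend hab γ t)) (Icc a b) t := by
  have h := (hasDerivAt_primitive hab (superposition X γ) t).const_add z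
  rw [IccExtend_of_mem hab _ ht, superposition_apply hX hγO] at h
  rw [IccExtend_of_mem hab _ ht]
  refine h.hasDerivWithinAt.congr (fun s hs ↦ ?_) ?_
  · rw [IccExtend_of_mem hab _ hs]
    exact DFunLike.congr_fun hγ ⟨s, hs⟩
  · rw [IccExtend_of_mem hab _ ht]
    exact DFunLike.congr_fun hγ ⟨t, ht⟩

/-- Near a solution `χ` of the ordinary differential equation `ẋ = X (t, x)` on `[a, b]`, solutions
depend smoothly on their initial value. -/
theorem exists_contDiffOn_isIntegralSolution (hab : a < b) (hO : IsOpen O) {X : ℝ × F → F}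
    (hX : ContDiffOn ℝ ∞ X (Icc a b ×ˢ O)) {χ : C(Icc a b, F)} (hχO : χ ∈ curvesIn a b O) {z₀ : F}
    (hχ : IsIntegralSolution hab.le X z₀ χ) {C : ℝ} (hC0 : 0 ≤ C)
    (hC : ∀ t : Icc a b, ‖partialSnd X (t, χ t)‖ ≤ C) (hCab : (b - a) * C < 1) :
    ∃ U : Set F, IsOpen U ∧ z₀ ∈ U ∧ ∃ Γ : F → C(Icc a b, F), ContDiffOn ℝ ∞ Γ U ∧
      Γ z₀ = χ ∧ ∀ z ∈ U, Γ z ∈ curvesIn a b O ∧ IsIntegralSolution hab.le X z (Γ z) := by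
  let 𝒪 : Set (F × C(Icc a b, F)) := univ ×ˢ curvesIn a b O
  have h𝒪 : IsOpen 𝒪 := isOpen_univ.prod (isOpen_curvesIn hO)
  -- For γ in O, the integral equation with initial value z is T (z, γ) = (z, 0), to be solved by
  -- the inverse function theorem.
  let T : F × C(Icc a b, F) → F × C(Icc a b, F) := fun q ↦
    (q.1, q.2 - constCurve a b q.1 - primitive hab.le (superposition X q.2))
  have hsup : ContDiffOn ℝ ∞ (fun q : F × C(Icc a b, F) ↦ superposition X q.2) 𝒪 :=
    (contDiffOn_superposition hab hO hX).comp contDiff_snd.contDiffOn fun q hq ↦ hq.2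
  have hT : ContDiffOn ℝ ∞ T 𝒪 := by
    refine contDiff_fst.contDiffOn.prodMk (ContDiffOn.sub ?_ ?_)
    · exact (contDiff_snd.sub (contDiff_constCurve.comp contDiff_fst)).contDiffOn
    · exact (contDiff_primitive hab.le).comp_contDiffOn hsup
  let A : C(Icc a b, F) →L[ℝ] C(Icc a b, F) :=
    pointwiseApply (ContinuousLinearMap.id ℝ (F →L[ℝ] F)) (superposition (partialSnd X) χ)
  have hcp := (contDiffOn_partialSnd hab hO hX).continuousOn
  have hA : HasFDerivAt (superposition X) A χ := hasFDerivAt_superposition hO hX.continuousOn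
      (ContinuousLinearMap.id ℝ (F →L[ℝ] F)) hcp
      (fun t ht x hx ↦ (hasFDerivAt_partialSnd hO hX ht hx).1) hχO
  have hAn : ‖A‖ ≤ C := norm_pointwiseApply_le _ _ hC0 fun t ↦ by
    rw [superposition_apply hcp hχO]
    exact hC t
  let N : C(Icc a b, F) →L[ℝ] C(Icc a b, F) := (primitive hab.le).comp A
  have hN : ‖N‖ < 1 := by
    refine lt_of_le_of_lt ((ContinuousLinearMap.opNorm_comp_le _ _).trans ?_) hCab
    exact mul_le_mul (norm_primitive_le hab.le) hAn (norm_nonneg _) (sub_nonneg.2 hab.le)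
  -- The derivative of T in the curve is 1 - N, invertible by the Neumann series because ‖N‖ ≤ (b -
  -- a) C < 1.
  let Ψ : C(Icc a b, F) ≃L[ℝ] C(Icc a b, F) :=
    ContinuousLinearEquiv.unitsEquiv ℝ _ (Units.oneSub N hN)
  let T' : (F × C(Icc a b, F)) ≃L[ℝ] (F × C(Icc a b, F)) :=
    (ContinuousLinearEquiv.refl ℝ F).skewProd Ψ (-(constCurve a b))
  have hT' : HasFDerivAt T (T' : F × C(Icc a b, F) →L[ℝ] F × C(Icc a b, F)) (z₀, χ) := by
    have h1 : HasFDerivAt (fun q : F × C(Icc a b, F) ↦ primitive hab.le (superposition X q.2))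
        ((primitive hab.le).comp (A.comp (ContinuousLinearMap.snd ℝ F C(Icc a b, F)))) (z₀, χ) :=
      HasFDerivAt.comp (z₀, χ) (g := primitive hab.le) (f := superposition X ∘ Prod.snd)
        (hasFDerivAt_primitive hab.le _)
        (HasFDerivAt.comp (z₀, χ) (g := superposition X) (f := Prod.snd) hA hasFDerivAt_snd)
    have h2 : HasFDerivAt (fun q : F × C(Icc a b, F) ↦ constCurve a b q.1)
        ((constCurve a b).comp (ContinuousLinearMap.fst ℝ F C(Icc a b, F))) (z₀, χ) :=
      HasFDerivAt.comp (z₀, χ) (f := Prod.fst) (hasFDerivAt_constCurve z₀) hasFDerivAt_fst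
    have hs : HasFDerivAt (fun q : F × C(Icc a b, F) ↦ q.2)
        (ContinuousLinearMap.snd ℝ F C(Icc a b, F)) (z₀, χ) := hasFDerivAt_snd
    have hf : HasFDerivAt (fun q : F × C(Icc a b, F) ↦ q.1)
        (ContinuousLinearMap.fst ℝ F C(Icc a b, F)) (z₀, χ) := hasFDerivAt_fst
    have h3 := hf.prodMk ((hs.sub h2).sub h1)
    refine h3.congr_fderiv (ContinuousLinearMap.ext fun q ↦ Prod.ext rfl ?_)
    change q.2 - constCurve a b q.1 - N q.2 = (q.2 - N q.2) + -(constCurve a b q.1)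
    abel
  have hq₀ : (z₀, χ) ∈ 𝒪 := ⟨mem_univ _, hχO⟩
  have hTat : ∀ q ∈ 𝒪, ContDiffAt ℝ ∞ T q := fun q hq ↦ hT.contDiffAt (h𝒪.mem_nhds hq)
  have hTq₀ := hTat _ hq₀
  let e := hTq₀.toOpenPartialHomeomorph T hT' (by simp)
  have heT : ∀ q, e q = T q := fun _ ↦ rfl
  have hq₀e : (z₀, χ) ∈ e.source := hTq₀.mem_toOpenPartialHomeomorph_source hT' (by simp)
  have hTχ : T (z₀, χ) = (z₀, 0) := by
    have h : χ - constCurve a b z₀ - primitive hab.le (superposition X χ) = 0 := by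
      nth_rewrite 1 [hχ]
      abel
    exact Prod.ext rfl h
  -- To have the local inverse smooth on a whole neighbourhood, the derivative of T must be
  -- invertible at nearby points too, an open condition.
  have hinv : ∀ᶠ q in 𝓝 (z₀, χ), ∃ S : (F × C(Icc a b, F)) ≃L[ℝ] (F × C(Icc a b, F)),
      (S : F × C(Icc a b, F) →L[ℝ] F × C(Icc a b, F)) = fderiv ℝ T q := by
    have hcont : ContinuousAt (fderiv ℝ T) (z₀, χ) := hTq₀.continuousAt_fderiv (by simp)
    refine hcont.eventually (p := fun L ↦ ∃ S : (F × C(Icc a b, F)) ≃L[ℝ] (F × C(Icc a b, F)),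
      (S : F × C(Icc a b, F) →L[ℝ] F × C(Icc a b, F)) = L) ?_
    rw [hT'.fderiv]
    exact ContinuousLinearEquiv.nhds T'
  obtain ⟨V, hVs, hV, hq₀V⟩ := mem_nhds_iff.1 (hinv.and (h𝒪.mem_nhds hq₀))
  let ι : F → F × C(Icc a b, F) := fun z ↦ (z, 0)
  have hι : ContDiff ℝ ∞ ι := contDiff_id.prodMk contDiff_const
  let Y : Set (F × C(Icc a b, F)) := e.target ∩ e.symm ⁻¹' V
  have hY : IsOpen Y := e.isOpen_inter_preimage_symm hV
  have hsymm : e.symm (z₀, 0) = (z₀, χ) := by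
    rw [← hTχ]
    exact e.left_inv hq₀e
  refine ⟨ι ⁻¹' Y, hY.preimage hι.continuous, ⟨?_, ?_⟩, fun z ↦ (e.symm (ι z)).2, ?_, ?_, ?_⟩
  · rw [show ι z₀ = T (z₀, χ) from hTχ.symm]
    exact e.map_source hq₀e
  · change e.symm (z₀, 0) ∈ V
    rw [hsymm]
    exact hq₀V
  · intro z hz
    obtain ⟨hzt, hzV⟩ := hz
    obtain ⟨⟨S, hS⟩, hz𝒪⟩ := hVs hzV
    have hd : HasFDerivAt e (S : F × C(Icc a b, F) →L[ℝ] F × C(Icc a b, F)) (e.symm (ι z)) := by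
      rw [hS]
      exact ((hTat _ hz𝒪).differentiableAt (by simp)).hasFDerivAt
    have h1 : ContDiffAt ℝ ∞ e.symm (ι z) := e.contDiffAt_symm hzt hd (hTat _ hz𝒪)
    exact (contDiffAt_snd.comp z (h1.comp z hι.contDiffAt)).contDiffWithinAt
  · change (e.symm (z₀, 0)).2 = χ
    rw [hsymm]
  · intro z hz
    obtain ⟨hzt, hzV⟩ := hz
    have hz𝒪 := (hVs hzV).2
    have h : T (e.symm (ι z)) = (z, 0) := e.right_inv hzt
    have h1 : (e.symm (ι z)).1 = z := congrArg Prod.fst h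
    have h2 : (e.symm (ι z)).2 - constCurve a b (e.symm (ι z)).1 -
      primitive hab.le (superposition X (e.symm (ι z)).2) = 0 := congrArg Prod.snd h
    refine ⟨hz𝒪.2, ?_⟩
    rw [h1, sub_sub, sub_eq_zero] at h2
    exact h2

end CurveFamily

/-! ### The first variation formula -/

section FirstVariation

open Filter Topology

variable {F : Type} [NormedAddCommGroup F] [NormedSpace ℝ F] [CompleteSpace F] {a b : ℝ} {O : Set F}

theorem hasDerivWithinAt_IccExtend_of_eq {hab : a ≤ b} {γ η : C(Icc a b, F)} {z : F}
    (h : γ = constCurve a b z + primitive hab η) {t : ℝ} (ht : t ∈ Icc a b) :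
    HasDerivWithinAt (IccExtend hab γ) (η ⟨t, ht⟩) (Icc a b) t := by
  have h1 := (hasDerivAt_primitive hab η t).const_add z
  rw [IccExtend_of_mem hab _ ht] at h1
  refine h1.hasDerivWithinAt.congr (fun s hs ↦ ?_) ?_
  · rw [IccExtend_of_mem hab _ hs]
    exact DFunLike.congr_fun h ⟨s, hs⟩
  · rw [IccExtend_of_mem hab _ ht]
    exact DFunLike.congr_fun h ⟨t, ht⟩

/-- The first variation of `∫ₐᵇ ℓ (t, Γ z t) dt` along a family `Γ z` of solutions is a boundary
term if the derivative of `ℓ` is the total derivative of a bilinear form `β`. -/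
theorem hasFDerivAt_integral_of_isIntegralSolution (hab : a < b) (hO : IsOpen O) {X : ℝ × F → F}
    (hX : ContDiffOn ℝ ∞ X (Icc a b ×ˢ O)) {ℓ : ℝ × F → ℝ}
    (hℓ : ContDiffOn ℝ ∞ ℓ (Icc a b ×ˢ O)) (β : F →L[ℝ] F →L[ℝ] ℝ)
    (hβ : ∀ t ∈ Icc a b, ∀ x ∈ O, ∀ δ, partialSnd ℓ (t, x) δ =
      β (X (t, x)) δ + β x (partialSnd X (t, x) δ))
    {U : Set F} (hU : IsOpen U) {Γ : F → C(Icc a b, F)} (hΓ : ContDiffOn ℝ ∞ Γ U)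
    (hsol : ∀ z ∈ U, Γ z ∈ curvesIn a b O ∧ IsIntegralSolution hab.le X z (Γ z)) :
    ContDiffOn ℝ ∞ (fun z ↦ ∫ t in a..b, IccExtend hab.le (superposition ℓ (Γ z)) t) U ∧
    ContDiffOn ℝ ∞ (fun z ↦ Γ z ⟨b, right_mem_Icc.2 hab.le⟩) U ∧
    ∀ z ∈ U, ∀ h : F,
      fderiv ℝ (fun z ↦ ∫ t in a..b, IccExtend hab.le (superposition ℓ (Γ z)) t) z h =
        β (Γ z ⟨b, right_mem_Icc.2 hab.le⟩)
          (fderiv ℝ (fun z ↦ Γ z ⟨b, right_mem_Icc.2 hab.le⟩) z h) - β z h := by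
  let b' : Icc a b := ⟨b, right_mem_Icc.2 hab.le⟩
  let a' : Icc a b := ⟨a, left_mem_Icc.2 hab.le⟩
  let evF : C(Icc a b, F) →L[ℝ] F := ContinuousMap.evalCLM ℝ b'
  let evR : C(Icc a b, ℝ) →L[ℝ] ℝ := ContinuousMap.evalCLM ℝ b'
  let J : C(Icc a b, ℝ) →L[ℝ] ℝ := evR.comp (primitive hab.le)
  have hevF : ContDiff ℝ ∞ evF := ContinuousLinearMap.contDiff (E := C(Icc a b, F)) _
  have hJ : ContDiff ℝ ∞ J := ContinuousLinearMap.contDiff (E := C(Icc a b, ℝ)) _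
  have hJeq : (fun z ↦ ∫ t in a..b, IccExtend hab.le (superposition ℓ (Γ z)) t) =
      fun z ↦ J (superposition ℓ (Γ z)) := rfl
  have hmaps : MapsTo Γ U (curvesIn a b O) := fun z hz ↦ (hsol z hz).1
  have hsup : ContDiffOn ℝ ∞ (fun z ↦ superposition ℓ (Γ z)) U :=
    (contDiffOn_superposition hab hO hℓ).comp hΓ hmaps
  refine ⟨hJ.comp_contDiffOn hsup, hevF.comp_contDiffOn hΓ, fun z hz h ↦ ?_⟩
  have hΓz : HasFDerivAt Γ (fderiv ℝ Γ z) z :=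
    ((hΓ.contDiffAt (hU.mem_nhds hz)).differentiableAt (by simp)).hasFDerivAt
  obtain ⟨hzO, hzs⟩ := hsol z hz
  have hpX := (contDiffOn_partialSnd hab hO hX).continuousOn
  have hpℓ := (contDiffOn_partialSnd hab hO hℓ).continuousOn
  let AX := pointwiseApply (ContinuousLinearMap.id ℝ (F →L[ℝ] F))
    (superposition (partialSnd X) (Γ z))
  let Aℓ := pointwiseApply (ContinuousLinearMap.id ℝ (F →L[ℝ] ℝ))
    (superposition (partialSnd ℓ) (Γ z))
  have hAX : HasFDerivAt (superposition X) AX (Γ z) := hasFDerivAt_superposition hO hX.continuousOn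
      (ContinuousLinearMap.id ℝ (F →L[ℝ] F)) hpX
      (fun t ht x hx ↦ (hasFDerivAt_partialSnd hO hX ht hx).1) hzO
  have hAℓ : HasFDerivAt (superposition ℓ) Aℓ (Γ z) := hasFDerivAt_superposition hO hℓ.continuousOn
      (ContinuousLinearMap.id ℝ (F →L[ℝ] ℝ)) hpℓ
      (fun t ht x hx ↦ (hasFDerivAt_partialSnd hO hℓ ht hx).1) hzO
  have hA1 : HasFDerivAt (fun z ↦ J (superposition ℓ (Γ z))) (J.comp (Aℓ.comp (fderiv ℝ Γ z))) z :=
    HasFDerivAt.comp z (g := J) (f := superposition ℓ ∘ Γ)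
      (ContinuousLinearMap.hasFDerivAt (E := C(Icc a b, ℝ)) J) (hAℓ.comp z hΓz)
  have hA2 : HasFDerivAt (fun z ↦ Γ z b') (evF.comp (fderiv ℝ Γ z)) z :=
    HasFDerivAt.comp z (g := evF) (f := Γ)
      (ContinuousLinearMap.hasFDerivAt (E := C(Icc a b, F)) evF) hΓz
  -- Differentiating the integral equation in z gives the linearised integral equation for the
  -- variation.
  have hΓeq : fderiv ℝ Γ z = constCurve a b + (primitive hab.le).comp (AX.comp (fderiv ℝ Γ z)) := by
    have h1 : HasFDerivAt (fun z ↦ primitive hab.le (superposition X (Γ z)))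
        ((primitive hab.le).comp (AX.comp (fderiv ℝ Γ z))) z :=
      HasFDerivAt.comp z (g := primitive hab.le) (f := superposition X ∘ Γ)
        (hasFDerivAt_primitive hab.le _) (hAX.comp z hΓz)
    refine hΓz.unique (((hasFDerivAt_constCurve z).add h1).congr_of_eventuallyEq ?_)
    filter_upwards [hU.mem_nhds hz] with y hy using (hsol y hy).2
  set δ : C(Icc a b, F) := fderiv ℝ Γ z h with hδ
  have hδeq : δ = constCurve a b h + primitive hab.le (AX δ) := by
    conv_lhs => rw [hδ, hΓeq]
    rfl
  have hδa : δ a' = h := by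
    rw [hδeq, ContinuousMap.add_apply, primitive_apply]
    simp [a']
  have hAXt : ∀ t : Icc a b, AX δ t = partialSnd X (t, Γ z t) (δ t) := fun t ↦ by
    change (superposition (partialSnd X) (Γ z) t) (δ t) = _
    rw [superposition_apply hpX hzO]
  have hAℓt : ∀ t : Icc a b, Aℓ δ t = partialSnd ℓ (t, Γ z t) (δ t) := fun t ↦ by
    change (superposition (partialSnd ℓ) (Γ z) t) (δ t) = _
    rw [superposition_apply hpℓ hzO]
  -- By `hβ` the derivative of β (γ t) (δ t) is the derivative of ℓ in the direction δ, so the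
  -- integrated variation is D b - D a.
  let D : ℝ → ℝ := fun t ↦ β (IccExtend hab.le (Γ z) t) (IccExtend hab.le δ t)
  have hD : ∀ t (ht : t ∈ Icc a b), HasDerivWithinAt D (Aℓ δ ⟨t, ht⟩) (Icc a b) t := by
    intro t ht
    have h1 := hasDerivWithinAt_IccExtend_of_eq hzs ht
    have h2 := hasDerivWithinAt_IccExtend_of_eq hδeq ht
    have h3 := (β.hasFDerivAt.comp_hasDerivWithinAt t h1).clm_apply h2
    refine h3.congr_deriv ?_
    rw [hAℓt, hβ t ht _ (hzO _), hAXt]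
    simp only [Function.comp_apply]
    rw [superposition_apply hX.continuousOn hzO,
      IccExtend_of_mem hab.le _ ht, IccExtend_of_mem hab.le _ ht]
  have hDint := intervalIntegral.integral_eq_sub_of_hasDerivAt_of_le (f := D)
    (f' := IccExtend hab.le (Aℓ δ)) hab.le (fun t ht ↦ (hD t ht).continuousWithinAt)
    (fun t ht ↦ by
      rw [IccExtend_of_mem hab.le _ (Ioo_subset_Icc_self ht)]
      exact (hD t (Ioo_subset_Icc_self ht)).hasDerivAt (Icc_mem_nhds ht.1 ht.2))
    (((Aℓ δ).continuous.Icc_extend' (h := hab.le)).intervalIntegrable _ _)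
  have hDb : D b = β (Γ z b') (δ b') := by
    simp only [D, IccExtend_of_mem hab.le _ (right_mem_Icc.2 hab.le), b']
  have hDa : D a = β z h := by
    simp only [D, IccExtend_of_mem hab.le _ (left_mem_Icc.2 hab.le)]
    rw [hzs.apply_left, hδa]
  rw [hJeq, hA1.fderiv, hA2.fderiv]
  rw [hDb, hDa] at hDint
  exact hDint

end FirstVariation

/-! ### Charts and the exterior derivative of one-forms -/

section ChartCalculus

open Filter Topology

variable {F : Type*} [NormedAddCommGroup F] [NormedSpace ℝ F] {G : Type*} [TopologicalSpace G]
  {J : ModelWithCorners ℝ F G} {M : Type*} [TopologicalSpace M] [ChartedSpace G M]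
  {N : Type*} [NormedAddCommGroup N] [NormedSpace ℝ N]

theorem mfderiv_eq_fderiv_extChartAt_comp {g : N → M} {b : N}
    (hg : MDifferentiableAt 𝓘(ℝ, N) J g b) :
    mfderiv 𝓘(ℝ, N) J g b = fderiv ℝ (extChartAt J (g b) ∘ g) b := by
  simp only [mfderiv, hg, writtenInExtChartAt, extChartAt_model_space_eq_id,
    PartialEquiv.refl_symm, modelWithCornersSelf_coe, range_id, fderivWithin_univ]
  rfl

variable [IsManifold J ∞ M]

theorem ContMDiffOn.contDiffOn_extChartAt_comp {g : N → M} {V : Set N} {x : M}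
    (hg : ContMDiffOn 𝓘(ℝ, N) J ∞ g V) (hV : MapsTo g V (extChartAt J x).source) :
    ContDiffOn ℝ ∞ (extChartAt J x ∘ g) V :=
  ((contMDiffOn_extChartAt (I := J) (x := x)).comp hg
    (fun y hy ↦ by simpa using hV hy)).contDiffOn

variable [J.Boundaryless]

theorem mdifferentiableAt_extChartAt_symm {x : M} {ξ : F} (hξ : ξ ∈ (extChartAt J x).target) :
    MDifferentiableAt 𝓘(ℝ, F) J (extChartAt J x).symm ξ :=
  ((contMDiffOn_extChartAt_symm (n := ∞) x).contMDiffAt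
    ((isOpen_extChartAt_target x).mem_nhds hξ)).mdifferentiableAt (by simp)

theorem mfderiv_extChartAt_comp_mfderiv_symm {x : M} {ξ : F} (hξ : ξ ∈ (extChartAt J x).target)
    (v : F) : mfderiv J 𝓘(ℝ, F) (extChartAt J x) ((extChartAt J x).symm ξ)
      (mfderiv 𝓘(ℝ, F) J (extChartAt J x).symm ξ v) = v := by
  have h1 := mdifferentiableAt_extChartAt_symm hξ
  have h2 : MDifferentiableAt J 𝓘(ℝ, F) (extChartAt J x) ((extChartAt J x).symm ξ) :=
    mdifferentiableAt_extChartAt (by simpa using (extChartAt J x).map_target hξ)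
  have h3 : mfderiv 𝓘(ℝ, F) 𝓘(ℝ, F) (extChartAt J x ∘ (extChartAt J x).symm) ξ =
      mfderiv 𝓘(ℝ, F) 𝓘(ℝ, F) id ξ := by
    refine Filter.EventuallyEq.mfderiv_eq ?_
    filter_upwards [(isOpen_extChartAt_target x).mem_nhds hξ] with y hy
    exact (extChartAt J x).right_inv hy
  rw [mfderiv_comp ξ h2 h1, mfderiv_id] at h3
  exact DFunLike.congr_fun h3 v

theorem mfderiv_symm_comp_mfderiv_extChartAt {x y : M} (hy : y ∈ (extChartAt J x).source)
    (v : TangentSpace J y) : mfderiv 𝓘(ℝ, F) J (extChartAt J x).symm (extChartAt J x y)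
      (mfderiv J 𝓘(ℝ, F) (extChartAt J x) y v) = v := by
  have h1 := mdifferentiableAt_extChartAt_symm ((extChartAt J x).map_source hy)
  have h2 : MDifferentiableAt J 𝓘(ℝ, F) (extChartAt J x) y :=
    mdifferentiableAt_extChartAt (by simpa using hy)
  have h3 : mfderiv J J ((extChartAt J x).symm ∘ extChartAt J x) y =
      ContinuousLinearMap.id ℝ (TangentSpace J y) := by
    rw [← mfderiv_id]
    refine Filter.EventuallyEq.mfderiv_eq ?_
    filter_upwards [extChartAt_source_mem_nhds' hy] with z hz
    exact (extChartAt J x).left_inv hz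
  rw [mfderiv_comp y h1 h2] at h3
  exact DFunLike.congr_fun h3 v

/-- The exterior derivative of a one-form is natural under pull-back to a vector space. -/
theorem extDerivOneForm_mfderiv {α : ∀ y : M, TangentSpace J y →L[ℝ] ℝ} {g : N → M} {V : Set N}
    (hV : IsOpen V) (hg : ContMDiffOn 𝓘(ℝ, N) J ∞ g V) {b : N} (hb : b ∈ V)
    (hα : DifferentiableAt ℝ (oneFormInChart J α (g b)) (extChartAt J (g b) (g b)))
    {γ : N → N →L[ℝ] ℝ} (hγ : ∀ᶠ y in 𝓝 b, ∀ v : N, γ y v = α (g y) (mfderiv 𝓘(ℝ, N) J g y v))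
    (v w : N) :
    extDerivOneForm J α (g b) (mfderiv 𝓘(ℝ, N) J g b v) (mfderiv 𝓘(ℝ, N) J g b w) =
      fderiv ℝ γ b v w - fderiv ℝ γ b w v := by
  set ψ := extChartAt J (g b) with hψ
  set h : N → F := ψ ∘ g with hh
  set β : F → F →L[ℝ] ℝ := oneFormInChart J α (g b) with hβ
  have hgd : ∀ y ∈ V, MDifferentiableAt 𝓘(ℝ, N) J g y := fun y hy ↦
    (hg.contMDiffAt (hV.mem_nhds hy)).mdifferentiableAt (by simp)
  have hV' : IsOpen (V ∩ g ⁻¹' ψ.source) :=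
    hg.continuousOn.isOpen_inter_preimage hV (isOpen_extChartAt_source _)
  have hbV' : b ∈ V ∩ g ⁻¹' ψ.source := ⟨hb, mem_extChartAt_source (g b)⟩
  have hhs : ContDiffAt ℝ ∞ h b := ((hg.mono inter_subset_left).contDiffOn_extChartAt_comp
    fun y hy ↦ hy.2).contDiffAt (hV'.mem_nhds hbV')
  have hγ' : γ =ᶠ[𝓝 b] fun y ↦ (β (h y)).comp (fderiv ℝ h y) := by
    filter_upwards [hγ, hV'.mem_nhds hbV'] with y hy hyV
    refine ContinuousLinearMap.ext fun v ↦ ?_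
    rw [hy]
    have h1 : mfderiv 𝓘(ℝ, N) 𝓘(ℝ, F) h y = (mfderiv J 𝓘(ℝ, F) ψ (g y)).comp
        (mfderiv 𝓘(ℝ, N) J g y) :=
      mfderiv_comp y (mdifferentiableAt_extChartAt (by simpa [ψ] using hyV.2)) (hgd y hyV.1)
    rw [mfderiv_eq_fderiv] at h1
    have h2 := mfderiv_symm_comp_mfderiv_extChartAt hyV.2 (mfderiv 𝓘(ℝ, N) J g y v)
    have h3 : ψ.symm (h y) = g y := ψ.left_inv hyV.2
    -- The equality ψ.symm (h y) = g y cannot be rewritten inside dependent tangent spaces; reading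
    -- all covectors on the model space F permits the substitution.
    have h4 : ∀ z : M, z = g y → ∀ u : F, (α z : F →L[ℝ] ℝ) u = (α (g y) : F →L[ℝ] ℝ) u := by
      rintro _ rfl u
      rfl
    have h5 : fderiv ℝ h y v = mfderiv J 𝓘(ℝ, F) ψ (g y) (mfderiv 𝓘(ℝ, N) J g y v) :=
      DFunLike.congr_fun h1 v
    change _ = α (ψ.symm (h y)) (mfderiv 𝓘(ℝ, F) J ψ.symm (h y) (fderiv ℝ h y v))
    rw [h5]
    refine Eq.trans ?_ (h4 _ h3 _).symm
    exact congrArg (α (g y)) h2.symm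
  have hD : fderiv ℝ γ b = _ := hγ'.fderiv_eq
  have hc : HasFDerivAt (fun y ↦ β (h y)) ((fderiv ℝ β (h b)).comp (fderiv ℝ h b)) b :=
    HasFDerivAt.comp b (g := β) (f := h) hα.hasFDerivAt (hhs.differentiableAt (by simp)).hasFDerivAt
  have hd : HasFDerivAt (fderiv ℝ h) (fderiv ℝ (fderiv ℝ h) b) b :=
    ((hhs.fderiv_right (m := 1) (by norm_cast)).differentiableAt (by simp)).hasFDerivAt
  -- The terms containing the second derivative of h cancel by its symmetry.
  have hsymm : IsSymmSndFDerivAt ℝ h b := hhs.isSymmSndFDerivAt (by simp only [minSmoothness_of_isRCLikeNormedField]; norm_cast)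
  rw [hD, (hc.clm_comp hd).fderiv, mfderiv_eq_fderiv_extChartAt_comp (hgd b hb)]
  change fderiv ℝ β (h b) (fderiv ℝ h b v) (fderiv ℝ h b w) -
    fderiv ℝ β (h b) (fderiv ℝ h b w) (fderiv ℝ h b v) =
      (β (h b) (fderiv ℝ (fderiv ℝ h) b v w) +
        fderiv ℝ β (h b) (fderiv ℝ h b v) (fderiv ℝ h b w)) -
      (β (h b) (fderiv ℝ (fderiv ℝ h) b w v) +
        fderiv ℝ β (h b) (fderiv ℝ h b w) (fderiv ℝ h b v))
  rw [hsymm.eq v w]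
  ring

end ChartCalculus

/-! ### Hamiltonian vector fields on a symplectic vector space -/

section HamiltonianField

variable {F : Type} [NormedAddCommGroup F] [NormedSpace ℝ F] {β : F →L[ℝ] F →L[ℝ] ℝ}
  {e : F ≃L[ℝ] (F →L[ℝ] ℝ)}

/-- The Hamiltonian vector with differential `L` with respect to a symplectic form, given as an
isomorphism `e` from `F` to its dual: the solution `v` of `e v = - L`. -/
noncomputable def hamiltonianVector (e : F ≃L[ℝ] (F →L[ℝ] ℝ)) (L : F →L[ℝ] ℝ) : F :=
  -e.symm L

theorem apply_hamiltonianVector (L : F →L[ℝ] ℝ) (w : F) : e (hamiltonianVector e L) w = -L w := by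
  rw [hamiltonianVector, map_neg, e.apply_symm_apply]
  rfl

theorem eq_hamiltonianVector {L : F →L[ℝ] ℝ} {v : F} (h : ∀ w, e v w = -L w) :
    v = hamiltonianVector e L :=
  e.injective (ContinuousLinearMap.ext fun w ↦ (h w).trans (apply_hamiltonianVector L w).symm)

/-- The Hamiltonian vector field of a time-dependent Hamiltonian. -/
noncomputable def hamiltonianField (e : F ≃L[ℝ] (F →L[ℝ] ℝ)) (h : ℝ × F → ℝ) (q : ℝ × F) : F :=
  hamiltonianVector e (partialSnd h q)

/-- The Lagrangian `β (x, X) - h` along the flow of the Hamiltonian vector field `X`. -/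
noncomputable def lagrangianAlong (β : F →L[ℝ] F →L[ℝ] ℝ) (e : F ≃L[ℝ] (F →L[ℝ] ℝ)) (h : ℝ × F → ℝ) (q : ℝ × F) :
    ℝ :=
  β q.2 (hamiltonianField e h q) - h q

variable {a b : ℝ} {O : Set F} {h : ℝ × F → ℝ}

theorem contDiffOn_hamiltonianField (hab : a < b) (hO : IsOpen O)
    (hh : ContDiffOn ℝ ∞ h (Icc a b ×ˢ O)) :
    ContDiffOn ℝ ∞ (hamiltonianField e h) (Icc a b ×ˢ O) :=
  (e.symm.contDiff.comp_contDiffOn (contDiffOn_partialSnd hab hO hh)).neg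

theorem contDiffOn_lagrangianAlong (hab : a < b) (hO : IsOpen O)
    (hh : ContDiffOn ℝ ∞ h (Icc a b ×ˢ O)) :
    ContDiffOn ℝ ∞ (lagrangianAlong β e h) (Icc a b ×ˢ O) :=
  ((β.contDiff.comp_contDiffOn contDiff_snd.contDiffOn).clm_apply
    (contDiffOn_hamiltonianField hab hO hh)).sub hh

/-- The product rule produces β δ X - ∂h δ, and the defining equation e X δ = -∂h δ turns this into
β X δ. The result is the hypothesis `hβ` of the first variation formula. -/
theorem partialSnd_lagrangianAlong (he : ∀ v w, e v w = β v w - β w v) (hab : a < b)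
    (hO : IsOpen O) (hh : ContDiffOn ℝ ∞ h (Icc a b ×ˢ O)) {t : ℝ} (ht : t ∈ Icc a b) {x : F}
    (hx : x ∈ O) (δ : F) :
    partialSnd (lagrangianAlong β e h) (t, x) δ =
      β (hamiltonianField e h (t, x)) δ + β x (partialSnd (hamiltonianField e h) (t, x) δ) := by
  have h1 := (hasFDerivAt_partialSnd hO (contDiffOn_hamiltonianField (e := e) hab hO hh) ht hx).1
  have h2 := (hasFDerivAt_partialSnd hO hh ht hx).1
  have h3 := ((β.hasFDerivAt (x := x)).clm_apply h1).sub h2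
  have h4 : partialSnd (lagrangianAlong β e h) (t, x) = _ := h3.fderiv
  have h5 := apply_hamiltonianVector (e := e) (partialSnd h (t, x)) δ
  rw [he] at h5
  rw [h4]
  change (β x (partialSnd (hamiltonianField e h) (t, x) δ) +
    β δ (hamiltonianField e h (t, x))) - partialSnd h (t, x) δ = _
  simp only [hamiltonianField] at h5 ⊢
  linarith

theorem ContinuousLinearMap.hasFDerivAt_of_eqOn {G : Type*} [NormedAddCommGroup G] [NormedSpace ℝ G]
    (L : F →L[ℝ] G) {f : F → G} {U : Set F} (hU : IsOpen U) (hf : ∀ y ∈ U, f y = L y) {x : F}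
    (hx : x ∈ U) : HasFDerivAt f L x :=
  L.hasFDerivAt.congr_of_eventuallyEq (Filter.eventually_of_mem (hU.mem_nhds hx) hf)

theorem finrank_continuousDual (V : Type*) [NormedAddCommGroup V] [NormedSpace ℝ V]
    [FiniteDimensional ℝ V] : Module.finrank ℝ (V →L[ℝ] ℝ) = Module.finrank ℝ V :=
  (LinearMap.toContinuousLinearMap (𝕜 := ℝ) (E := V) (F' := ℝ)).symm.finrank_eq.trans
    Subspace.dual_finrank_eq

theorem exists_equiv_of_nondegenerate [FiniteDimensional ℝ F] {β : F →L[ℝ] F →L[ℝ] ℝ}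
    (hβ : ∀ v, (∀ w, β v w - β w v = 0) → v = 0) :
    ∃ e : F ≃L[ℝ] (F →L[ℝ] ℝ), ∀ v w, e v w = β v w - β w v := by
  let Ω : F →L[ℝ] (F →L[ℝ] ℝ) := β - β.flip
  have hΩ : Function.Injective Ω.toLinearMap :=
    (injective_iff_map_eq_zero _).2 fun v hv ↦ hβ v fun w ↦ DFunLike.congr_fun hv w
  exact ⟨(LinearMap.linearEquivOfInjective Ω.toLinearMap hΩ
    (finrank_continuousDual _).symm).toContinuousLinearEquiv, fun _ _ ↦ rfl⟩

end HamiltonianField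

section CanonicalCoordinates

variable (E : Type) [NormedAddCommGroup E] [NormedSpace ℝ E]

/-- The pairing `((u, p), (u', p')) ↦ p u'` on `E × E^*`. -/
noncomputable def momentumPairing :
    (E × (E →L[ℝ] ℝ)) →L[ℝ] (E × (E →L[ℝ] ℝ)) →L[ℝ] ℝ :=
  ((ContinuousLinearMap.compL ℝ (E × (E →L[ℝ] ℝ)) E ℝ).flip
    (ContinuousLinearMap.fst ℝ E (E →L[ℝ] ℝ))).comp (ContinuousLinearMap.snd ℝ E (E →L[ℝ] ℝ))

variable {E}

theorem momentumPairing_apply (v w : E × (E →L[ℝ] ℝ)) : momentumPairing E v w = v.2 w.1 := rfl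

variable [FiniteDimensional ℝ E]

theorem exists_canonicalEquiv : ∃ e : (E × (E →L[ℝ] ℝ)) ≃L[ℝ] ((E × (E →L[ℝ] ℝ)) →L[ℝ] ℝ),
    ∀ v w, e v w = momentumPairing E v w - momentumPairing E w v := by
  refine exists_equiv_of_nondegenerate fun v h ↦ Prod.ext ?_ ?_
  · by_contra hne
    obtain ⟨f, hf⟩ := SeparatingDual.exists_ne_zero (R := ℝ) hne
    have := h (0, f)
    simp only [momentumPairing_apply, map_zero, zero_sub, neg_eq_zero] at this
    exact hf this
  · ext u
    simpa [momentumPairing_apply] using h (u, 0)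

variable (E) in
/-- The isomorphism of `E × E^*` with its dual given by the canonical symplectic form. -/
noncomputable def canonicalEquiv : (E × (E →L[ℝ] ℝ)) ≃L[ℝ] ((E × (E →L[ℝ] ℝ)) →L[ℝ] ℝ) :=
  exists_canonicalEquiv.choose

theorem canonicalEquiv_apply (v w : E × (E →L[ℝ] ℝ)) :
    canonicalEquiv E v w = v.2 w.1 - w.2 v.1 :=
  exists_canonicalEquiv.choose_spec v w

end CanonicalCoordinates

/-! ### Canonical coordinates on the cotangent bundle -/

section CotangentCharts

open Filter Topology

variable {r : ℕ} {Q : Type*} [TopologicalSpace Q] [ChartedSpace (EuclideanSpace ℝ (Fin r)) Q]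
  [IsManifold (𝓡 r) ∞ Q]

theorem mem_cotChart_source {c z : CotBundle r Q} :
    z ∈ (extChartAt (cotModel r) c).source ↔ z.proj ∈ (extChartAt (𝓡 r) c.proj).source := by
  rw [FiberBundle.extChartAt]
  simp only [PartialEquiv.trans_source, PartialEquiv.prod_source, PartialEquiv.refl_source,
    mem_inter_iff, mem_preimage, mem_prod, mem_univ, and_true, extChartAt_source]
  constructor
  · rintro ⟨h1, h2⟩
    exact h2
  · intro h
    exact ⟨⟨h, mem_univ _⟩, h⟩

theorem cotChart_fst (c z : CotBundle r Q) :
    (extChartAt (cotModel r) c z).1 = extChartAt (𝓡 r) c.proj z.proj := by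
  rw [FiberBundle.extChartAt]
  rfl

/-- The fibre coordinate of a bundle chart is the covector pulled back by the inverse of the base
chart. This is why θ = p_a du^a holds in each of these charts. -/
theorem cotChart_snd {c z : CotBundle r Q} (hz : z.proj ∈ (extChartAt (𝓡 r) c.proj).source)
    (a : EuclideanSpace ℝ (Fin r)) :
    (extChartAt (cotModel r) c z).2 a = z.snd (mfderiv 𝓘(ℝ, EuclideanSpace ℝ (Fin r)) (𝓡 r)
      (extChartAt (𝓡 r) c.proj).symm (extChartAt (𝓡 r) c.proj z.proj) a) := by
  rw [FiberBundle.extChartAt]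
  have h := TangentBundle.symmL_trivializationAt (I := 𝓡 r) (x₀ := c.proj) (x := z.proj)
    (by simpa using hz)
  rw [ModelWithCorners.Boundaryless.range_eq_univ, mfderivWithin_univ] at h
  change (trivializationAt ℝ (Trivial Q ℝ) c.proj).continuousLinearMapAt ℝ z.proj (z.snd
    ((trivializationAt (EuclideanSpace ℝ (Fin r)) (TangentSpace (𝓡 r)) c.proj).symmL ℝ z.proj a))
      = _
  rw [h]
  exact DFunLike.congr_fun (Bundle.Trivial.continuousLinearMapAt_trivialization ℝ Q ℝ z.proj) _

theorem cotChart_symm_proj {c : CotBundle r Q} {ξ : EuclideanSpace ℝ (Fin r) × CotFiber r}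
    (hξ : ξ ∈ (extChartAt (cotModel r) c).target) :
    ((extChartAt (cotModel r) c).symm ξ).proj = (extChartAt (𝓡 r) c.proj).symm ξ.1 := by
  have h1 := (extChartAt (cotModel r) c).map_target hξ
  have h2 := cotChart_fst c ((extChartAt (cotModel r) c).symm ξ)
  rw [(extChartAt (cotModel r) c).right_inv hξ] at h2
  rw [h2, PartialEquiv.left_inv _ (mem_cotChart_source.1 h1)]

theorem cotChart_target (c : CotBundle r Q) :
    (extChartAt (cotModel r) c).target = (extChartAt (𝓡 r) c.proj).target ×ˢ univ := by
  refine Subset.antisymm ?_ ?_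
  · intro ξ hξ
    rw [FiberBundle.extChartAt_target] at hξ
    exact ⟨hξ.1.1, mem_univ _⟩
  · rintro ξ ⟨h1, -⟩
    rw [FiberBundle.extChartAt_target]
    refine ⟨⟨h1, ?_⟩, mem_univ _⟩
    have h2 := (extChartAt (𝓡 r) c.proj).map_target h1
    rw [extChartAt_source] at h2
    exact ⟨h2, mem_univ _⟩

theorem mdifferentiable_proj (z : CotBundle r Q) :
    MDifferentiableAt (cotModel r) (𝓡 r) (fun y : CotBundle r Q ↦ y.proj) z :=
  ((contMDiff_proj (n := ∞) (fun u : Q ↦ TangentSpace (𝓡 r) u →L[ℝ] Trivial Q ℝ u)).contMDiffAt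
    (x := z)).mdifferentiableAt (by simp)

theorem mfderiv_proj_mfderiv_cotChart_symm {c : CotBundle r Q}
    {ξ : EuclideanSpace ℝ (Fin r) × CotFiber r} (hξ : ξ ∈ (extChartAt (cotModel r) c).target)
    (v : EuclideanSpace ℝ (Fin r) × CotFiber r) :
    mfderiv (cotModel r) (𝓡 r) (fun y : CotBundle r Q ↦ y.proj)
      ((extChartAt (cotModel r) c).symm ξ)
      (mfderiv 𝓘(ℝ, EuclideanSpace ℝ (Fin r) × CotFiber r) (cotModel r)
        (extChartAt (cotModel r) c).symm ξ v) =
      mfderiv 𝓘(ℝ, EuclideanSpace ℝ (Fin r)) (𝓡 r) (extChartAt (𝓡 r) c.proj).symm ξ.1 v.1 := by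
  have hξ1 : ξ.1 ∈ (extChartAt (𝓡 r) c.proj).target := by
    rw [cotChart_target] at hξ
    exact hξ.1
  have h1 := mfderiv_comp ξ (mdifferentiable_proj ((extChartAt (cotModel r) c).symm ξ))
    (mdifferentiableAt_extChartAt_symm hξ)
  have h2 : mfderiv 𝓘(ℝ, EuclideanSpace ℝ (Fin r) × CotFiber r) (𝓡 r)
      ((fun y : CotBundle r Q ↦ y.proj) ∘ (extChartAt (cotModel r) c).symm) ξ =
      mfderiv 𝓘(ℝ, EuclideanSpace ℝ (Fin r) × CotFiber r) (𝓡 r)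
        ((extChartAt (𝓡 r) c.proj).symm ∘ Prod.fst) ξ := by
    refine Filter.EventuallyEq.mfderiv_eq ?_
    filter_upwards [(isOpen_extChartAt_target c).mem_nhds hξ] with η hη
    exact cotChart_symm_proj hη
  have hfst : HasMFDerivAt 𝓘(ℝ, EuclideanSpace ℝ (Fin r) × CotFiber r)
      𝓘(ℝ, EuclideanSpace ℝ (Fin r)) Prod.fst ξ
      (ContinuousLinearMap.fst ℝ (EuclideanSpace ℝ (Fin r)) (CotFiber r)) :=
    hasFDerivAt_fst.hasMFDerivAt
  have h3 := mfderiv_comp ξ (mdifferentiableAt_extChartAt_symm hξ1) hfst.mdifferentiableAt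
  rw [hfst.mfderiv] at h3
  exact DFunLike.congr_fun (h1.symm.trans (h2.trans h3)) v

/-- In every chart of the cotangent bundle the Liouville form is `p_a du^a`. -/
theorem liouvilleForm_mfderiv_cotChart_symm {c : CotBundle r Q}
    {ξ : EuclideanSpace ℝ (Fin r) × CotFiber r} (hξ : ξ ∈ (extChartAt (cotModel r) c).target)
    (v : EuclideanSpace ℝ (Fin r) × CotFiber r) :
    liouvilleForm ((extChartAt (cotModel r) c).symm ξ)
      (mfderiv 𝓘(ℝ, EuclideanSpace ℝ (Fin r) × CotFiber r) (cotModel r)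
        (extChartAt (cotModel r) c).symm ξ v) = ξ.2 v.1 := by
  have h1 := (extChartAt (cotModel r) c).map_target hξ
  have h2 := cotChart_snd (mem_cotChart_source.1 h1) v.1
  have h3 := cotChart_fst c ((extChartAt (cotModel r) c).symm ξ)
  rw [(extChartAt (cotModel r) c).right_inv hξ] at h2 h3
  rw [h2, ← h3]
  exact congrArg ((extChartAt (cotModel r) c).symm ξ).snd (mfderiv_proj_mfderiv_cotChart_symm hξ v)

theorem oneFormInChart_liouvilleForm {c : CotBundle r Q}
    {ξ : EuclideanSpace ℝ (Fin r) × CotFiber r} (hξ : ξ ∈ (extChartAt (cotModel r) c).target) :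
    oneFormInChart (cotModel r) liouvilleForm c ξ = momentumPairing _ ξ :=
  ContinuousLinearMap.ext fun v ↦ liouvilleForm_mfderiv_cotChart_symm hξ v

end CotangentCharts

/-! ### Manifolds whose one-form has the same linear expression in all charts -/

section CanonicalOneForm

open Filter Topology

variable {F : Type} [NormedAddCommGroup F] [NormedSpace ℝ F] {G : Type*} [TopologicalSpace G]
  {J : ModelWithCorners ℝ F G} {M : Type*} [TopologicalSpace M] [ChartedSpace G M]
  {θ : M → F →L[ℝ] ℝ} {β : F →L[ℝ] F →L[ℝ] ℝ} {e : F ≃L[ℝ] (F →L[ℝ] ℝ)}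

/-- The differential at `z` of the preferred chart at `c`, as a map of the model space. -/
noncomputable def chartDeriv (J : ModelWithCorners ℝ F G) (c z : M) : F →L[ℝ] F :=
  mfderiv J 𝓘(ℝ, F) (extChartAt J c) z

/-- The differential at `ξ` of the inverse of the preferred chart at `c`. -/
noncomputable def chartSymmDeriv (J : ModelWithCorners ℝ F G) (c : M) (ξ : F) : F →L[ℝ] F :=
  mfderiv 𝓘(ℝ, F) J (extChartAt J c).symm ξ

/-- The one-form `θ` is given in all charts by the same bilinear form `β`, the differential of
which is the symplectic form `e`. -/
structure IsCanonicalOneForm (J : ModelWithCorners ℝ F G) (θ : M → F →L[ℝ] ℝ)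
    (β : F →L[ℝ] F →L[ℝ] ℝ) (e : F ≃L[ℝ] (F →L[ℝ] ℝ)) : Prop where
  inChart : ∀ c : M, ∀ ξ ∈ (extChartAt J c).target, oneFormInChart J θ c ξ = β ξ
  form_eq : ∀ v w, e v w = β v w - β w v

theorem IsCanonicalOneForm.apply_chartSymmDeriv (hθ : IsCanonicalOneForm J θ β e) {c : M} {ξ : F}
    (hξ : ξ ∈ (extChartAt J c).target) (v : F) :
    θ ((extChartAt J c).symm ξ) (chartSymmDeriv J c ξ v) = β ξ v :=
  DFunLike.congr_fun (hθ.inChart c ξ hξ) v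

/-- The Hamiltonian vector field of a time-dependent Hamiltonian on `M`. -/
noncomputable def hamVec (J : ModelWithCorners ℝ F G) (e : F ≃L[ℝ] (F →L[ℝ] ℝ)) (H : ℝ → M → ℝ)
    (t : ℝ) (z : M) : F :=
  hamiltonianVector e (mfderiv J 𝓘(ℝ, ℝ) (H t) z)

/-- The Hamiltonian in the chart at `c`. -/
noncomputable def localHam (J : ModelWithCorners ℝ F G) (H : ℝ → M → ℝ) (c : M) (q : ℝ × F) : ℝ :=
  H q.1 ((extChartAt J c).symm q.2)

/-- The Lagrangian `θ (v) - H` along the Hamiltonian vector field `v`. -/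
noncomputable def lagrangianAt (J : ModelWithCorners ℝ F G) (θ : M → F →L[ℝ] ℝ)
    (e : F ≃L[ℝ] (F →L[ℝ] ℝ)) (H : ℝ → M → ℝ) (t : ℝ) (z : M) : ℝ :=
  θ z (hamVec J e H t z) - H t z

/-- A linear map from `ℝ` to the model space, as the differential of a curve. -/
noncomputable def velocityMap (v : F) : ℝ →L[ℝ] F := (1 : ℝ →L[ℝ] ℝ).smulRight v

/-- The curve `χ` is an integral curve of the Hamiltonian vector field of `H` on `[a, b]`. -/
def IsHamCurve (J : ModelWithCorners ℝ F G) (e : F ≃L[ℝ] (F →L[ℝ] ℝ)) (H : ℝ → M → ℝ) (a b : ℝ)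
    (χ : ℝ → M) : Prop :=
  ∀ t ∈ Icc a b, HasMFDerivWithinAt 𝓘(ℝ, ℝ) J χ (Icc a b) t
    (velocityMap (F := F) (hamVec J e H t (χ t)))

variable {H : ℝ → M → ℝ} {a b : ℝ}

theorem mdifferentiableAt_hamiltonian
    (hH : ContMDiffOn (𝓘(ℝ, ℝ).prod J) 𝓘(ℝ, ℝ) ∞ (fun x : ℝ × M ↦ H x.1 x.2)
      (Icc a b ×ˢ univ)) {t : ℝ} (ht : t ∈ Icc a b) (z : M) :
    MDifferentiableAt J 𝓘(ℝ, ℝ) (H t) z := by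
  have h : ContMDiff J 𝓘(ℝ, ℝ) ∞ (H t) := by
    rw [← contMDiffOn_univ]
    exact hH.comp ((contMDiff_const (c := t)).prodMk contMDiff_id).contMDiffOn
      fun y _ ↦ ⟨ht, mem_univ _⟩
  exact (h z).mdifferentiableAt (by simp)

theorem IsCanonicalOneForm.hasFDerivAt_oneFormInChart [J.Boundaryless]
    (hθ : IsCanonicalOneForm J θ β e) {c : M} {ξ : F} (hξ : ξ ∈ (extChartAt J c).target) :
    HasFDerivAt (oneFormInChart J θ c) β ξ :=
  β.hasFDerivAt_of_eqOn (isOpen_extChartAt_target c) (hθ.inChart c) hξ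

theorem IsCanonicalOneForm.extDerivOneForm_eq [J.Boundaryless]
    (hθ : IsCanonicalOneForm J θ β e) (z : M) (v w : F) :
    extDerivOneForm J θ z v w = e v w := by
  have h := (hθ.hasFDerivAt_oneFormInChart (mem_extChartAt_target z)).fderiv
  rw [hθ.form_eq, ← h]
  rfl

variable [IsManifold J ∞ M]

theorem contDiffOn_localHam
    (hH : ContMDiffOn (𝓘(ℝ, ℝ).prod J) 𝓘(ℝ, ℝ) ∞ (fun x : ℝ × M ↦ H x.1 x.2)
      (Icc a b ×ˢ univ)) (c : M) :
    ContDiffOn ℝ ∞ (localHam J H c) (Icc a b ×ˢ (extChartAt J c).target) := by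
  have h1 : ContMDiffOn 𝓘(ℝ, ℝ × F) 𝓘(ℝ, ℝ) ∞ (fun q : ℝ × F ↦ q.1)
      (Icc a b ×ˢ (extChartAt J c).target) := contDiff_fst.contMDiff.contMDiffOn
  have h2 : ContMDiffOn 𝓘(ℝ, ℝ × F) J ∞ (fun q : ℝ × F ↦ (extChartAt J c).symm q.2)
      (Icc a b ×ˢ (extChartAt J c).target) :=
    (contMDiffOn_extChartAt_symm c).comp contDiff_snd.contMDiff.contMDiffOn fun q hq ↦ hq.2
  exact (hH.comp (h1.prodMk h2) fun q hq ↦ ⟨hq.1, mem_univ _⟩).contDiffOn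

theorem hasMFDerivAt_extChartAt_chartDeriv {c z : M} (hz : z ∈ (extChartAt J c).source) :
    HasMFDerivAt J 𝓘(ℝ, F) (extChartAt J c) z (chartDeriv (F := F) J c z) :=
  (mdifferentiableAt_extChartAt (by simpa using hz)).hasMFDerivAt

variable [J.Boundaryless]

theorem chartDeriv_chartSymmDeriv {c : M} {ξ : F} (hξ : ξ ∈ (extChartAt J c).target) (v : F) :
    chartDeriv J c ((extChartAt J c).symm ξ) (chartSymmDeriv J c ξ v) = v :=
  mfderiv_extChartAt_comp_mfderiv_symm hξ v

theorem chartSymmDeriv_chartDeriv {c z : M} (hz : z ∈ (extChartAt J c).source) (v : F) :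
    chartSymmDeriv J c (extChartAt J c z) (chartDeriv J c z v) = v :=
  mfderiv_symm_comp_mfderiv_extChartAt hz v

theorem hasMFDerivAt_extChartAt_symm {c : M} {ξ : F} (hξ : ξ ∈ (extChartAt J c).target) :
    HasMFDerivAt 𝓘(ℝ, F) J (extChartAt J c).symm ξ (chartSymmDeriv (F := F) J c ξ) :=
  (mdifferentiableAt_extChartAt_symm hξ).hasMFDerivAt

namespace IsCanonicalOneForm

theorem apply_eq (hθ : IsCanonicalOneForm J θ β e) {c z : M} (hz : z ∈ (extChartAt J c).source)
    (v : F) : θ z v = β (extChartAt J c z) (chartDeriv J c z v) := by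
  rw [← hθ.apply_chartSymmDeriv ((extChartAt J c).map_source hz), (extChartAt J c).left_inv hz,
    chartSymmDeriv_chartDeriv hz]

/-- Both sides are dθ, computed in two charts. In particular, changes of charts are symplectic. -/
theorem form_chartSymmDeriv (hθ : IsCanonicalOneForm J θ β e) {c : M} {ξ : F}
    (hξ : ξ ∈ (extChartAt J c).target) (v w : F) :
    e (chartSymmDeriv J c ξ v) (chartSymmDeriv J c ξ w) = e v w := by
  have h := extDerivOneForm_mfderiv (J := J) (α := θ)
    (g := (extChartAt J c).symm) (isOpen_extChartAt_target c)
    (contMDiffOn_extChartAt_symm c) hξ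
    (hθ.hasFDerivAt_oneFormInChart (mem_extChartAt_target _)).differentiableAt
    (γ := oneFormInChart J θ c) (Eventually.of_forall fun _ _ ↦ rfl) v w
  rw [(hθ.hasFDerivAt_oneFormInChart hξ).fderiv] at h
  exact (hθ.extDerivOneForm_eq _ _ _).symm.trans (h.trans (hθ.form_eq v w).symm)

end IsCanonicalOneForm

theorem mfderiv_hamiltonian_chartSymmDeriv
    (hH : ContMDiffOn (𝓘(ℝ, ℝ).prod J) 𝓘(ℝ, ℝ) ∞ (fun x : ℝ × M ↦ H x.1 x.2)
      (Icc a b ×ˢ univ)) {t : ℝ} (ht : t ∈ Icc a b) {c : M} {ξ : F}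
    (hξ : ξ ∈ (extChartAt J c).target) (w : F) :
    (mfderiv J 𝓘(ℝ, ℝ) (H t) ((extChartAt J c).symm ξ) : F →L[ℝ] ℝ) (chartSymmDeriv J c ξ w) =
      partialSnd (localHam J H c) (t, ξ) w := by
  have h1 := mfderiv_comp ξ (mdifferentiableAt_hamiltonian hH ht _)
    (mdifferentiableAt_extChartAt_symm hξ)
  rw [mfderiv_eq_fderiv] at h1
  exact (DFunLike.congr_fun h1 w).symm

namespace IsCanonicalOneForm

/-- The differential of the chart preserves e, so it carries the solution of e v = -dH in one chart
to the solution in the other. -/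
theorem hamVec_symm (hθ : IsCanonicalOneForm J θ β e)
    (hH : ContMDiffOn (𝓘(ℝ, ℝ).prod J) 𝓘(ℝ, ℝ) ∞ (fun x : ℝ × M ↦ H x.1 x.2)
      (Icc a b ×ˢ univ)) {t : ℝ} (ht : t ∈ Icc a b) {c : M} {ξ : F}
    (hξ : ξ ∈ (extChartAt J c).target) :
    hamVec J e H t ((extChartAt J c).symm ξ) =
      chartSymmDeriv J c ξ (hamiltonianField e (localHam J H c) (t, ξ)) := by
  refine Eq.symm (eq_hamiltonianVector fun w ↦ ?_)
  have hs := (extChartAt J c).map_target hξ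
  have h1 := chartSymmDeriv_chartDeriv hs w
  rw [(extChartAt J c).right_inv hξ] at h1
  have h2 := mfderiv_hamiltonian_chartSymmDeriv hH ht hξ
    (chartDeriv J c ((extChartAt J c).symm ξ) w)
  have h3 := hθ.form_chartSymmDeriv hξ (hamiltonianField e (localHam J H c) (t, ξ))
    (chartDeriv J c ((extChartAt J c).symm ξ) w)
  rw [hamiltonianField, apply_hamiltonianVector] at h3
  rw [h1] at h2 h3
  exact h3.trans (congrArg Neg.neg h2.symm)

theorem chartDeriv_hamVec (hθ : IsCanonicalOneForm J θ β e)
    (hH : ContMDiffOn (𝓘(ℝ, ℝ).prod J) 𝓘(ℝ, ℝ) ∞ (fun x : ℝ × M ↦ H x.1 x.2)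
      (Icc a b ×ˢ univ)) {t : ℝ} (ht : t ∈ Icc a b) {c z : M}
    (hz : z ∈ (extChartAt J c).source) :
    chartDeriv J c z (hamVec J e H t z) =
      hamiltonianField e (localHam J H c) (t, extChartAt J c z) := by
  have hξ := (extChartAt J c).map_source hz
  have h1 := hθ.hamVec_symm hH ht hξ
  have h2 := chartDeriv_chartSymmDeriv hξ
    (hamiltonianField e (localHam J H c) (t, extChartAt J c z))
  rwa [← h1, (extChartAt J c).left_inv hz] at h2

theorem lagrangianAt_symm (hθ : IsCanonicalOneForm J θ β e)
    (hH : ContMDiffOn (𝓘(ℝ, ℝ).prod J) 𝓘(ℝ, ℝ) ∞ (fun x : ℝ × M ↦ H x.1 x.2)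
      (Icc a b ×ˢ univ)) {t : ℝ} (ht : t ∈ Icc a b) {c : M} {ξ : F}
    (hξ : ξ ∈ (extChartAt J c).target) :
    lagrangianAt J θ e H t ((extChartAt J c).symm ξ) =
      lagrangianAlong β e (localHam J H c) (t, ξ) := by
  rw [lagrangianAt, hθ.hamVec_symm hH ht hξ, hθ.apply_chartSymmDeriv hξ]
  rfl

theorem hasDerivWithinAt_extChartAt_comp (hθ : IsCanonicalOneForm J θ β e)
    {a' b' : ℝ} (hH : ContMDiffOn (𝓘(ℝ, ℝ).prod J) 𝓘(ℝ, ℝ) ∞ (fun x : ℝ × M ↦ H x.1 x.2)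
      (Icc a' b' ×ˢ univ)) {χ : ℝ → M} (hχ : IsHamCurve J e H a b χ) {t : ℝ} (ht : t ∈ Icc a b)
    (ht' : t ∈ Icc a' b') {c : M} (hc : χ t ∈ (extChartAt J c).source) :
    HasDerivWithinAt (extChartAt J c ∘ χ)
      (hamiltonianField e (localHam J H c) (t, extChartAt J c (χ t))) (Icc a b) t := by
  have h1 := (hasMFDerivAt_extChartAt_chartDeriv hc).comp_hasMFDerivWithinAt t (hχ t ht)
  have h2 : HasFDerivWithinAt (extChartAt J c ∘ χ)
    ((chartDeriv J c (χ t)).comp (velocityMap (hamVec J e H t (χ t)))) (Icc a b) t :=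
    h1.hasFDerivWithinAt
  refine h2.hasDerivWithinAt.congr_deriv ?_
  rw [← hθ.chartDeriv_hamVec hH ht' hc]
  simp [velocityMap]

theorem hasMFDerivWithinAt_symm_comp (hθ : IsCanonicalOneForm J θ β e)
    (hH : ContMDiffOn (𝓘(ℝ, ℝ).prod J) 𝓘(ℝ, ℝ) ∞ (fun x : ℝ × M ↦ H x.1 x.2)
      (Icc a b ×ˢ univ)) {ξ : ℝ → F} {t : ℝ} {s : Set ℝ}
    (ht : t ∈ Icc a b) {c : M} (hξt : ξ t ∈ (extChartAt J c).target)
    (hξ : HasDerivWithinAt ξ (hamiltonianField e (localHam J H c) (t, ξ t)) s t) :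
    HasMFDerivWithinAt 𝓘(ℝ, ℝ) J ((extChartAt J c).symm ∘ ξ) s t
      (velocityMap (F := F) (hamVec J e H t ((extChartAt J c).symm (ξ t)))) := by
  have h1 := (hasMFDerivAt_extChartAt_symm hξt).comp_hasMFDerivWithinAt t
    hξ.hasFDerivWithinAt.hasMFDerivWithinAt
  have h2 : velocityMap (hamVec J e H t ((extChartAt J c).symm (ξ t))) =
      (chartSymmDeriv J c (ξ t)).comp
        (velocityMap (hamiltonianField e (localHam J H c) (t, ξ t))) := by
    ext
    simp only [velocityMap, hθ.hamVec_symm hH ht hξt]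
    simp
  have h3 : velocityMap (hamiltonianField e (localHam J H c) (t, ξ t)) =
      ContinuousLinearMap.toSpanSingleton ℝ (hamiltonianField e (localHam J H c) (t, ξ t)) := by
    ext
    simp [velocityMap]
  rw [← h3] at h1
  exact h2 ▸ h1

end IsCanonicalOneForm

end CanonicalOneForm

/-! ### Uniqueness of integral curves -/

section Uniqueness

open Filter Topology

variable {F : Type} [NormedAddCommGroup F] [NormedSpace ℝ F] {G : Type*} [TopologicalSpace G]
  {J : ModelWithCorners ℝ F G} {M : Type*} [TopologicalSpace M] [ChartedSpace G M]
  {θ : M → F →L[ℝ] ℝ} {β : F →L[ℝ] F →L[ℝ] ℝ} {e : F ≃L[ℝ] (F →L[ℝ] ℝ)}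

theorem exists_lipschitzOnWith {a b : ℝ} {O : Set F} {X : ℝ × F → F} (hab : a < b) (hO : IsOpen O)
    (hX : ContDiffOn ℝ ∞ X (Icc a b ×ˢ O)) {t : ℝ} (ht : t ∈ Icc a b) {x : F} (hx : x ∈ O) :
    ∃ K : NNReal, ∃ V ∈ 𝓝 x, ∀ᶠ s in 𝓝[Icc a b] t, LipschitzOnWith K (fun y ↦ X (s, y)) V := by
  have hc : ContinuousWithinAt (partialSnd X) (Icc a b ×ˢ O) (t, x) :=
    (contDiffOn_partialSnd hab hO hX).continuousOn _ ⟨ht, hx⟩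
  set K : NNReal := ‖partialSnd X (t, x)‖₊ + 1
  have h1 : ∀ᶠ q in 𝓝[Icc a b ×ˢ O] (t, x), ‖partialSnd X q‖₊ < K :=
    hc.nnnorm.eventually_lt continuousWithinAt_const (lt_add_one _)
  rw [nhdsWithin_prod_eq, hO.nhdsWithin_eq hx] at h1
  obtain ⟨S, hS, V, hV, hSV⟩ := mem_prod_iff.1 (h1.and
    (prod_mem_prod self_mem_nhdsWithin (hO.mem_nhds hx)))
  obtain ⟨ε, hε, hεV⟩ := Metric.mem_nhds_iff.1 hV
  refine ⟨K, Metric.ball x ε, Metric.ball_mem_nhds x hε, ?_⟩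
  filter_upwards [hS] with s hs
  refine (convex_ball x ε).lipschitzOnWith_of_nnnorm_hasFDerivWithin_le
    (f' := fun y ↦ partialSnd X (s, y)) (fun y hy ↦ ?_) fun y hy ↦ ?_
  · have h2 := (hSV (mk_mem_prod hs (hεV hy))).2
    exact (hasFDerivAt_partialSnd hO hX h2.1 h2.2).1.hasFDerivWithinAt
  · exact (hSV (mk_mem_prod hs (hεV hy))).1.le

variable {H : ℝ → M → ℝ} {a b : ℝ}

theorem IsHamCurve.continuousOn {χ : ℝ → M} (hχ : IsHamCurve J e H a b χ) :
    ContinuousOn χ (Icc a b) := fun t ht ↦ (hχ t ht).continuousWithinAt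

variable [IsManifold J ∞ M] [J.Boundaryless]

/-- Integral curves of a Hamiltonian vector field are determined by their initial value. -/
theorem IsCanonicalOneForm.eqOn_of_isHamCurve [T2Space M] (hθ : IsCanonicalOneForm J θ β e)
    (hH : ContMDiffOn (𝓘(ℝ, ℝ).prod J) 𝓘(ℝ, ℝ) ∞ (fun x : ℝ × M ↦ H x.1 x.2)
      (Icc a b ×ˢ univ)) {χ χ' : ℝ → M} (hχ : IsHamCurve J e H a b χ)
    (hχ' : IsHamCurve J e H a b χ') (h0 : χ a = χ' a) : EqOn χ χ' (Icc a b) := by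
  -- Continuous induction: the coincidence set is closed because M is Hausdorff, and uniqueness for
  -- Lipschitz fields in the chart at χ t extends it to the right of t.
  refine IsClosed.Icc_subset_of_forall_mem_nhdsWithin (s := {t | χ t = χ' t}) ?_ h0 ?_
  · have h1 : {t | χ t = χ' t} ∩ Icc a b = Icc a b ∩ (fun t ↦ (χ t, χ' t)) ⁻¹' diagonal M := by
      rw [inter_comm]
      rfl
    rw [h1]
    exact (hχ.continuousOn.prodMk hχ'.continuousOn).preimage_isClosed_of_isClosed isClosed_Icc
      isClosed_diagonal
  · rintro t ⟨hte : χ t = χ' t, hta, htb⟩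
    have ht : t ∈ Icc a b := ⟨hta, htb.le⟩
    have hab : a < b := hta.trans_lt htb
    set c := χ t with hc
    set O := (extChartAt J c).target
    have hX := contDiffOn_hamiltonianField (e := e) hab (isOpen_extChartAt_target c)
      (contDiffOn_localHam hH c)
    obtain ⟨K, V, hV, hK⟩ := exists_lipschitzOnWith hab (isOpen_extChartAt_target c) hX ht
      (mem_extChartAt_target c)
    have hmem : ∀ η : ℝ → M, IsHamCurve J e H a b η → η t = c → ∀ᶠ s in 𝓝[Icc a b] t,
        η s ∈ (extChartAt J c).source ∧ extChartAt J c (η s) ∈ V := by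
      intro η hη hηt
      have h1 : ContinuousWithinAt η (Icc a b) t := (hη t ht).continuousWithinAt
      have h2 : Tendsto η (𝓝[Icc a b] t) (𝓝 c) := hηt ▸ h1
      have hsrc : ∀ᶠ y in 𝓝 c, y ∈ (extChartAt J c).source := extChartAt_source_mem_nhds c
      have h3 : ∀ᶠ y in 𝓝 c, y ∈ (extChartAt J c).source ∧ extChartAt J c y ∈ V :=
        hsrc.and ((continuousAt_extChartAt c).eventually hV)
      exact h2.eventually h3
    have hle : 𝓝[≥] t ≤ 𝓝[Icc a b] t :=
      nhdsWithin_le_of_mem (mem_of_superset (Icc_mem_nhdsGE htb) (Icc_subset_Icc_left hta))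
    have hev := ((hmem χ hχ hc.symm).and ((hmem χ' hχ' hte.symm).and hK)).filter_mono hle
    obtain ⟨u, htu, hu⟩ := (mem_nhdsGE_iff_exists_Icc_subset.1
      (hev.and (Icc_mem_nhdsGE htb)))
    have hsub : Icc t u ⊆ Icc a b := fun s hs ↦ ⟨hta.trans hs.1, (hu hs).2.2⟩
    have hder : ∀ η : ℝ → M, IsHamCurve J e H a b η →
        (∀ s ∈ Icc t u, η s ∈ (extChartAt J c).source) →
        ContinuousOn (extChartAt J c ∘ η) (Icc t u) ∧ ∀ s ∈ Ico t u,
          HasDerivWithinAt (extChartAt J c ∘ η)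
            (hamiltonianField e (localHam J H c) (s, (extChartAt J c ∘ η) s)) (Ici s) s := by
      intro η hη hs
      have h1 : ∀ s ∈ Icc t u, HasDerivWithinAt (extChartAt J c ∘ η)
          (hamiltonianField e (localHam J H c) (s, (extChartAt J c ∘ η) s)) (Icc a b) s :=
        fun s hsI ↦ hθ.hasDerivWithinAt_extChartAt_comp hH hη (hsub hsI) (hsub hsI) (hs s hsI)
      refine ⟨fun s hsI ↦ (h1 s hsI).continuousWithinAt.mono hsub, fun s hsI ↦ ?_⟩
      refine (h1 s (Ico_subset_Icc_self hsI)).mono_of_mem_nhdsWithin ?_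
      exact mem_of_superset (Icc_mem_nhdsGE hsI.2)
        ((Icc_subset_Icc_left hsI.1).trans hsub)
    have hs1 : ∀ s ∈ Icc t u, χ s ∈ (extChartAt J c).source := fun s hs ↦ (hu hs).1.1.1
    have hs2 : ∀ s ∈ Icc t u, χ' s ∈ (extChartAt J c).source := fun s hs ↦ (hu hs).1.2.1.1
    obtain ⟨hc1, hd1⟩ := hder χ hχ hs1
    obtain ⟨hc2, hd2⟩ := hder χ' hχ' hs2
    have heq := ODE_solution_unique_of_mem_Icc_right (s := fun _ ↦ V) (K := K)
      (v := fun s y ↦ hamiltonianField e (localHam J H c) (s, y))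
      (fun s hs ↦ (hu (Ico_subset_Icc_self hs)).1.2.2) hc1 hd1
      (fun s hs ↦ (hu (Ico_subset_Icc_self hs)).1.1.2) hc2 hd2
      (fun s hs ↦ (hu (Ico_subset_Icc_self hs)).1.2.1.2) (congrArg (extChartAt J c) hte)
    refine mem_of_superset (mem_of_superset (Ioo_mem_nhdsGT htu) Ioo_subset_Icc_self) fun s hs ↦ ?_
    exact (extChartAt J c).injOn (hs1 s hs) (hs2 s hs) (heq hs)

end Uniqueness

/-! ### The local time evolution and its action -/

section ActionFlow

open Filter Topology MeasureTheory

variable {F : Type} [NormedAddCommGroup F] [NormedSpace ℝ F] {G : Type*} [TopologicalSpace G]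
  {J : ModelWithCorners ℝ F G} {M : Type*} [TopologicalSpace M] [ChartedSpace G M]
  {θ : M → F →L[ℝ] ℝ} {β : F →L[ℝ] F →L[ℝ] ℝ} {e : F ≃L[ℝ] (F →L[ℝ] ℝ)} {H : ℝ → M → ℝ}

theorem IsHamCurve.mono {a b a' b' : ℝ} {χ : ℝ → M} (hχ : IsHamCurve J e H a b χ)
    (h : Icc a' b' ⊆ Icc a b) : IsHamCurve J e H a' b' χ :=
  fun t ht ↦ (hχ t (h ht)).mono h

theorem IsHamCurve.congr {a b : ℝ} {χ χ' : ℝ → M} (hχ : IsHamCurve J e H a b χ)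
    (h : EqOn χ' χ (Icc a b)) : IsHamCurve J e H a b χ' := fun t ht ↦ by
  have h1 : velocityMap (hamVec J e H t (χ' t)) = velocityMap (hamVec J e H t (χ t)) := by
    rw [h ht]
  rw [h1]
  exact (hχ t ht).congr_mono (fun s hs ↦ h hs) (h ht) Subset.rfl

theorem IsHamCurve.union {a b c : ℝ} {χ : ℝ → M} (h1 : IsHamCurve J e H a b χ)
    (h2 : IsHamCurve J e H b c χ) (hab : a ≤ b) (hbc : b ≤ c) : IsHamCurve J e H a c χ := by
  intro t ht
  rcases lt_trichotomy t b with h | h | h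
  · refine (h1 t ⟨ht.1, h.le⟩).mono_of_mem_nhdsWithin ?_
    filter_upwards [self_mem_nhdsWithin, mem_nhdsWithin_of_mem_nhds (Iio_mem_nhds h)] with s hs hs'
      using ⟨hs.1, hs'.le⟩
  · rw [← Icc_union_Icc_eq_Icc hab hbc]
    exact (h1 t ⟨ht.1, h.le⟩).union (h2 t ⟨h.ge, ht.2⟩)
  · refine (h2 t ⟨h.le, ht.2⟩).mono_of_mem_nhdsWithin ?_
    filter_upwards [self_mem_nhdsWithin, mem_nhdsWithin_of_mem_nhds (Ioi_mem_nhds h)] with s hs hs'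
      using ⟨hs'.le, hs.2⟩

/-- A family `Φ` of solutions of Hamilton's equations on `[a, b]` with initial values in `U`,
depending smoothly on them. The differential of the action `A` is the difference of the pull-backs
of `θ` under the final and the initial value. -/
structure IsActionFlow (J : ModelWithCorners ℝ F G) (θ : M → F →L[ℝ] ℝ)
    (e : F ≃L[ℝ] (F →L[ℝ] ℝ)) (H : ℝ → M → ℝ) (a b : ℝ) (U : Set M) (φ : M → M) (A : M → ℝ)
    (Φ : M → ℝ → M) : Prop where
  isOpen : IsOpen U
  isHamCurve : ∀ z ∈ U, IsHamCurve J e H a b (Φ z)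
  left : ∀ z ∈ U, Φ z a = z
  right : ∀ z ∈ U, Φ z b = φ z
  intervalIntegrable : ∀ z ∈ U,
    IntervalIntegrable (fun t ↦ lagrangianAt J θ e H t (Φ z t)) volume a b
  action_eq : ∀ z ∈ U, A z = ∫ t in a..b, lagrangianAt J θ e H t (Φ z t)
  contMDiffOn_map : ContMDiffOn J J ∞ φ U
  contMDiffOn_action : ContMDiffOn J 𝓘(ℝ, ℝ) ∞ A U
  mfderiv_action : ∀ z ∈ U, ∀ v : F, (mfderiv J 𝓘(ℝ, ℝ) A z : F →L[ℝ] ℝ) v =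
    θ (φ z) ((mfderiv J J φ z : F →L[ℝ] F) v) - θ z v

theorem IsActionFlow.mdifferentiableAt_map {a b : ℝ} {U : Set M} {φ : M → M} {A : M → ℝ}
    {Φ : M → ℝ → M} (h : IsActionFlow J θ e H a b U φ A Φ) {z : M} (hz : z ∈ U) :
    MDifferentiableAt J J φ z :=
  (h.contMDiffOn_map.contMDiffAt (h.isOpen.mem_nhds hz)).mdifferentiableAt (by simp)

theorem IsActionFlow.mdifferentiableAt_action {a b : ℝ} {U : Set M} {φ : M → M} {A : M → ℝ}
    {Φ : M → ℝ → M} (h : IsActionFlow J θ e H a b U φ A Φ) {z : M} (hz : z ∈ U) :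
    MDifferentiableAt J 𝓘(ℝ, ℝ) A z :=
  (h.contMDiffOn_action.contMDiffAt (h.isOpen.mem_nhds hz)).mdifferentiableAt (by simp)

/-- Concatenation of solutions. The differentials telescope: (φ₁^*θ - θ) + φ₁^*(φ₂^*θ - θ) = (φ₂ ∘
φ₁)^*θ - θ. -/
theorem IsActionFlow.trans {a b c : ℝ} (hab : a ≤ b) (hbc : b ≤ c) {U₁ U₂ : Set M} {φ₁ φ₂ : M → M}
    {A₁ A₂ : M → ℝ} {Φ₁ Φ₂ : M → ℝ → M} (h₁ : IsActionFlow J θ e H a b U₁ φ₁ A₁ Φ₁)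
    (h₂ : IsActionFlow J θ e H b c U₂ φ₂ A₂ Φ₂) :
    IsActionFlow J θ e H a c (U₁ ∩ φ₁ ⁻¹' U₂) (φ₂ ∘ φ₁) (A₁ + A₂ ∘ φ₁)
      (fun z t ↦ if t ≤ b then Φ₁ z t else Φ₂ (φ₁ z) t) := by
  have e1 : ∀ z, EqOn (fun t ↦ if t ≤ b then Φ₁ z t else Φ₂ (φ₁ z) t) (Φ₁ z) (Icc a b) :=
    fun z t ht ↦ if_pos ht.2
  have e2 : ∀ z ∈ U₁ ∩ φ₁ ⁻¹' U₂,
      EqOn (fun t ↦ if t ≤ b then Φ₁ z t else Φ₂ (φ₁ z) t) (Φ₂ (φ₁ z)) (Icc b c) := by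
    intro z hz t ht
    rcases ht.1.eq_or_lt with h | h
    · rw [← h]
      change (if b ≤ b then Φ₁ z b else Φ₂ (φ₁ z) b) = _
      rw [if_pos le_rfl, h₁.right z hz.1, h₂.left _ hz.2]
    · exact if_neg h.not_ge
  have i1 : ∀ z, EqOn
      (fun t ↦ lagrangianAt J θ e H t (if t ≤ b then Φ₁ z t else Φ₂ (φ₁ z) t))
      (fun t ↦ lagrangianAt J θ e H t (Φ₁ z t)) (uIcc a b) := fun z t ht ↦ by
    rw [uIcc_of_le hab] at ht
    exact congrArg (lagrangianAt J θ e H t) (e1 z ht)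
  have i2 : ∀ z ∈ U₁ ∩ φ₁ ⁻¹' U₂, EqOn
      (fun t ↦ lagrangianAt J θ e H t (if t ≤ b then Φ₁ z t else Φ₂ (φ₁ z) t))
      (fun t ↦ lagrangianAt J θ e H t (Φ₂ (φ₁ z) t)) (uIcc b c) := fun z hz t ht ↦ by
    rw [uIcc_of_le hbc] at ht
    exact congrArg (lagrangianAt J θ e H t) (e2 z hz ht)
  have j1 : ∀ z ∈ U₁, IntervalIntegrable
      (fun t ↦ lagrangianAt J θ e H t (if t ≤ b then Φ₁ z t else Φ₂ (φ₁ z) t)) volume a b :=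
    fun z hz ↦ (h₁.intervalIntegrable z hz).congr fun t ht ↦
      (i1 z (uIoc_subset_uIcc ht)).symm
  have j2 : ∀ z ∈ U₁ ∩ φ₁ ⁻¹' U₂, IntervalIntegrable
      (fun t ↦ lagrangianAt J θ e H t (if t ≤ b then Φ₁ z t else Φ₂ (φ₁ z) t)) volume b c :=
    fun z hz ↦ (h₂.intervalIntegrable _ hz.2).congr fun t ht ↦
      (i2 z hz (uIoc_subset_uIcc ht)).symm
  have hmaps : MapsTo φ₁ (U₁ ∩ φ₁ ⁻¹' U₂) U₂ := fun z hz ↦ hz.2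
  have hsm := h₁.contMDiffOn_map.mono (inter_subset_left (t := φ₁ ⁻¹' U₂))
  refine
    { isOpen := h₁.contMDiffOn_map.continuousOn.isOpen_inter_preimage h₁.isOpen h₂.isOpen
      isHamCurve := fun z hz ↦ ((h₁.isHamCurve z hz.1).congr (e1 z)).union
        ((h₂.isHamCurve _ hz.2).congr (e2 z hz)) hab hbc
      left := fun z hz ↦ (if_pos hab).trans (h₁.left z hz.1)
      right := fun z hz ↦ (e2 z hz (right_mem_Icc.2 hbc)).trans (h₂.right _ hz.2)
      intervalIntegrable := fun z hz ↦ (j1 z hz.1).trans (j2 z hz)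
      action_eq := fun z hz ↦ ?_
      contMDiffOn_map := h₂.contMDiffOn_map.comp hsm hmaps
      contMDiffOn_action := (h₁.contMDiffOn_action.mono inter_subset_left).add
        (h₂.contMDiffOn_action.comp hsm hmaps)
      mfderiv_action := fun z hz v ↦ ?_ }
  · rw [← intervalIntegral.integral_add_adjacent_intervals (j1 z hz.1) (j2 z hz),
      intervalIntegral.integral_congr (i1 z), intervalIntegral.integral_congr (i2 z hz),
      ← h₁.action_eq z hz.1, ← h₂.action_eq _ hz.2]
    rfl
  · have d1 := h₁.mdifferentiableAt_map hz.1
    have d2 := h₂.mdifferentiableAt_map hz.2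
    have d3 := h₁.mdifferentiableAt_action hz.1
    have d4 := h₂.mdifferentiableAt_action hz.2
    have k1 := d3.hasMFDerivAt.add (d4.hasMFDerivAt.comp z d1.hasMFDerivAt)
    have k2 := d2.hasMFDerivAt.comp z d1.hasMFDerivAt
    have k3 := h₁.mfderiv_action z hz.1 v
    have k4 := h₂.mfderiv_action _ hz.2 ((mfderiv J J φ₁ z : F →L[ℝ] F) v)
    rw [k1.mfderiv, k2.mfderiv]
    let L₁ : F →L[ℝ] ℝ := mfderiv J 𝓘(ℝ, ℝ) A₁ z
    let L₂ : F →L[ℝ] ℝ := mfderiv J 𝓘(ℝ, ℝ) A₂ (φ₁ z)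
    let T₁ : F →L[ℝ] F := mfderiv J J φ₁ z
    let T₂ : F →L[ℝ] F := mfderiv J J φ₂ (φ₁ z)
    change L₁ v = θ (φ₁ z) (T₁ v) - θ z v at k3
    change L₂ (T₁ v) = θ (φ₂ (φ₁ z)) (T₂ (T₁ v)) - θ (φ₁ z) (T₁ v) at k4
    change L₁ v + L₂ (T₁ v) = θ (φ₂ (φ₁ z)) (T₂ (T₁ v)) - θ z v
    rw [k3, k4]
    ring

variable [IsManifold J ∞ M] [J.Boundaryless] {a b : ℝ}

/-- Inside one chart and over a short interval, the smooth family of solutions and the first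
variation formula of the model space are transported to M. -/
theorem IsCanonicalOneForm.exists_isActionFlow_of_mem_source [CompleteSpace F]
    (hθ : IsCanonicalOneForm J θ β e)
    (hH : ContMDiffOn (𝓘(ℝ, ℝ).prod J) 𝓘(ℝ, ℝ) ∞ (fun x : ℝ × M ↦ H x.1 x.2)
      (Icc a b ×ˢ univ)) (hab : a < b) {χ : ℝ → M} (hχ : IsHamCurve J e H a b χ) {c : M}
    (hc : ∀ t ∈ Icc a b, χ t ∈ (extChartAt J c).source) {C : ℝ} (hC0 : 0 ≤ C)
    (hC : ∀ t ∈ Icc a b,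
      ‖partialSnd (hamiltonianField e (localHam J H c)) (t, extChartAt J c (χ t))‖ ≤ C)
    (hCab : (b - a) * C < 1) :
    ∃ U φ A Φ, χ a ∈ U ∧ φ (χ a) = χ b ∧ IsActionFlow J θ e H a b U φ A Φ := by
  set ψ := extChartAt J c with hψ
  set X := hamiltonianField e (localHam J H c)
  set ℓ := lagrangianAlong β e (localHam J H c)
  have hO : IsOpen ψ.target := isOpen_extChartAt_target c
  have hh := contDiffOn_localHam hH c
  have hX : ContDiffOn ℝ ∞ X (Icc a b ×ˢ ψ.target) := contDiffOn_hamiltonianField hab hO hh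
  have hℓ : ContDiffOn ℝ ∞ ℓ (Icc a b ×ˢ ψ.target) := contDiffOn_lagrangianAlong hab hO hh
  have hξ : ∀ t ∈ Icc a b, HasDerivWithinAt (ψ ∘ χ) (X (t, ψ (χ t))) (Icc a b) t :=
    fun t ht ↦ hθ.hasDerivWithinAt_extChartAt_comp hH hχ ht ht (hc t ht)
  let γ : C(Icc a b, F) := ⟨fun t ↦ ψ (χ t),
    (continuousOn_iff_continuous_domRestrict.1 fun t ht ↦ (hξ t ht).continuousWithinAt)⟩
  have hγO : γ ∈ curvesIn a b ψ.target := fun t ↦ ψ.map_source (hc t t.2)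
  have hγ : IsIntegralSolution hab.le X (ψ (χ a)) γ :=
    IsIntegralSolution.of_hasDerivWithinAt hab.le hX.continuousOn hγO (ξ := ψ ∘ χ)
      (fun _ ↦ rfl) hξ
  obtain ⟨U, hU, haU, Γ, hΓ, hΓa, hsol⟩ := exists_contDiffOn_isIntegralSolution hab hO hX hγO hγ
    hC0 (fun t ↦ hC t t.2) hCab
  obtain ⟨hAs, hΓb, hdA⟩ := hasFDerivAt_integral_of_isIntegralSolution hab hO hX hℓ β
    (fun t ht x hx δ ↦ partialSnd_lagrangianAlong hθ.form_eq hab hO hh ht hx δ) hU hΓ hsol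
  set b' : Icc a b := ⟨b, right_mem_Icc.2 hab.le⟩
  set Ac : F → ℝ := fun z ↦ ∫ t in a..b, IccExtend hab.le (superposition ℓ (Γ z)) t with hAc
  have hlag : ∀ z ∈ U, EqOn (fun t ↦ lagrangianAt J θ e H t (ψ.symm (IccExtend hab.le (Γ z) t)))
      (IccExtend hab.le (superposition ℓ (Γ z))) (Icc a b) := fun z hz t ht ↦ by
    have h1 := (hsol z hz).1
    change lagrangianAt J θ e H t (ψ.symm (IccExtend hab.le (Γ z) t)) = _
    rw [IccExtend_of_mem hab.le _ ht, IccExtend_of_mem hab.le _ ht,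
      superposition_apply hℓ.continuousOn h1, hθ.lagrangianAt_symm hH ht (h1 _)]
  have hV : IsOpen (ψ.source ∩ ψ ⁻¹' U) :=
    (continuousOn_extChartAt c).isOpen_inter_preimage (isOpen_extChartAt_source c) hU
  have hψs : ContMDiffOn J 𝓘(ℝ, F) ∞ ψ (ψ.source ∩ ψ ⁻¹' U) :=
    (contMDiffOn_extChartAt (I := J) (x := c)).mono fun z hz ↦ by simpa [hψ] using hz.1
  have hmaps : MapsTo ψ (ψ.source ∩ ψ ⁻¹' U) U := fun z hz ↦ hz.2
  have hΓt : ∀ z ∈ U, Γ z b' ∈ ψ.target := fun z hz ↦ (hsol z hz).1 b'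
  refine ⟨ψ.source ∩ ψ ⁻¹' U, fun z ↦ ψ.symm (Γ (ψ z) b'), Ac ∘ ψ,
    fun z t ↦ ψ.symm (IccExtend hab.le (Γ (ψ z)) t),
    ⟨hc a (left_mem_Icc.2 hab.le), haU⟩, ?_, ?_⟩
  · change ψ.symm (Γ (ψ (χ a)) b') = χ b
    rw [hΓa]
    exact ψ.left_inv (hc b (right_mem_Icc.2 hab.le))
  refine
    { isOpen := hV
      isHamCurve := fun z hz t ht ↦ ?_
      left := fun z hz ↦ ?_
      right := fun z hz ↦ ?_
      intervalIntegrable := fun z hz ↦ ?_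
      action_eq := fun z hz ↦ ?_
      contMDiffOn_map := (contMDiffOn_extChartAt_symm c).comp (hΓb.contMDiffOn.comp hψs hmaps)
        fun z hz ↦ hΓt _ hz.2
      contMDiffOn_action := hAs.contMDiffOn.comp hψs hmaps
      mfderiv_action := fun z hz v ↦ ?_ }
  · have h1 := (hsol _ hz.2).1
    refine hθ.hasMFDerivWithinAt_symm_comp hH ht (ξ := IccExtend hab.le (Γ (ψ z))) ?_
      ((hsol _ hz.2).2.hasDerivWithinAt hX.continuousOn h1 ht)
    rw [IccExtend_of_mem hab.le _ ht]
    exact h1 _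
  · rw [IccExtend_of_mem hab.le _ (left_mem_Icc.2 hab.le), (hsol _ hz.2).2.apply_left]
    exact ψ.left_inv hz.1
  · rw [IccExtend_of_mem hab.le _ (right_mem_Icc.2 hab.le)]
  · refine IntervalIntegrable.congr (fun t ht ↦ (hlag _ hz.2 ?_).symm)
      (((superposition ℓ (Γ (ψ z))).continuous.Icc_extend' (h := hab.le)).intervalIntegrable _ _)
    rw [uIoc_of_le hab.le] at ht
    exact Ioc_subset_Icc_self ht
  · refine (intervalIntegral.integral_congr fun t ht ↦ hlag _ hz.2 ?_).symm
    rwa [uIcc_of_le hab.le] at ht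
  · have d1 := hasMFDerivAt_extChartAt_chartDeriv (J := J) hz.1
    have d2 : HasFDerivAt Ac (fderiv ℝ Ac (ψ z)) (ψ z) :=
      ((hAs.contDiffAt (hU.mem_nhds hz.2)).differentiableAt (by simp)).hasFDerivAt
    have d3 : HasFDerivAt (fun y ↦ Γ y b') (fderiv ℝ (fun y ↦ Γ y b') (ψ z)) (ψ z) :=
      ((hΓb.contDiffAt (hU.mem_nhds hz.2)).differentiableAt (by simp)).hasFDerivAt
    have d4 := hasMFDerivAt_extChartAt_symm (J := J) (hΓt _ hz.2)
    have k1 := d2.hasMFDerivAt.comp z d1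
    have k2 := d4.comp z (d3.hasMFDerivAt.comp z d1)
    have k3 : (mfderiv J J (fun z ↦ ψ.symm (Γ (ψ z) b')) z : F →L[ℝ] F) v =
        chartSymmDeriv J c (Γ (ψ z) b') (fderiv ℝ (fun y ↦ Γ y b') (ψ z) (chartDeriv J c z v)) :=
      DFunLike.congr_fun k2.mfderiv v
    have k4 : (mfderiv J 𝓘(ℝ, ℝ) (Ac ∘ ψ) z : F →L[ℝ] ℝ) v =
        fderiv ℝ Ac (ψ z) (chartDeriv J c z v) := DFunLike.congr_fun k1.mfderiv v
    rw [k3, k4, hθ.apply_chartSymmDeriv (hΓt _ hz.2), hθ.apply_eq hz.1]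
    exact hdA _ hz.2 _

/-- A solution of Hamilton's equations is contained in a smooth family of solutions. -/
theorem IsCanonicalOneForm.exists_isActionFlow [CompleteSpace F] (hθ : IsCanonicalOneForm J θ β e)
    (hH : ContMDiffOn (𝓘(ℝ, ℝ).prod J) 𝓘(ℝ, ℝ) ∞ (fun x : ℝ × M ↦ H x.1 x.2)
      (Icc a b ×ˢ univ)) (hab : a < b) {χ : ℝ → M} (hχ : IsHamCurve J e H a b χ) :
    ∃ U φ A Φ, χ a ∈ U ∧ φ (χ a) = χ b ∧ IsActionFlow J θ e H a b U φ A Φ := by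
  have hloc : ∀ s ∈ Icc a b, ∃ ε > 0, ∀ a' b', a' < b' → Icc a' b' ⊆ Metric.ball s ε ∩ Icc a b →
      ∃ U φ A Φ, χ a' ∈ U ∧ φ (χ a') = χ b' ∧ IsActionFlow J θ e H a' b' U φ A Φ := by
    intro s hs
    set c := χ s with hc
    have hO : IsOpen (extChartAt J c).target := isOpen_extChartAt_target c
    have hX := contDiffOn_hamiltonianField (e := e) hab hO (contDiffOn_localHam hH c)
    have hpX := (contDiffOn_partialSnd hab hO hX).continuousOn
    set D : ℝ → F →L[ℝ] F := fun t ↦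
      partialSnd (hamiltonianField e (localHam J H c)) (t, extChartAt J c (χ t)) with hD
    have hχs : ContinuousWithinAt χ (Icc a b) s := hχ.continuousOn s hs
    have hsrc : ∀ᶠ t in 𝓝[Icc a b] s, χ t ∈ (extChartAt J c).source :=
      hχs (extChartAt_source_mem_nhds c)
    have hDc : ContinuousWithinAt D (Icc a b) s := by
      have h1 : ContinuousWithinAt (fun t ↦ (t, extChartAt J c (χ t))) (Icc a b) s :=
        continuousWithinAt_id.prodMk ((continuousAt_extChartAt c).comp_continuousWithinAt hχs)
      have h2 : ContinuousWithinAt (partialSnd (hamiltonianField e (localHam J H c)))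
          (Icc a b ×ˢ (extChartAt J c).target) (s, extChartAt J c (χ s)) :=
        hpX _ ⟨hs, mem_extChartAt_target c⟩
      refine ContinuousWithinAt.comp_of_preimage_mem_nhdsWithin
        (g := partialSnd (hamiltonianField e (localHam J H c)))
        (f := fun t ↦ (t, extChartAt J c (χ t)))
        (t := Icc a b ×ˢ (extChartAt J c).target) h2 h1 ?_
      filter_upwards [self_mem_nhdsWithin, hsrc] with t ht hts
        using ⟨ht, (extChartAt J c).map_source hts⟩
    set C := ‖D s‖ + 1 with hC
    have hC0 : 0 < C := by positivity
    have hDC : ∀ᶠ t in 𝓝[Icc a b] s, ‖D t‖ < C :=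
      hDc.norm.eventually_lt continuousWithinAt_const (lt_add_one _)
    obtain ⟨δ, hδ, hδC⟩ := Metric.mem_nhdsWithin_iff.1 (hsrc.and hDC)
    -- An interval in this ball is shorter than 1 / (2 C), so its length times the bound C stays
    -- below 1.
    refine ⟨min δ (1 / (4 * C)), lt_min hδ (by positivity), fun a' b' hab' hsub ↦ ?_⟩
    have hsub' : Icc a' b' ⊆ Icc a b := fun t ht ↦ (hsub ht).2
    have hmem : ∀ t ∈ Icc a' b', χ t ∈ (extChartAt J c).source ∧ ‖D t‖ < C := fun t ht ↦
      hδC ⟨Metric.ball_subset_ball (min_le_left _ _) (hsub ht).1, (hsub ht).2⟩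
    refine hθ.exists_isActionFlow_of_mem_source
      (hH.mono (prod_mono_left hsub')) hab' (hχ.mono hsub') (c := c)
      (fun t ht ↦ (hmem t ht).1) hC0.le (fun t ht ↦ (hmem t ht).2.le) ?_
    have hdist : ∀ t ∈ Icc a' b', |t - s| < 1 / (4 * C) := fun t ht ↦
      lt_of_lt_of_le (Real.dist_eq t s ▸ Metric.mem_ball.1 (hsub ht).1) (min_le_right _ _)
    have h1 := abs_lt.1 (hdist a' (left_mem_Icc.2 hab'.le))
    have h2 := abs_lt.1 (hdist b' (right_mem_Icc.2 hab'.le))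
    have h3 : b' - a' < 2 * (1 / (4 * C)) := by linarith [h1.1, h2.2]
    calc (b' - a') * C < 2 * (1 / (4 * C)) * C := mul_lt_mul_of_pos_right h3 hC0
      _ = 1 / 2 := by field_simp; norm_num
      _ < 1 := by norm_num
  choose! ε hε hflow using hloc
  obtain ⟨t, ht0, htm, ⟨m, hm⟩, htc⟩ := exists_monotone_Icc_subset_open_cover_Icc hab.le
    (c := fun s : Icc a b ↦ Subtype.val ⁻¹' Metric.ball (s : ℝ) (ε s))
    (fun s ↦ Metric.isOpen_ball.preimage continuous_subtype_val)
    (fun s _ ↦ mem_iUnion.2 ⟨s, Metric.mem_ball_self (hε s s.2)⟩)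
  -- Local flows are available over nondegenerate intervals only, while partition points may repeat;
  -- the first alternative covers those still equal to a.
  have hind : ∀ n, (t n : ℝ) = a ∨
      ∃ U φ A Φ, χ a ∈ U ∧ φ (χ a) = χ (t n) ∧ IsActionFlow J θ e H a (t n) U φ A Φ := by
    intro n
    induction n with
    | zero => exact Or.inl ht0
    | succ n ih =>
      have hle : (t n : ℝ) ≤ t (n + 1) := htm n.le_succ
      rcases hle.eq_or_lt with h | h
      · rwa [← h]
      obtain ⟨i, hi⟩ := htc n
      have hsub : Icc (t n : ℝ) (t (n + 1)) ⊆ Metric.ball (i : ℝ) (ε i) ∩ Icc a b := by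
        intro s hs
        have hsI : s ∈ Icc a b := ⟨(t n).2.1.trans hs.1, hs.2.trans (t (n + 1)).2.2⟩
        exact ⟨hi (a := ⟨s, hsI⟩) hs, hsI⟩
      obtain ⟨U, φ, A, Φ, hU, hφ, hf⟩ := hflow i i.2 _ _ h hsub
      rcases ih with ih | ⟨U', φ', A', Φ', hU', hφ', hf'⟩
      · rw [ih] at hU hφ hf
        exact Or.inr ⟨U, φ, A, Φ, hU, hφ, hf⟩
      · have hU'' : χ a ∈ U' ∩ φ' ⁻¹' U := ⟨hU', by rwa [mem_preimage, hφ']⟩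
        have hφ'' : (φ ∘ φ') (χ a) = χ (t (n + 1)) := by rw [Function.comp_apply, hφ', hφ]
        exact Or.inr ⟨_, _, _, _, hU'', hφ'', hf'.trans (t n).2.1 hle hf⟩
  rcases hind m with h | h
  · rw [hm m le_rfl] at h
    exact absurd h hab.ne'
  · rwa [hm m le_rfl] at h

end ActionFlow

/-! ### The graph of the time evolution is Lagrangian -/

section GraphSlice

open Filter Topology

variable {F : Type} [NormedAddCommGroup F] [NormedSpace ℝ F] {G : Type*} [TopologicalSpace G]
  {J : ModelWithCorners ℝ F G} {M : Type*} [TopologicalSpace M] [ChartedSpace G M]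
  {θ : M → F →L[ℝ] ℝ} {β : F →L[ℝ] F →L[ℝ] ℝ} {e : F ≃L[ℝ] (F →L[ℝ] ℝ)} {H : ℝ → M → ℝ}

/-- The one-form `pr₁^* θ - pr₂^* θ`. -/
noncomputable def differenceForm (θ : M → F →L[ℝ] ℝ) (z : M × M) : F × F →L[ℝ] ℝ :=
  (θ z.1).comp (ContinuousLinearMap.fst ℝ F F) - (θ z.2).comp (ContinuousLinearMap.snd ℝ F F)

variable [IsManifold J ∞ M]

/-- The chart of `M × M` around a point of the graph of a smooth map `φ` that straightens the
graph. -/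
noncomputable def graphChart {φ : M → M} {U : Set M} (hU : IsOpen U) (hφ : ContMDiffOn J J ∞ φ U)
    [J.Boundaryless] (x : M) : PartialDiffeomorph (J.prod J) 𝓘(ℝ, F × F) (M × M) (F × F) ∞ where
  toFun y := (extChartAt J (φ x) y.1 - extChartAt J (φ x) (φ y.2), extChartAt J x y.2)
  invFun q := ((extChartAt J (φ x)).symm
    (q.1 + extChartAt J (φ x) (φ ((extChartAt J x).symm q.2))), (extChartAt J x).symm q.2)
  source := (extChartAt J (φ x)).source ×ˢ
    ((U ∩ φ ⁻¹' (extChartAt J (φ x)).source) ∩ (extChartAt J x).source)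
  target := {q | q.2 ∈ (extChartAt J x).target ∩
      (extChartAt J x).symm ⁻¹' (U ∩ φ ⁻¹' (extChartAt J (φ x)).source) ∧
    q.1 + extChartAt J (φ x) (φ ((extChartAt J x).symm q.2)) ∈ (extChartAt J (φ x)).target}
  map_source' := by
    rintro ⟨y₁, y₀⟩ ⟨h1, ⟨h2, h3⟩⟩
    refine ⟨⟨(extChartAt J x).map_source h3, ?_⟩, ?_⟩
    · rwa [mem_preimage, (extChartAt J x).left_inv h3]
    · change extChartAt J (φ x) y₁ - extChartAt J (φ x) (φ y₀) +
        extChartAt J (φ x) (φ ((extChartAt J x).symm (extChartAt J x y₀))) ∈ (extChartAt J (φ x)).target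
      rw [(extChartAt J x).left_inv h3, sub_add_cancel]
      exact (extChartAt J (φ x)).map_source h1
  map_target' := by
    rintro ⟨a, b⟩ ⟨⟨h1, h2⟩, h3⟩
    exact ⟨(extChartAt J (φ x)).map_target h3, h2, (extChartAt J x).map_target h1⟩
  left_inv' := by
    rintro ⟨y₁, y₀⟩ ⟨h1, ⟨h2, h3⟩⟩
    refine Prod.ext ?_ ((extChartAt J x).left_inv h3)
    change (extChartAt J (φ x)).symm (extChartAt J (φ x) y₁ - extChartAt J (φ x) (φ y₀) +
        extChartAt J (φ x) (φ ((extChartAt J x).symm (extChartAt J x y₀)))) = y₁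
    rw [(extChartAt J x).left_inv h3, sub_add_cancel]
    exact (extChartAt J (φ x)).left_inv h1
  right_inv' := by
    rintro ⟨a, b⟩ ⟨⟨h1, h2⟩, h3⟩
    refine Prod.ext ?_ ((extChartAt J x).right_inv h1)
    change extChartAt J (φ x) ((extChartAt J (φ x)).symm
      (a + extChartAt J (φ x) (φ ((extChartAt J x).symm b)))) -
        extChartAt J (φ x) (φ ((extChartAt J x).symm b)) = a
    rw [(extChartAt J (φ x)).right_inv h3, add_sub_cancel_right]
  open_source := (isOpen_extChartAt_source (I := J) _).prod
    ((hφ.continuousOn.isOpen_inter_preimage hU (isOpen_extChartAt_source (I := J) _)).inter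
      (isOpen_extChartAt_source (I := J) _))
  open_target := by
    have h1 : IsOpen (U ∩ φ ⁻¹' (extChartAt J (φ x)).source) :=
      hφ.continuousOn.isOpen_inter_preimage hU (isOpen_extChartAt_source (I := J) _)
    have h2 : IsOpen ((extChartAt J x).target ∩
        (extChartAt J x).symm ⁻¹' (U ∩ φ ⁻¹' (extChartAt J (φ x)).source)) :=
      (continuousOn_extChartAt_symm (I := J) x).isOpen_inter_preimage
        (isOpen_extChartAt_target (I := J) x) h1
    have h3 : ContinuousOn (fun b ↦ extChartAt J (φ x) (φ ((extChartAt J x).symm b)))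
        ((extChartAt J x).target ∩
          (extChartAt J x).symm ⁻¹' (U ∩ φ ⁻¹' (extChartAt J (φ x)).source)) :=
      (continuousOn_extChartAt (φ x)).comp
        (hφ.continuousOn.comp ((continuousOn_extChartAt_symm x).mono inter_subset_left)
          fun b hb ↦ hb.2.1) fun b hb ↦ hb.2.2
    have h4 : ContinuousOn
        (fun q : F × F ↦ q.1 + extChartAt J (φ x) (φ ((extChartAt J x).symm q.2)))
        (univ ×ˢ ((extChartAt J x).target ∩
          (extChartAt J x).symm ⁻¹' (U ∩ φ ⁻¹' (extChartAt J (φ x)).source))) :=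
      continuousOn_fst.add (h3.comp continuousOn_snd fun q hq ↦ hq.2)
    have h5 := h4.isOpen_inter_preimage (isOpen_univ.prod h2)
      (isOpen_extChartAt_target (I := J) (φ x))
    convert h5 using 1
    ext q
    simp only [mem_ofPred_eq, mem_inter_iff, mem_prod, mem_univ, true_and, mem_preimage]
  contMDiffOn_toFun := by
    have hc : ∀ c : M, ContMDiffOn J 𝓘(ℝ, F) ∞ (extChartAt J c) (extChartAt J c).source :=
      fun c ↦ by
        rw [extChartAt_source]
        exact contMDiffOn_extChartAt
    refine ContMDiffOn.prodMk_space (ContMDiffOn.sub ?_ ?_) ?_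
    · exact (hc _).comp contMDiff_fst.contMDiffOn fun y hy ↦ hy.1
    · exact (hc _).comp (hφ.comp contMDiff_snd.contMDiffOn fun y hy ↦ hy.2.1.1)
        fun y hy ↦ hy.2.1.2
    · exact (hc _).comp contMDiff_snd.contMDiffOn fun y hy ↦ hy.2.2
  contMDiffOn_invFun := by
    have hc : ∀ c : M, ContMDiffOn J 𝓘(ℝ, F) ∞ (extChartAt J c) (extChartAt J c).source :=
      fun c ↦ by
        rw [extChartAt_source]
        exact contMDiffOn_extChartAt
    have h0 : ContMDiff 𝓘(ℝ, F × F) 𝓘(ℝ, F) ∞ (Prod.snd : F × F → F) := contDiff_snd.contMDiff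
    have h1 := (contMDiffOn_extChartAt_symm (I := J) (n := ∞) x).comp
      (h0.contMDiffOn (s := {q : F × F | q.2 ∈ (extChartAt J x).target ∩
      (extChartAt J x).symm ⁻¹' (U ∩ φ ⁻¹' (extChartAt J (φ x)).source) ∧
      q.1 + extChartAt J (φ x) (φ ((extChartAt J x).symm q.2)) ∈ (extChartAt J (φ x)).target}))
      fun q hq ↦ hq.1.1
    refine ContMDiffOn.prodMk ?_ h1
    refine (contMDiffOn_extChartAt_symm (φ x)).comp (ContMDiffOn.add ?_ ?_) fun q hq ↦ hq.2
    · exact contDiff_fst.contMDiff.contMDiffOn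
    · exact (hc _).comp (hφ.comp h1 fun q hq ↦ hq.1.2.1) fun q hq ↦ hq.1.2.2

variable [J.Boundaryless]

/-- In a product chart the form is β ξ₁ on the first factor minus β ξ₂ on the second, linear in ξ.
`extDerivOneForm_mfderiv` requires this regularity. -/
theorem IsCanonicalOneForm.differentiableAt_differenceForm (hθ : IsCanonicalOneForm J θ β e)
    (x : M × M) : DifferentiableAt ℝ (oneFormInChart (J.prod J) (differenceForm θ) x)
      (extChartAt (J.prod J) x x) := by
  have h1 : DifferentiableAt ℝ (fun ξ : F × F ↦
      (β ξ.1).comp (ContinuousLinearMap.fst ℝ F F) - (β ξ.2).comp (ContinuousLinearMap.snd ℝ F F))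
      (extChartAt (J.prod J) x x) :=
    (((β.differentiable.comp differentiable_fst).differentiableAt).clm_comp
      (differentiableAt_const _)).sub
    (((β.differentiable.comp differentiable_snd).differentiableAt).clm_comp
      (differentiableAt_const _))
  refine h1.congr_of_eventuallyEq ?_
  filter_upwards [(isOpen_extChartAt_target x).mem_nhds (mem_extChartAt_target x)] with ξ hξ
  have hξ' : ξ.1 ∈ (extChartAt J x.1).target ∧ ξ.2 ∈ (extChartAt J x.2).target := by
    rw [extChartAt_prod] at hξ
    exact hξ
  have d1 : HasMFDerivAt 𝓘(ℝ, F × F) 𝓘(ℝ, F) Prod.fst ξ (ContinuousLinearMap.fst ℝ F F) :=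
    hasFDerivAt_fst.hasMFDerivAt
  have d2 : HasMFDerivAt 𝓘(ℝ, F × F) 𝓘(ℝ, F) Prod.snd ξ (ContinuousLinearMap.snd ℝ F F) :=
    hasFDerivAt_snd.hasMFDerivAt
  have d3 := (hasMFDerivAt_extChartAt_symm (J := J) hξ'.1).comp ξ d1
  have d4 := (hasMFDerivAt_extChartAt_symm (J := J) hξ'.2).comp ξ d2
  have d5 := d3.prodMk d4
  have d6 : ((extChartAt (J.prod J) x).symm : F × F → M × M) = fun ξ : F × F ↦
      ((extChartAt J x.1).symm ξ.1, (extChartAt J x.2).symm ξ.2) := by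
    rw [extChartAt_prod]
    rfl
  refine ContinuousLinearMap.ext fun v ↦ ?_
  have d7 : ∀ f : F × F → M × M, f = (fun ξ : F × F ↦
      ((extChartAt J x.1).symm ξ.1, (extChartAt J x.2).symm ξ.2)) →
      differenceForm θ (f ξ) ((mfderiv 𝓘(ℝ, F × F) (J.prod J) f ξ : F × F →L[ℝ] F × F) v) =
        θ ((extChartAt J x.1).symm ξ.1) (chartSymmDeriv J x.1 ξ.1 v.1) -
        θ ((extChartAt J x.2).symm ξ.2) (chartSymmDeriv J x.2 ξ.2 v.2) := by
    rintro _ rfl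
    have := d5.mfderiv
    exact congrArg (fun T : F × F →L[ℝ] F × F ↦ differenceForm θ
      ((extChartAt J x.1).symm ξ.1, (extChartAt J x.2).symm ξ.2) (T v)) this
  refine (d7 _ d6).trans ?_
  rw [hθ.apply_chartSymmDeriv hξ'.1, hθ.apply_chartSymmDeriv hξ'.2]
  rfl

variable [FiniteDimensional ℝ F] {a b : ℝ} {U : Set M} {φ : M → M} {A : M → ℝ} {Φ : M → ℝ → M}

/-- The graph of the time evolution is a Lagrangian submanifold. -/
theorem IsActionFlow.exists_isSliceChart (h : IsActionFlow J θ e H a b U φ A Φ)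
    (hθ : IsCanonicalOneForm J θ β e) {z : M} (hz : z ∈ U) {L : Set (M × M)}
    (hL : ∀ y₁, ∀ y₀ ∈ U, (y₁, y₀) ∈ L ↔ y₁ = φ y₀) :
    ∃ (Ψ : PartialDiffeomorph (J.prod J) 𝓘(ℝ, F × F) (M × M) (F × F) ∞)
      (S : Submodule ℝ (F × F)), IsSliceChart (J.prod J) L (φ z, z) Ψ S ∧
      2 * Module.finrank ℝ S = Module.finrank ℝ (F × F) ∧
      ∀ v w : TangentSpace (J.prod J) (φ z, z),
        mfderiv (J.prod J) 𝓘(ℝ, F × F) Ψ (φ z, z) v ∈ S →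
        mfderiv (J.prod J) 𝓘(ℝ, F × F) Ψ (φ z, z) w ∈ S →
        extDerivOneForm (J.prod J) (differenceForm θ) (φ z, z) v w = 0 := by
  set ψ := extChartAt J z with hψ
  set ψ' := extChartAt J (φ z) with hψ'
  let Ψ := graphChart h.isOpen h.contMDiffOn_map z
  have hΨ : ∀ y, Ψ y = (ψ' y.1 - ψ' (φ y.2), ψ y.2) := fun _ ↦ rfl
  have hinv : ∀ q, Ψ.invFun q = (ψ'.symm (q.1 + ψ' (φ (ψ.symm q.2))), ψ.symm q.2) := fun _ ↦ rfl
  have hsrc : Ψ.source = ψ'.source ×ˢ ((U ∩ φ ⁻¹' ψ'.source) ∩ ψ.source) := rfl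
  have hzs : (φ z, z) ∈ Ψ.source := by
    rw [hsrc]
    exact ⟨mem_extChartAt_source _, ⟨hz, mem_extChartAt_source _⟩, mem_extChartAt_source _⟩
  have hΨz : Ψ (φ z, z) = (0, ψ z) := by rw [hΨ, sub_self]
  have hzt : ((0 : F), ψ z) ∈ Ψ.target := hΨz ▸ Ψ.map_source hzs
  -- The first chart component compares y₁ with φ y₀ and vanishes exactly on the graph.
  let S : Submodule ℝ (F × F) := Submodule.prod ⊥ ⊤
  have hS : ∀ q : F × F, q ∈ S ↔ q.1 = 0 := fun q ↦ by simp [S, Submodule.mem_prod]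
  refine ⟨Ψ, S, ⟨hzs, ?_⟩, ?_, ?_⟩
  · rintro ⟨y₁, y₀⟩ hy
    rw [hsrc] at hy
    rw [hL y₁ y₀ hy.2.1.1, hΨz, hS, hΨ]
    change _ ↔ ψ' y₁ - ψ' (φ y₀) - 0 = 0
    rw [sub_zero, sub_eq_zero]
    exact ⟨fun hh ↦ hh ▸ rfl, fun hh ↦ ψ'.injOn hy.1 hy.2.1.2 hh⟩
  · have h1 : Module.finrank ℝ S = Module.finrank ℝ F := by
      let E : F ≃ₗ[ℝ] S :=
        { toFun := fun v ↦ ⟨(0, v), (hS _).2 rfl⟩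
          invFun := fun q ↦ q.1.2
          map_add' := fun v w ↦ Subtype.ext (Prod.ext (add_zero 0).symm rfl)
          map_smul' := fun c v ↦ Subtype.ext (Prod.ext (smul_zero c).symm rfl)
          left_inv := fun v ↦ rfl
          right_inv := fun q ↦ Subtype.ext (Prod.ext ((hS _).1 q.2).symm rfl) }
      exact E.finrank_eq.symm
    rw [h1, Module.finrank_prod, two_mul]
  · have hι : ContDiff ℝ ∞ (fun b : F ↦ ((0 : F), b)) := contDiff_const.prodMk contDiff_id
    let V : Set F := (fun b : F ↦ ((0 : F), b)) ⁻¹' Ψ.target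
    have hV : IsOpen V := Ψ.open_target.preimage hι.continuous
    -- The parametrisation of the graph by initial values. It pulls the difference form back to the
    -- differential of A ∘ ψ⁻¹, whose exterior derivative is zero.
    let g : F → M × M := fun b ↦ Ψ.invFun (0, b)
    have hg : ContMDiffOn 𝓘(ℝ, F) (J.prod J) ∞ g V :=
      Ψ.contMDiffOn_invFun.comp hι.contMDiff.contMDiffOn fun b hb ↦ hb
    have hgV : ∀ b ∈ V, b ∈ ψ.target ∧ ψ.symm b ∈ U ∧ g b = (φ (ψ.symm b), ψ.symm b) := by
      intro b hb
      have hb' : (b ∈ ψ.target ∧ ψ.symm b ∈ U ∧ φ (ψ.symm b) ∈ ψ'.source) ∧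
        (0 : F) + ψ' (φ (ψ.symm b)) ∈ ψ'.target := hb
      refine ⟨hb'.1.1, hb'.1.2.1, ?_⟩
      change Ψ.invFun (0, b) = _
      rw [hinv]
      exact Prod.ext (by simp only [zero_add]; exact ψ'.left_inv hb'.1.2.2) rfl
    have hzV : ψ z ∈ V := hzt
    have hgz : g (ψ z) = (φ z, z) := by
      rw [(hgV _ hzV).2.2, ψ.left_inv (mem_extChartAt_source z)]
    have hgder : ∀ b ∈ V, ∀ v : F,
        (mfderiv 𝓘(ℝ, F) (J.prod J) g b : F →L[ℝ] F × F) v =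
          ((mfderiv J J φ (ψ.symm b) : F →L[ℝ] F) (chartSymmDeriv J z b v),
            chartSymmDeriv J z b v) := by
      intro b hb v
      obtain ⟨hb1, hb2, -⟩ := hgV b hb
      have d1 := hasMFDerivAt_extChartAt_symm (J := J) hb1
      have d2 := ((h.mdifferentiableAt_map hb2).hasMFDerivAt.comp b d1).prodMk d1
      have d3 : mfderiv 𝓘(ℝ, F) (J.prod J) g b = mfderiv 𝓘(ℝ, F) (J.prod J)
          (fun b ↦ (φ (ψ.symm b), ψ.symm b)) b :=
        Filter.EventuallyEq.mfderiv_eq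
          (Filter.eventually_of_mem (hV.mem_nhds hb) fun y hy ↦ (hgV y hy).2.2)
      exact DFunLike.congr_fun (d3.trans d2.mfderiv) v
    let S' : F → ℝ := A ∘ ψ.symm
    have hS' : ∀ b ∈ V, ContDiffAt ℝ ∞ S' b := by
      intro b hb
      obtain ⟨hb1, hb2, -⟩ := hgV b hb
      exact ((h.contMDiffOn_action.contMDiffAt (h.isOpen.mem_nhds hb2)).comp b
        ((contMDiffOn_extChartAt_symm z).contMDiffAt
          ((isOpen_extChartAt_target z).mem_nhds hb1))).contDiffAt
    have hdS' : ∀ b ∈ V, ∀ v : F, fderiv ℝ S' b v = differenceForm θ (g b)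
        ((mfderiv 𝓘(ℝ, F) (J.prod J) g b : F →L[ℝ] F × F) v) := by
      intro b hb v
      rw [hgder b hb, (hgV b hb).2.2]
      obtain ⟨hb1, hb2, -⟩ := hgV b hb
      have d1 := hasMFDerivAt_extChartAt_symm (J := J) hb1
      have d2 := ((h.mdifferentiableAt_action hb2).hasMFDerivAt.comp b d1).mfderiv
      rw [mfderiv_eq_fderiv] at d2
      exact (DFunLike.congr_fun d2 v).trans (h.mfderiv_action _ hb2 _)
    let Ω : M × M → F × F → F × F → ℝ := fun y v w ↦
      extDerivOneForm (J.prod J) (differenceForm θ) y v w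
    have hΩ : ∀ v w : F, Ω (g (ψ z)) ((mfderiv 𝓘(ℝ, F) (J.prod J) g (ψ z) : F →L[ℝ] F × F) v)
        ((mfderiv 𝓘(ℝ, F) (J.prod J) g (ψ z) : F →L[ℝ] F × F) w) = 0 := by
      intro v w
      refine (extDerivOneForm_mfderiv (J := J.prod J) hV hg hzV
        (hθ.differentiableAt_differenceForm _) (γ := fderiv ℝ S')
        (Filter.eventually_of_mem (hV.mem_nhds hzV) fun y hy v ↦ hdS' y hy v) v w).trans ?_
      have hsymm : IsSymmSndFDerivAt ℝ S' (ψ z) := (hS' _ hzV).isSymmSndFDerivAt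
        (by simp only [minSmoothness_of_isRCLikeNormedField]; norm_cast)
      rw [hsymm.eq v w, sub_self]
    -- Since Ψ⁻¹ ∘ Ψ is the identity near the point, a vector that dΨ sends to (0, w) is the image
    -- of w under dg.
    have htan : ∀ v : F × F, (mfderiv (J.prod J) 𝓘(ℝ, F × F) Ψ (φ z, z) : F × F →L[ℝ] F × F) v ∈ S →
        ∃ w : F, v = (mfderiv 𝓘(ℝ, F) (J.prod J) g (ψ z) : F →L[ℝ] F × F) w := by
      intro v hv
      set D : F × F →L[ℝ] F × F := mfderiv (J.prod J) 𝓘(ℝ, F × F) Ψ (φ z, z) with hD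
      refine ⟨(D v).2, ?_⟩
      have d1 : MDifferentiableAt (J.prod J) 𝓘(ℝ, F × F) Ψ (φ z, z) :=
        (Ψ.contMDiffOn_toFun.contMDiffAt (Ψ.open_source.mem_nhds hzs)).mdifferentiableAt (by simp)
      have d2 : MDifferentiableAt 𝓘(ℝ, F × F) (J.prod J) Ψ.invFun (0, ψ z) :=
        (Ψ.contMDiffOn_invFun.contMDiffAt (Ψ.open_target.mem_nhds hzt)).mdifferentiableAt (by simp)
      set D' : F × F →L[ℝ] F × F := mfderiv 𝓘(ℝ, F × F) (J.prod J) Ψ.invFun (0, ψ z) with hD'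
      have d2' : MDifferentiableAt 𝓘(ℝ, F × F) (J.prod J) Ψ.invFun (Ψ (φ z, z)) := by
        rwa [hΨz]
      have d0 : mfderiv (J.prod J) (J.prod J) (Ψ.invFun ∘ Ψ) (φ z, z) =
          mfderiv (J.prod J) (J.prod J) id (φ z, z) :=
        Filter.EventuallyEq.mfderiv_eq (Filter.eventually_of_mem
          (Ψ.open_source.mem_nhds hzs) fun y hy ↦ Ψ.left_inv hy)
      have d3 := (mfderiv_comp (φ z, z) d2' d1).symm.trans d0
      rw [mfderiv_id] at d3
      have d4 : D' (D v) = v := by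
        have : ∀ q, q = ((0 : F), ψ z) → (mfderiv 𝓘(ℝ, F × F) (J.prod J) Ψ.invFun q :
            F × F →L[ℝ] F × F) = D' := by
          rintro _ rfl
          rfl
        rw [← this _ hΨz]
        exact DFunLike.congr_fun d3 v
      have d5 : HasMFDerivAt 𝓘(ℝ, F) 𝓘(ℝ, F × F) (fun b : F ↦ ((0 : F), b)) (ψ z)
          (ContinuousLinearMap.inr ℝ F F) := (hasFDerivAt_prodMk_right 0 (ψ z)).hasMFDerivAt
      have d6 : (mfderiv 𝓘(ℝ, F) (J.prod J) g (ψ z) : F →L[ℝ] F × F) (D v).2 = D' (0, (D v).2) :=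
        DFunLike.congr_fun (d2.hasMFDerivAt.comp (ψ z) d5).mfderiv (D v).2
      rw [d6, ← (hS _).1 hv]
      exact d4.symm
    intro v w hv hw
    obtain ⟨v', hv'⟩ := htan v hv
    obtain ⟨w', hw'⟩ := htan w hw
    have hΩz : ∀ (y : M × M) (p q : F × F), Ω y p q = 0 → y = (φ z, z) → Ω (φ z, z) p q = 0 := by
      rintro y p q h rfl
      exact h
    exact (congrArg₂ (Ω (φ z, z)) hv' hw').trans (hΩz _ _ _ (hΩ v' w') hgz)

end GraphSlice

/-! ### Generating functions in coordinates -/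

section GeneratingFunction

variable {E : Type} [NormedAddCommGroup E] [NormedSpace ℝ E] [FiniteDimensional ℝ E]

/-- A function `W` of the end points whose pull-back under an injective map to the pairs of end
points is smooth, with differential `p₁ du₁ - p₀ du₀`, is continuously differentiable. -/
theorem contDiffOn_generatingFunction {U : Set (E × (E →L[ℝ] ℝ))} (hU : IsOpen U)
    {g : E × (E →L[ℝ] ℝ) → E × (E →L[ℝ] ℝ)} (hg : ContDiffOn ℝ ∞ g U)
    {S : E × (E →L[ℝ] ℝ) → ℝ} (hS : ContDiffOn ℝ ∞ S U)
    (hdS : ∀ x ∈ U, ∀ v, fderiv ℝ S x v =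
      momentumPairing E (g x) (fderiv ℝ g x v) - momentumPairing E x v)
    (hinj : InjOn (fun x ↦ (x.1, (g x).1)) U) {W : E × E → ℝ}
    (hW : ∀ x ∈ U, W (x.1, (g x).1) = S x) :
    IsOpen ((fun x ↦ (x.1, (g x).1)) '' U) ∧
      (∀ x ∈ U, HasFDerivAt W ((g x).2.comp (ContinuousLinearMap.snd ℝ E E) -
        x.2.comp (ContinuousLinearMap.fst ℝ E E)) (x.1, (g x).1)) ∧
      ContDiffOn ℝ 1 W ((fun x ↦ (x.1, (g x).1)) '' U) := by
  have hrank : Module.finrank ℝ (E × (E →L[ℝ] ℝ)) = Module.finrank ℝ (E × E) := by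
    rw [Module.finrank_prod, Module.finrank_prod, finrank_continuousDual]
  have hf : ContDiffOn ℝ ∞ (fun x ↦ (x.1, (g x).1)) U :=
    contDiff_fst.contDiffOn.prodMk hg.fst
  -- The injective map is (u₀, p₀) ↦ (u₀, u₁), whose differential may be singular, and P = p₁ du₁ -
  -- p₀ du₀.
  refine contDiffOn_of_comp_eq_of_injOn hrank hU (hf.of_le (by simp)) hinj (hS.of_le (by simp))
    (P := fun x ↦ (g x).2.comp (ContinuousLinearMap.snd ℝ E E) -
        x.2.comp (ContinuousLinearMap.fst ℝ E E)) ?_ (fun x hx ↦ ?_) hW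
  · exact (hg.continuousOn.snd.clm_comp continuousOn_const).sub
      (continuousOn_snd.clm_comp continuousOn_const)
  · have h1 : HasFDerivAt g (fderiv ℝ g x) x :=
      ((hg.contDiffAt (hU.mem_nhds hx)).differentiableAt (by simp)).hasFDerivAt
    have h2 := (hasFDerivAt_fst (𝕜 := ℝ) (p := x)).prodMk (hasFDerivAt_fst.comp x h1)
    refine ContinuousLinearMap.ext fun v ↦ ?_
    have h3 : fderiv ℝ (fun x : E × (E →L[ℝ] ℝ) ↦ (x.1, (g x).1)) x v =
        (v.1, (fderiv ℝ g x v).1) := DFunLike.congr_fun h2.fderiv v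
    rw [hdS x hx, ContinuousLinearMap.comp_apply, h3]
    rfl

end GeneratingFunction

/-! ### From the definitions on T^*Q to the abstract setting -/

section CotangentT2

variable {r : ℕ} {Q : Type*} [TopologicalSpace Q] [ChartedSpace (EuclideanSpace ℝ (Fin r)) Q]
  [IsManifold (𝓡 r) ∞ Q]

/-- Points over the same base point share a chart; all others are separated in Q. Uniqueness of
integral curves relies on this. -/
theorem t2Space_cotBundle [T2Space Q] : T2Space (CotBundle r Q) := by
  refine ⟨fun x y hxy ↦ ?_⟩
  have : T2Space (ModelProd (EuclideanSpace ℝ (Fin r)) (CotFiber r)) :=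
    inferInstanceAs (T2Space (EuclideanSpace ℝ (Fin r) × CotFiber r))
  by_cases h : x.proj = y.proj
  · let c := chartAt (ModelProd (EuclideanSpace ℝ (Fin r)) (CotFiber r)) x
    have hx : x ∈ c.source := mem_chart_source _ x
    have hy : y ∈ c.source := by
      have := (mem_cotChart_source (c := x) (z := y)).2 (by
        rw [← h]
        exact mem_extChartAt_source _)
      rwa [extChartAt_source] at this
    obtain ⟨u, v, hu, hv, hxu, hyv, huv⟩ := t2_separation (fun hc ↦ hxy (c.injOn hx hy hc))
    exact ⟨_, _, c.isOpen_inter_preimage hu, c.isOpen_inter_preimage hv, ⟨hx, hxu⟩, ⟨hy, hyv⟩,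
      (huv.preimage c).mono inter_subset_right inter_subset_right⟩
  · obtain ⟨u, v, hu, hv, hxu, hyv, huv⟩ := t2_separation h
    have hc : Continuous (fun z : CotBundle r Q ↦ z.proj) :=
      FiberBundle.continuous_proj _ _
    exact ⟨_, _, hu.preimage hc, hv.preimage hc, hxu, hyv, huv.preimage _⟩

theorem isCanonicalOneForm_liouvilleForm :
    IsCanonicalOneForm (M := CotBundle r Q) (cotModel r) liouvilleForm
      (momentumPairing (EuclideanSpace ℝ (Fin r))) (canonicalEquiv _) where
  inChart _ _ hξ := oneFormInChart_liouvilleForm hξ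
  form_eq v w := canonicalEquiv_apply v w

/-- Nondegeneracy of ω leaves only one possible velocity, the Hamiltonian vector. -/
theorem isHamiltonSolution_iff {H : ℝ → CotBundle r Q → ℝ} {χ : ℝ → CotBundle r Q} :
    IsHamiltonSolution H χ ↔ IsHamCurve (cotModel r) (canonicalEquiv _) H 0 1 χ := by
  have key : ∀ (t : ℝ) (v : EuclideanSpace ℝ (Fin r) × CotFiber r),
      (∀ w : EuclideanSpace ℝ (Fin r) × CotFiber r, symplecticForm (χ t) v w =
        - (mfderiv (cotModel r) 𝓘(ℝ, ℝ) (H t) (χ t) :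
          (EuclideanSpace ℝ (Fin r) × CotFiber r) →L[ℝ] ℝ) w) ↔
      v = hamVec (cotModel r) (canonicalEquiv _) H t (χ t) := by
    intro t v
    have h1 : ∀ w, symplecticForm (χ t) v w = canonicalEquiv _ v w := fun w ↦
      isCanonicalOneForm_liouvilleForm.extDerivOneForm_eq (χ t) v w
    constructor
    · intro h
      exact eq_hamiltonianVector fun w ↦ (h1 w).symm.trans (h w)
    · rintro rfl w
      exact (h1 w).trans (apply_hamiltonianVector _ w)
  constructor
  · intro h t ht
    obtain ⟨v, hv, hvw⟩ := h t ht
    have := (key t v).1 hvw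
    subst this
    exact hv
  · intro h t ht
    exact ⟨hamVec (F := EuclideanSpace ℝ (Fin r) × CotFiber r) (cotModel r) (canonicalEquiv _) H t (χ t), h t ht, (key t _).2 rfl⟩

/-- The chain rule for the projection gives p(u') = θ(χ'). -/
theorem action_eq_of_isHamCurve {H : ℝ → CotBundle r Q → ℝ} {χ : ℝ → CotBundle r Q}
    (h : IsHamCurve (cotModel r) (canonicalEquiv _) H 0 1 χ) :
    action H χ = ∫ t in (0 : ℝ)..1,
      lagrangianAt (cotModel r) liouvilleForm (canonicalEquiv _) H t (χ t) := by
  refine intervalIntegral.integral_congr fun t ht ↦ ?_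
  rw [uIcc_of_le zero_le_one] at ht
  have h1 := (mdifferentiable_proj (χ t)).hasMFDerivAt.comp_hasMFDerivWithinAt t (h t ht)
  have h2 := h1.mfderivWithin ((uniqueDiffOn_Icc zero_lt_one).uniqueMDiffOn t ht)
  have h3 : baseVelocity χ t = mfderiv (cotModel r) (𝓡 r) (fun y : CotBundle r Q ↦ y.proj) (χ t)
      (hamVec (F := EuclideanSpace ℝ (Fin r) × CotFiber r) (cotModel r) (canonicalEquiv _) H t
        (χ t)) := by
    refine (DFunLike.congr_fun h2 (1 : ℝ)).trans ?_
    refine congrArg (mfderiv (cotModel r) (𝓡 r) (fun y : CotBundle r Q ↦ y.proj) (χ t)) ?_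
    exact one_smul ℝ _
  change (χ t).snd (baseVelocity χ t) - H t (χ t) = _
  rw [h3]
  rfl

end CotangentT2

section ActionInCharts

open Filter Topology

variable {F : Type} [NormedAddCommGroup F] [NormedSpace ℝ F] {G : Type*} [TopologicalSpace G]
  {J : ModelWithCorners ℝ F G} {M : Type*} [TopologicalSpace M] [ChartedSpace G M]
  {θ : M → F →L[ℝ] ℝ} {β : F →L[ℝ] F →L[ℝ] ℝ} {e : F ≃L[ℝ] (F →L[ℝ] ℝ)} {H : ℝ → M → ℝ}
  {a b : ℝ} {U : Set M} {φ : M → M} {A : M → ℝ} {Φ : M → ℝ → M} [IsManifold J ∞ M]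
  [J.Boundaryless]

/-- The expression in charts of the differential of the action. -/
theorem IsActionFlow.inCharts (h : IsActionFlow J θ e H a b U φ A Φ)
    (hθ : IsCanonicalOneForm J θ β e) {z : M} (hz : z ∈ U) :
    ∃ V : Set F, IsOpen V ∧ extChartAt J z z ∈ V ∧
      (∀ ξ ∈ V, ξ ∈ (extChartAt J z).target ∧ (extChartAt J z).symm ξ ∈ U ∧
        φ ((extChartAt J z).symm ξ) ∈ (extChartAt J (φ z)).source) ∧
      ContDiffOn ℝ ∞ (fun ξ ↦ extChartAt J (φ z) (φ ((extChartAt J z).symm ξ))) V ∧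
      ContDiffOn ℝ ∞ (fun ξ ↦ A ((extChartAt J z).symm ξ)) V ∧
      ∀ ξ ∈ V, ∀ v, fderiv ℝ (fun ξ ↦ A ((extChartAt J z).symm ξ)) ξ v =
        β (extChartAt J (φ z) (φ ((extChartAt J z).symm ξ)))
          (fderiv ℝ (fun ξ ↦ extChartAt J (φ z) (φ ((extChartAt J z).symm ξ))) ξ v) - β ξ v := by
  set ψ := extChartAt J z
  set ψ' := extChartAt J (φ z)
  have h1 : IsOpen (U ∩ φ ⁻¹' ψ'.source) :=
    h.contMDiffOn_map.continuousOn.isOpen_inter_preimage h.isOpen (isOpen_extChartAt_source _)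
  have hV : IsOpen (ψ.target ∩ ψ.symm ⁻¹' (U ∩ φ ⁻¹' ψ'.source)) :=
    (continuousOn_extChartAt_symm z).isOpen_inter_preimage (isOpen_extChartAt_target z) h1
  have hsymm : ContMDiffOn 𝓘(ℝ, F) J ∞ ψ.symm (ψ.target ∩ ψ.symm ⁻¹' (U ∩ φ ⁻¹' ψ'.source)) :=
    (contMDiffOn_extChartAt_symm z).mono inter_subset_left
  have hψ' : ContMDiffOn J 𝓘(ℝ, F) ∞ ψ' ψ'.source := by
    simp only [ψ', extChartAt_source]
    exact contMDiffOn_extChartAt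
  refine ⟨_, hV, ⟨mem_extChartAt_target z, ?_⟩, fun ξ hξ ↦ ⟨hξ.1, hξ.2.1, hξ.2.2⟩,
    (hψ'.comp (h.contMDiffOn_map.comp hsymm fun ξ hξ ↦ hξ.2.1) fun ξ hξ ↦ hξ.2.2).contDiffOn,
    (h.contMDiffOn_action.comp hsymm fun ξ hξ ↦ hξ.2.1).contDiffOn, fun ξ hξ v ↦ ?_⟩
  · rw [mem_preimage, ψ.left_inv (mem_extChartAt_source z)]
    exact ⟨hz, mem_extChartAt_source _⟩
  · have d1 := hasMFDerivAt_extChartAt_symm (J := J) hξ.1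
    have d2 := (h.mdifferentiableAt_map hξ.2.1).hasMFDerivAt.comp ξ d1
    have d3 := ((hasMFDerivAt_extChartAt_chartDeriv hξ.2.2).comp ξ d2).mfderiv
    have d4 := ((h.mdifferentiableAt_action hξ.2.1).hasMFDerivAt.comp ξ d1).mfderiv
    rw [mfderiv_eq_fderiv] at d3 d4
    let T : F →L[ℝ] F := mfderiv J J φ (ψ.symm ξ)
    let dA : F →L[ℝ] ℝ := mfderiv J 𝓘(ℝ, ℝ) A (ψ.symm ξ)
    have k1 : fderiv ℝ (fun ξ ↦ ψ' (φ (ψ.symm ξ))) ξ v = chartDeriv J (φ z) (φ (ψ.symm ξ))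
        (T (chartSymmDeriv J z ξ v)) := DFunLike.congr_fun d3 v
    have k2 : fderiv ℝ (fun ξ ↦ A (ψ.symm ξ)) ξ v = dA (chartSymmDeriv J z ξ v) :=
      DFunLike.congr_fun d4 v
    have k3 : dA (chartSymmDeriv J z ξ v) = θ (φ (ψ.symm ξ)) (T (chartSymmDeriv J z ξ v)) -
        θ (ψ.symm ξ) (chartSymmDeriv J z ξ v) := h.mfderiv_action _ hξ.2.1 _
    rw [k1, k2]
    refine k3.trans (congrArg₂ (· - ·) ?_ (hθ.apply_chartSymmDeriv hξ.1 v))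
    exact hθ.apply_eq hξ.2.2 _

end ActionInCharts

/-! ### Consequences of the Dirichlet condition -/

section PrincipalFunction

open Filter Topology

variable {r : ℕ} {Q : Type*} [TopologicalSpace Q] [ChartedSpace (EuclideanSpace ℝ (Fin r)) Q]
  [IsManifold (𝓡 r) ∞ Q] {H : ℝ → CotBundle r Q → ℝ}

theorem action_congr {χ χ' : ℝ → CotBundle r Q} (hχ : IsHamiltonSolution H χ)
    (hχ' : IsHamiltonSolution H χ') (h : EqOn χ χ' (Icc 0 1)) : action H χ = action H χ' := by
  rw [action_eq_of_isHamCurve (isHamiltonSolution_iff.1 hχ),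
    action_eq_of_isHamCurve (isHamiltonSolution_iff.1 hχ')]
  refine intervalIntegral.integral_congr fun t ht ↦ ?_
  rw [uIcc_of_le zero_le_one] at ht
  exact congrArg (lagrangianAt (cotModel r) liouvilleForm (canonicalEquiv _) H t) (h ht)

/-- The solution chosen in the definition agrees with χ on [0,1] by Dirichlet uniqueness, hence has
the same action. -/
theorem principalFunction_eq (hD : IsDirichlet H) {χ : ℝ → CotBundle r Q}
    (hχ : IsHamiltonSolution H χ) :
    principalFunction hD ((χ 0).proj, (χ 1).proj) = action H χ := by
  obtain ⟨h1, h2, h3⟩ := (hD (χ 0).proj (χ 1).proj).1.choose_spec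
  exact action_congr h1 hχ ((hD _ _).2 _ _ h1 h2 h3 hχ rfl rfl)

variable {U : Set (CotBundle r Q)} {φ : CotBundle r Q → CotBundle r Q} {A : CotBundle r Q → ℝ}
  {Φ : CotBundle r Q → ℝ → CotBundle r Q}

theorem IsActionFlow.principalFunction_eq
    (h : IsActionFlow (cotModel r) liouvilleForm (canonicalEquiv _) H 0 1 U φ A Φ)
    (hD : IsDirichlet H) {z : CotBundle r Q} (hz : z ∈ U) :
    principalFunction hD (z.proj, (φ z).proj) = A z := by
  have h1 := h.isHamCurve z hz
  have h2 := _root_.principalFunction_eq hD (isHamiltonSolution_iff.2 h1)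
  rw [h.left z hz, h.right z hz] at h2
  rw [h2, action_eq_of_isHamCurve h1, h.action_eq z hz]

/-- Dirichlet uniqueness read as injectivity of the end point map z ↦ (u₀, u₁). -/
theorem IsActionFlow.eq_of_proj_eq
    (h : IsActionFlow (cotModel r) liouvilleForm (canonicalEquiv _) H 0 1 U φ A Φ)
    (hD : IsDirichlet H) {z z' : CotBundle r Q} (hz : z ∈ U) (hz' : z' ∈ U)
    (h0 : z.proj = z'.proj) (h1 : (φ z).proj = (φ z').proj) : z = z' := by
  have h2 := (hD z'.proj (φ z').proj).2 (Φ z) (Φ z') (isHamiltonSolution_iff.2 (h.isHamCurve z hz))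
    (by rw [h.left z hz, h0]) (by rw [h.right z hz, h1])
    (isHamiltonSolution_iff.2 (h.isHamCurve z' hz')) (by rw [h.left z' hz']) (by rw [h.right z' hz'])
  have h3 := h2 (left_mem_Icc.2 zero_le_one)
  rwa [h.left z hz, h.left z' hz'] at h3

/-- Every solution starting in U belongs to the flow Φ, by uniqueness for the initial value problem.
-/
theorem IsActionFlow.mem_boundaryValues_iff [T2Space Q]
    (h : IsActionFlow (cotModel r) liouvilleForm (canonicalEquiv _) H 0 1 U φ A Φ)
    (hH : ContMDiffOn (𝓘(ℝ, ℝ).prod (cotModel r)) 𝓘(ℝ, ℝ) ∞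
      (fun x : ℝ × CotBundle r Q ↦ H x.1 x.2) (Icc (0 : ℝ) 1 ×ˢ univ))
    (y₁ : CotBundle r Q) {y₀ : CotBundle r Q} (hy₀ : y₀ ∈ U) :
    (y₁, y₀) ∈ boundaryValues H ↔ y₁ = φ y₀ := by
  have : T2Space (CotBundle r Q) := t2Space_cotBundle
  constructor
  · rintro ⟨χ, hχ, hy⟩
    obtain ⟨rfl, rfl⟩ := Prod.mk.inj hy
    have h1 := isCanonicalOneForm_liouvilleForm.eqOn_of_isHamCurve hH (isHamiltonSolution_iff.1 hχ)
      (h.isHamCurve _ hy₀) (h.left _ hy₀).symm (right_mem_Icc.2 zero_le_one)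
    rw [h1, h.right _ hy₀]
  · rintro rfl
    refine ⟨Φ y₀, isHamiltonSolution_iff.2 (h.isHamCurve _ hy₀), ?_⟩
    rw [h.left _ hy₀, h.right _ hy₀]

end PrincipalFunction

theorem ContinuousLinearMap.eq_and_eq_of_forall_sub_eq {E : Type*} [NormedAddCommGroup E]
    [NormedSpace ℝ E] {p₁ q₁ p₀ q₀ : E →L[ℝ] ℝ} (h : ∀ a b, p₁ b - p₀ a = q₁ b - q₀ a) :
    p₁ = q₁ ∧ p₀ = q₀ := by
  constructor
  · ext b
    simpa using h 0 b
  · ext a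
    simpa using h a 0

/-! ### The differential of the principal function -/

section PreferredChart

open Filter Topology

variable {F : Type*} [NormedAddCommGroup F] [NormedSpace ℝ F] {G : Type*} [TopologicalSpace G]
  {J : ModelWithCorners ℝ F G} {M : Type*} [TopologicalSpace M] [ChartedSpace G M]

theorem continuousAt_of_comp_extChartAt_symm {W : M → ℝ} {x : M}
    (h : ContinuousAt (W ∘ (extChartAt J x).symm) (extChartAt J x x)) : ContinuousAt W x := by
  refine (h.comp (continuousAt_extChartAt x)).congr ?_
  filter_upwards [extChartAt_source_mem_nhds (I := J) x] with y hy
  exact congrArg W ((extChartAt J x).left_inv hy)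

theorem hasMFDerivAt_of_comp_extChartAt_symm {W : M → ℝ} {x : M} {D : F →L[ℝ] ℝ}
    (h : HasFDerivAt (W ∘ (extChartAt J x).symm) D (extChartAt J x x)) :
    HasMFDerivAt J 𝓘(ℝ, ℝ) W x D :=
  ⟨continuousAt_of_comp_extChartAt_symm h.continuousAt, h.hasFDerivWithinAt⟩

theorem contMDiffAt_of_comp_extChartAt_symm {n : WithTop ℕ∞} {W : M → ℝ} {x : M}
    (h : ContDiffAt ℝ n (W ∘ (extChartAt J x).symm) (extChartAt J x x)) :
    ContMDiffAt J 𝓘(ℝ, ℝ) n W x :=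
  contMDiffAt_iff.2 ⟨continuousAt_of_comp_extChartAt_symm h.continuousAt, h.contDiffWithinAt⟩

/-- The tangent space at x is identified with F through this very chart, in which the map is the
identity. -/
theorem mfderiv_extChartAt_symm_self [J.Boundaryless] [IsManifold J ∞ M] (x : M) (v : F) :
    (mfderiv 𝓘(ℝ, F) J (extChartAt J x).symm (extChartAt J x x) : F →L[ℝ] F) v = v := by
  have h1 := mfderiv_eq_fderiv_extChartAt_comp
    (mdifferentiableAt_extChartAt_symm (J := J) (mem_extChartAt_target x))
  have h2 : fderiv ℝ (extChartAt J ((extChartAt J x).symm (extChartAt J x x)) ∘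
      (extChartAt J x).symm) (extChartAt J x x) = ContinuousLinearMap.id ℝ F := by
    rw [(extChartAt J x).left_inv (mem_extChartAt_source x)]
    refine ((hasFDerivAt_id _).congr_of_eventuallyEq ?_).fderiv
    filter_upwards [(isOpen_extChartAt_target x).mem_nhds (mem_extChartAt_target x)] with ξ hξ
    exact (extChartAt J x).right_inv hξ
  exact DFunLike.congr_fun (h1.trans h2) v

end PreferredChart

section PrincipalFunctionGraph

open Filter Topology

variable {r : ℕ} {Q : Type*} [TopologicalSpace Q] [ChartedSpace (EuclideanSpace ℝ (Fin r)) Q]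
  [IsManifold (𝓡 r) ∞ Q] {H : ℝ → CotBundle r Q → ℝ}

theorem cotChart_snd_self (z : CotBundle r Q) (a : EuclideanSpace ℝ (Fin r)) :
    (extChartAt (cotModel r) z z).2 a = z.snd a :=
  (cotChart_snd (mem_extChartAt_source z.proj) a).trans
    (congrArg z.snd (mfderiv_extChartAt_symm_self (J := 𝓡 r) z.proj a))

variable {U : Set (CotBundle r Q)} {φ : CotBundle r Q → CotBundle r Q} {A : CotBundle r Q → ℝ}
  {Φ : CotBundle r Q → ℝ → CotBundle r Q}

/-- Near the end points of a solution, the principal function is continuously differentiable with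
differential `p₁ du₁ - p₀ du₀`. -/
theorem IsActionFlow.contMDiffAt_principalFunction
    (h : IsActionFlow (cotModel r) liouvilleForm (canonicalEquiv _) H 0 1 U φ A Φ)
    (hD : IsDirichlet H) {z : CotBundle r Q} (hz : z ∈ U) :
    ContMDiffAt ((𝓡 r).prod (𝓡 r)) 𝓘(ℝ, ℝ) 1 (principalFunction hD) (z.proj, (φ z).proj) ∧
      (φ z, z) ∈ graphOfDifferential (principalFunction hD) := by
  obtain ⟨V, hV, hzV, hmem, hg, hS, hdS⟩ := h.inCharts isCanonicalOneForm_liouvilleForm hz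
  let x : Q × Q := (z.proj, (φ z).proj)
  let W := principalFunction hD ∘ (extChartAt ((𝓡 r).prod (𝓡 r)) x).symm
  have hsymm : ∀ q, (extChartAt ((𝓡 r).prod (𝓡 r)) x).symm q =
      ((extChartAt (𝓡 r) z.proj).symm q.1, (extChartAt (𝓡 r) (φ z).proj).symm q.2) := fun q ↦ by
    rw [extChartAt_prod]; rfl
  have h0 : ∀ ξ ∈ V, ((extChartAt (cotModel r) z).symm ξ).proj =
      (extChartAt (𝓡 r) z.proj).symm ξ.1 := fun ξ hξ ↦ cotChart_symm_proj (hmem ξ hξ).1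
  have h1 : ∀ ξ ∈ V, (φ ((extChartAt (cotModel r) z).symm ξ)).proj =
      (extChartAt (𝓡 r) (φ z).proj).symm
        (extChartAt (cotModel r) (φ z) (φ ((extChartAt (cotModel r) z).symm ξ))).1 := by
    intro ξ hξ
    rw [cotChart_fst, PartialEquiv.left_inv _ (mem_cotChart_source.1 (hmem ξ hξ).2.2)]
  have hW : ∀ ξ ∈ V, W (ξ.1, (extChartAt (cotModel r) (φ z)
      (φ ((extChartAt (cotModel r) z).symm ξ))).1) = A ((extChartAt (cotModel r) z).symm ξ) := by
    intro ξ hξ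
    rw [← h.principalFunction_eq hD (hmem ξ hξ).2.1, h0 ξ hξ, h1 ξ hξ]
    exact congrArg (principalFunction hD) (hsymm _)
  have hinj : InjOn (fun ξ ↦ (ξ.1, (extChartAt (cotModel r) (φ z)
      (φ ((extChartAt (cotModel r) z).symm ξ))).1)) V := by
    intro ξ hξ η hη he
    obtain ⟨e1, e2⟩ := Prod.mk.inj he
    have e3 := h.eq_of_proj_eq hD (hmem ξ hξ).2.1 (hmem η hη).2.1
      (by rw [h0 ξ hξ, h0 η hη, e1]) (by rw [h1 ξ hξ, h1 η hη, e2])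
    rw [← (extChartAt (cotModel r) z).right_inv (hmem ξ hξ).1, e3,
      (extChartAt (cotModel r) z).right_inv (hmem η hη).1]
  obtain ⟨k1, k2, k3⟩ := contDiffOn_generatingFunction hV hg hS hdS hinj hW
  have hx : extChartAt ((𝓡 r).prod (𝓡 r)) x x = ((extChartAt (cotModel r) z z).1,
      (extChartAt (cotModel r) (φ z) (φ ((extChartAt (cotModel r) z).symm
        (extChartAt (cotModel r) z z)))).1) := by
    rw [(extChartAt (cotModel r) z).left_inv (mem_extChartAt_source z), cotChart_fst, cotChart_fst,
      extChartAt_prod]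
    rfl
  constructor
  · refine contMDiffAt_of_comp_extChartAt_symm ?_
    change ContDiffAt ℝ 1 W (extChartAt ((𝓡 r).prod (𝓡 r)) x x)
    rw [hx]
    exact k3.contDiffAt (k1.mem_nhds ⟨_, hzV, rfl⟩)
  · have k4 := k2 _ hzV
    rw [← hx] at k4
    intro a b
    have k5 := DFunLike.congr_fun (hasMFDerivAt_of_comp_extChartAt_symm k4).mfderiv (a, b)
    refine k5.trans (congrArg₂ (· - ·) ?_ (cotChart_snd_self z a))
    rw [(extChartAt (cotModel r) z).left_inv (mem_extChartAt_source z)]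
    exact cotChart_snd_self (φ z) b

theorem boundaryOneForm_eq (z : CotBundle r Q × CotBundle r Q) :
    boundaryOneForm z = differenceForm (F := EuclideanSpace ℝ (Fin r) × CotFiber r)
      liouvilleForm z := by
  unfold boundaryOneForm
  rw [mfderiv_fst, mfderiv_snd]
  rfl

end PrincipalFunctionGraph

theorem theorem3p6 (r : ℕ) (Q : Type*) [TopologicalSpace Q] [T2Space Q]
    [SecondCountableTopology Q] [ChartedSpace (EuclideanSpace ℝ (Fin r)) Q]
    [IsManifold (𝓡 r) ∞ Q] (H : ℝ → CotBundle r Q → ℝ)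
    (hH : ContMDiffOn (𝓘(ℝ, ℝ).prod (cotModel r)) 𝓘(ℝ, ℝ) ∞
      (fun x : ℝ × CotBundle r Q ↦ H x.1 x.2) (Icc (0 : ℝ) 1 ×ˢ univ))
    (hD : IsDirichlet H) :
    IsLagrangianSubmanifold ((cotModel r).prod (cotModel r)) boundarySymplecticForm
      (boundaryValues H) ∧
    ContMDiff ((𝓡 r).prod (𝓡 r)) 𝓘(ℝ, ℝ) 1 (principalFunction hD) ∧
    boundaryValues H = graphOfDifferential (principalFunction hD) := by
  have hflow : ∀ χ, IsHamiltonSolution H χ → ∃ U φ A Φ, χ 0 ∈ U ∧ φ (χ 0) = χ 1 ∧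
      IsActionFlow (cotModel r) liouvilleForm (canonicalEquiv _) H 0 1 U φ A Φ := fun χ hχ ↦
    isCanonicalOneForm_liouvilleForm.exists_isActionFlow hH zero_lt_one
      (isHamiltonSolution_iff.1 hχ)
  have hlocal : ∀ χ, IsHamiltonSolution H χ → ContMDiffAt ((𝓡 r).prod (𝓡 r)) 𝓘(ℝ, ℝ) 1
      (principalFunction hD) ((χ 0).proj, (χ 1).proj) ∧
      (χ 1, χ 0) ∈ graphOfDifferential (principalFunction hD) := by
    intro χ hχ
    obtain ⟨U, φ, A, Φ, h0, h1, h⟩ := hflow χ hχ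
    have h2 := h.contMDiffAt_principalFunction hD h0
    rwa [h1] at h2
  refine ⟨?_, fun u ↦ ?_, Subset.antisymm ?_ ?_⟩
  · rintro _ ⟨χ, hχ, rfl⟩
    obtain ⟨U, φ, A, Φ, h0, h1, h⟩ := hflow χ hχ
    have h2 := h.exists_isSliceChart isCanonicalOneForm_liouvilleForm h0 (L := boundaryValues H)
      (fun y₁ y₀ hy₀ ↦ h.mem_boundaryValues_iff hH y₁ hy₀)
    rw [h1] at h2
    obtain ⟨Ψ, S, hs, hr, hω⟩ := h2
    refine ⟨Ψ, S, hs, hr, fun v w hv hw ↦ ?_⟩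
    have h3 := hω v w hv hw
    have h4 : (boundaryOneForm : ∀ z : CotBundle r Q × CotBundle r Q, _) =
      differenceForm (F := EuclideanSpace ℝ (Fin r) × CotFiber r) liouvilleForm :=
      funext boundaryOneForm_eq
    unfold boundarySymplecticForm
    rw [h4]
    exact h3
  · obtain ⟨χ, hχ, h0, h1⟩ := (hD u.1 u.2).1
    have h2 := (hlocal χ hχ).1
    rwa [h0, h1] at h2
  · rintro _ ⟨χ, hχ, rfl⟩
    exact (hlocal χ hχ).2
  -- The Dirichlet solution with end points u₀ and u₁ also gives a point of the graph of dW; as dW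
  -- determines both momenta, it is the given one.
  · rintro ⟨⟨u₁, p₁⟩, ⟨u₀, p₀⟩⟩ hz
    obtain ⟨χ, hχ, h0, h1⟩ := (hD u₀ u₁).1
    have h2 := (hlocal χ hχ).2
    refine ⟨χ, hχ, ?_⟩
    generalize χ 0 = z₀ at *
    generalize χ 1 = z₁ at *
    obtain ⟨v₀, q₀⟩ := z₀
    obtain ⟨v₁, q₁⟩ := z₁
    obtain rfl : v₀ = u₀ := h0
    obtain rfl : v₁ = u₁ := h1
    obtain ⟨rfl, rfl⟩ := ContinuousLinearMap.eq_and_eq_of_forall_sub_eq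
      (E := EuclideanSpace ℝ (Fin r)) fun a b ↦ (hz a b).symm.trans (h2 a b)
    rfl
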